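/- **Setting.** Let $d\in\{2,3\}$, let $\Omega\subset\mathbb R^d$ be a bounded, convex, polygonal (polyhedral) domain with boundary $\Gamma=\partial\Omega$, and let $T,m,m_\Gamma>0$, $\kappa\ge 0$. Let $F=F_++F_-$ and $G=G_++G_-$ be bounded from below, with $F_\pm,G_\pm\in C^1(\mathbb R)$, $F_+,G_+$ convex and non-negative, $F_-,G_-$ concave, each of $F_\pm,G_\pm$ being the sum of a polynomial of degree at most four and a $C^1$ function with globally Lipschitz derivative. Let $\beta\ge0$, with $\beta>0$ if $\kappa=0$, be such that $G_-'(s_2)(s_1-s_2)\ge G_-(s_1)-G_-(s_2)+\beta|s_1-s_2|^2$ for all $s_1,s_2\in\mathbb R$. Consider a family of discretizations with parameters $(h,\tau)$, $h>0$, $\tau=T/N$, $N\in\mathbb N$, $N\geq 1$. For each member, let $\mathcal T_h$ be a conforming triangulation of $\overline\Omega$ and $\mathcal T_h^\Gamma$ a conforming triangulation of $\Gamma$, consisting of nonobtuse $d$- and $(d-1)$-simplices, respectively, of diameter at most $h$, such that every element of $\mathcal T_h^\Gamma$ is a face of an element of $\mathcal T_h$. The family is quasiuniform: for some $\rho>0$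 independent of the member, every $d$-simplex (every $(d-1)$-simplex) contains a $d$-dimensional ($(d-1)$-dimensional) ball of radius $\rho h$. Let $U_h^\Omega$, $U_h^\Gamma$ be the spaces of continuous, piecewise linear functions on $\mathcal T_h$, $\mathcal T_h^\Gamma$, and $\mathcal I_h$, $\mathcal I_h^\Gamma$ the nodal interpolation operators. Let $\phi_h^0\in U_h^\Omega$ be initial data with $$\int_\Omega|\nabla\phi_h^0|^2+\int_\Omega\mathcal I_h\{F(\phi_h^0)\}+\kappa\int_\Gamma|\nabla_\Gamma\phi_h^0|^2+\int_\Gamma\mathcal I_h^\Gamma\{G(\phi_h^0)\}\le C_0$$ with $C_0$ independent of the member of the family. Finally assume that, within the family, as $(h,\tau)\searrow0$, $$h^4/\tau\to0\ \text{ if }\kappa>0,\qquad h^2/\tau\to0\ \text{ if }\kappa=0 .$$ A discrete solution consists of $\phi_h^n,\mu_h^n\in U_h^\Omega$ and $\mu_{\Gamma,h}^n\in U_h^\Gamma$, $n=1,\dots,N$, such that for all $n$ and all $\theta_h\in U_h^\Omega$ $$\int_\Omega\mathcal I_h\{\phi_h^n\theta_h\}+\tau m\int_\Omega\nabla\mu_h^n\cdot\nabla\theta_h=\int_\Omega\mathcal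 I_h\{\phi_h^{n-1}\theta_h\},$$ $$\int_\Gamma\mathcal I_h^\Gamma\{\phi_h^n\theta_h\}+\tau m_\Gamma\int_\Gamma\nabla_\Gamma\mu_{\Gamma,h}^n\cdot\nabla_\Gamma\theta_h=\int_\Gamma\mathcal I_h^\Gamma\{\phi_h^{n-1}\theta_h\},$$ $$\begin{aligned}\int_\Omega\mathcal I_h\{\mu_h^n\theta_h\}+\int_\Gamma\mathcal I_h^\Gamma\{\mu_{\Gamma,h}^n\theta_h\}={}&\int_\Omega\nabla\phi_h^n\cdot\nabla\theta_h+\int_\Omega\mathcal I_h\{(F_+'(\phi_h^n)+F_-'(\phi_h^{n-1}))\theta_h\}\\&+\kappa\int_\Gamma\nabla_\Gamma\phi_h^n\cdot\nabla_\Gamma\theta_h+\int_\Gamma\mathcal I_h^\Gamma\{(G_+'(\phi_h^n)+G_-'(\phi_h^{n-1}))\theta_h\}.\end{aligned}$$ **Lemma.** There are $h_0>0$ and $C>0$ such that for every member of the family with $h\le h_0$ every discrete solution satisfies, with $\partial_\tau^-\phi_h^n:=\tau^{-1}(\phi_h^n-\phi_h^{n-1})$, $$\tau\sum_{n=1}^N\|\partial_\tau^-\phi_h^n\|_{(H^1(\Omega))'}^2\le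 C\qquad\text{and}\qquad\tau\sum_{n=1}^N\|\partial_\tau^-\phi_h^n\|_{(H^1(\Gamma))'}^2\le C,$$ where $C$ is independent of $h$ and $\tau$. Here $\|f\|_{(H^1(\Omega))'}=\sup\{|\int_\Omega f\theta| : \|\theta\|_{H^1(\Omega)}\le1\}$, and similarly on $\Gamma$ (where $f$ is restricted to $\Gamma$). -/

import Mathlib

open MeasureTheory Set Filter Topology
open scoped ENNReal NNReal ContDiff Gradient

noncomputable section

namespace CHDyn

/-- `ℝᵈ` with its Euclidean structure. -/
abbrev E (d : ℕ) := EuclideanSpace ℝ (Fin d)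

/-! ### The domain, its boundary, the outer normal -/

/-- Bounded, convex, polygonal (polyhedral) domains: the nonempty interiors of the convex hulls of
finite sets. -/
def IsConvexPolytopalDomain {d : ℕ} (Ω : Set (E d)) : Prop :=
  Ω.Nonempty ∧ ∃ s : Finset (E d), Ω = interior (convexHull ℝ (s : Set (E d)))

/-- Lebesgue measure on the domain. -/
def bulk {d : ℕ} (Ω : Set (E d)) : Measure (E d) := volume.restrict Ω

/-- Surface measure on the boundary `Γ = ∂Ω`: the `(d-1)`-dimensional Hausdorff measure, normalised
so that it is Lebesgue measure on hyperplanes. -/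
def surf {d : ℕ} (Ω : Set (E d)) : Measure (E d) := μHE[d - 1].restrict (frontier Ω)

/-- `ν` is an outer unit normal of the convex set `Ω` at `x`. -/
def IsOuterUnitNormal {d : ℕ} (Ω : Set (E d)) (x ν : E d) : Prop :=
  ‖ν‖ = 1 ∧ ∀ y ∈ Ω, inner ℝ ν (y - x) ≤ 0

open Classical in
/-- The outer unit normal field of a convex domain. It is determined at all points of the boundary of
a polytope that lie in the relative interior of a facet, that is, almost everywhere. -/
def outerNormal {d : ℕ} (Ω : Set (E d)) (x : E d) : E d :=
  if h : ∃ ν, IsOuterUnitNormal Ω x ν then h.choose else 0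

/-- The tangential gradient on the boundary, `∇_Γ v = (I - n ⊗ n) ∇ v`, of a function that only has
to be given on `Γ = ∂Ω`; it is used for functions that are piecewise affine on `Γ`. In the relative
interior of a facet the tangential part of a gradient within `Γ` does not depend on the choice of
that gradient. -/
def surfGrad {d : ℕ} (Ω : Set (E d)) (v : E d → ℝ) (x : E d) : E d :=
  gradientWithin v (frontier Ω) x
    - (inner ℝ (outerNormal Ω x) (gradientWithin v (frontier Ω) x)) • outerNormal Ω x

/-! ### Sobolev spaces on the domain and on its boundary, and the norms of their duals -/

/-- `θ ∈ H¹(Ω)` with weak gradient `g`. -/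
structure IsWeakGrad {d : ℕ} (Ω : Set (E d)) (θ : E d → ℝ) (g : E d → E d) : Prop where
  memLp : MemLp θ 2 (bulk Ω)
  memLp_grad : MemLp g 2 (bulk Ω)
  weak : ∀ ψ : E d → ℝ, ContDiff ℝ ∞ ψ → HasCompactSupport ψ → tsupport ψ ⊆ Ω →
    ∀ i : Fin d, ∫ x, θ x * (∇ ψ x) i ∂(bulk Ω) = -∫ x, g x i * ψ x ∂(bulk Ω)

/-- `θ ∈ H¹(Γ)`, `Γ = ∂Ω`, with weak tangential gradient `g`. With the outer normal `n`, the
tangential derivatives `n_i ∂_j - n_j ∂_i` span all tangential directions and are skew-adjoint on the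
closed surface `Γ`; the field `g` is tangential, and `n_i g_j - n_j g_i` is the weak derivative of
`θ` with respect to each of them. -/
structure IsWeakSurfGrad {d : ℕ} (Ω : Set (E d)) (θ : E d → ℝ) (g : E d → E d) : Prop where
  memLp : MemLp θ 2 (surf Ω)
  memLp_grad : MemLp g 2 (surf Ω)
  tangential : ∀ᵐ x ∂(surf Ω), inner ℝ (outerNormal Ω x) (g x) = 0
  weak : ∀ ψ : E d → ℝ, ContDiff ℝ ∞ ψ → HasCompactSupport ψ → ∀ i j : Fin d,
    ∫ x, θ x * (outerNormal Ω x i * (∇ ψ x) j - outerNormal Ω x j * (∇ ψ x) i) ∂(surf Ω)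
      = -∫ x, (outerNormal Ω x i * g x j - outerNormal Ω x j * g x i) * ψ x ∂(surf Ω)

/-- The norm in `(H¹(Ω))'` of the functional `θ ↦ ∫_Ω f θ`: the supremum of `|∫_Ω f θ|` over the unit
ball of `H¹(Ω)`. -/
def dualNormBulk {d : ℕ} (Ω : Set (E d)) (f : E d → ℝ) : ℝ≥0∞ :=
  ⨆ (θ : E d → ℝ) (g : E d → E d) (_ : IsWeakGrad Ω θ g)
    (_ : ∫ x, θ x ^ 2 ∂(bulk Ω) + ∫ x, ‖g x‖ ^ 2 ∂(bulk Ω) ≤ 1),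
    ENNReal.ofReal |∫ x, f x * θ x ∂(bulk Ω)|

/-- The norm in `(H¹(Γ))'` of the functional `θ ↦ ∫_Γ f θ`: the supremum of `|∫_Γ f θ|` over the unit
ball of `H¹(Γ)`. -/
def dualNormSurf {d : ℕ} (Ω : Set (E d)) (f : E d → ℝ) : ℝ≥0∞ :=
  ⨆ (θ : E d → ℝ) (g : E d → E d) (_ : IsWeakSurfGrad Ω θ g)
    (_ : ∫ x, θ x ^ 2 ∂(surf Ω) + ∫ x, ‖g x‖ ^ 2 ∂(surf Ω) ≤ 1),
    ENNReal.ofReal |∫ x, f x * θ x ∂(surf Ω)|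

/-! ### Triangulations. A simplex is given by the finite set of its vertices. -/

/-- The closed simplex with vertex set `s`. -/
abbrev hull {d : ℕ} (s : Finset (E d)) : Set (E d) := convexHull ℝ (s : Set (E d))

/-- All dihedral angles of the simplex with vertex set `s` are at most `π/2`: for two vertices
`a ≠ b`, the angle at the face `s \ {a, b}` between the facets that omit `b` and `a` is the angle
between the components of `a - p` and `b - p` orthogonal to that face, `p` being any vertex of it.
(There is no such condition on a segment.) -/
def IsNonobtuse {d : ℕ} (s : Finset (E d)) : Prop :=
  ∀ a ∈ s, ∀ b ∈ s, ∀ p ∈ s, a ≠ b → p ≠ a → p ≠ b →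
    0 ≤ inner ℝ
      ((vectorSpan ℝ ((s : Set (E d)) \ {a, b}))ᗮ.starProjection (a - p))
      ((vectorSpan ℝ ((s : Set (E d)) \ {a, b}))ᗮ.starProjection (b - p))

/-- The simplex with vertex set `s` contains a ball of radius `r` of its affine span. -/
def ContainsBall {d : ℕ} (s : Finset (E d)) (r : ℝ) : Prop :=
  ∃ x ∈ affineSpan ℝ (s : Set (E d)),
    Metric.closedBall x r ∩ (affineSpan ℝ (s : Set (E d)) : Set (E d)) ⊆ hull s

/-- `T` is a (conforming) triangulation of the closed set `S` into nonobtuse `k`-simplices, with mesh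
size at most `h`, each of which contains a `k`-dimensional ball of radius `ρ h`. A family of such
triangulations with a common `ρ > 0` is quasiuniform. -/
structure IsTriangulation {d : ℕ} (k : ℕ) (T : Finset (Finset (E d))) (S : Set (E d)) (ρ h : ℝ) :
    Prop where
  card_eq : ∀ s ∈ T, s.card = k + 1
  affineIndependent : ∀ s ∈ T, AffineIndependent ℝ ((↑) : s → E d)
  conforming : ∀ s ∈ T, ∀ t ∈ T,
    hull s ∩ hull t = convexHull ℝ ((s : Set (E d)) ∩ (t : Set (E d)))
  cover : ⋃ s ∈ T, hull s = S
  nonobtuse : ∀ s ∈ T, IsNonobtuse s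
  diam_le : ∀ s ∈ T, Metric.diam (hull s) ≤ h
  containsBall : ∀ s ∈ T, ContainsBall s (ρ * h)

/-- Compatible triangulations `T` of `Ω` and `TΓ` of `Γ = ∂Ω`: the elements of `TΓ` are faces of
elements of `T`. -/
structure IsMesh {d : ℕ} (Ω : Set (E d)) (T TΓ : Finset (Finset (E d))) (ρ h : ℝ) : Prop where
  bulk : IsTriangulation d T (closure Ω) ρ h
  surf : IsTriangulation (d - 1) TΓ (frontier Ω) ρ h
  compatible : ∀ F ∈ TΓ, ∃ K ∈ T, F ⊆ K

/-! ### Piecewise linear finite elements and nodal interpolation -/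

open Classical in
/-- The vertices of a triangulation. -/
def verts {d : ℕ} (T : Finset (Finset (E d))) : Finset (E d) := T.biUnion id

/-- `v` is a continuous, piecewise linear finite element function on `T`
(its values off the triangulated set play no role). -/
def IsFE {d : ℕ} (T : Finset (Finset (E d))) (v : E d → ℝ) : Prop :=
  ContinuousOn v (⋃ s ∈ T, hull s) ∧
    ∀ s ∈ T, ∃ (a : E d) (c : ℝ), ∀ x ∈ hull s, v x = inner ℝ a x + c

open Classical in
/-- The nodal basis function `χ` that belongs to the vertex `p`: the finite element function with
value one at `p` and value zero at all other vertices. -/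
def nodalBasis {d : ℕ} (T : Finset (Finset (E d))) (p : E d) : E d → ℝ :=
  if h : ∃ χ : E d → ℝ, IsFE T χ ∧ ∀ q ∈ verts T, χ q = if q = p then 1 else 0 then h.choose else 0

/-- The nodal interpolation operator. -/
def interp {d : ℕ} (T : Finset (Finset (E d))) (a : E d → ℝ) (x : E d) : ℝ :=
  ∑ p ∈ verts T, a p * nodalBasis T p x

/-! ### The potentials -/

/-- `f` is the sum of a polynomial of degree at most four and a `C¹` function whose derivative is
globally Lipschitz continuous. -/
def HasQuarticSplitting (f : ℝ → ℝ) : Prop :=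
  ∃ (P : Polynomial ℝ) (q : ℝ → ℝ), P.natDegree ≤ 4 ∧ ContDiff ℝ 1 q ∧
    (∃ L : ℝ≥0, LipschitzWith L (deriv q)) ∧ ∀ s, f s = P.eval s + q s

/-- The assumptions on one potential `F = Fp + Fm`, with convex part `Fp` and concave part `Fm`. -/
structure IsPotential (Fp Fm : ℝ → ℝ) : Prop where
  contDiff_convex : ContDiff ℝ 1 Fp
  contDiff_concave : ContDiff ℝ 1 Fm
  convex : ConvexOn ℝ univ Fp
  nonneg : ∀ s, 0 ≤ Fp s
  concave : ConcaveOn ℝ univ Fm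
  bddBelow : ∃ c > 0, ∀ s, -c < Fp s + Fm s
  quartic_convex : HasQuarticSplitting Fp
  quartic_concave : HasQuarticSplitting Fm

/-! ### The discrete scheme -/

/-- The discrete energy bounded at time zero:
`∫_Ω |∇v|² + ∫_Ω I_h F(v) + κ ∫_Γ |∇_Γ v|² + ∫_Γ I_h^Γ G(v)`. -/
def initialEnergy {d : ℕ} (Ω : Set (E d)) (T TΓ : Finset (Finset (E d))) (κ : ℝ)
    (Fp Fm Gp Gm : ℝ → ℝ) (v : E d → ℝ) : ℝ :=
  ∫ x, ‖∇ v x‖ ^ 2 ∂(bulk Ω) + ∫ x, interp T (fun y => Fp (v y) + Fm (v y)) x ∂(bulk Ω)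
    + κ * ∫ x, ‖surfGrad Ω v x‖ ^ 2 ∂(surf Ω)
    + ∫ x, interp TΓ (fun y => Gp (v y) + Gm (v y)) x ∂(surf Ω)

/-- `(φ n, μ n, μΓ n)`, `n = 1, …, N`, solve the finite element scheme with time increment `τ`,
started from `φ 0` (the physical constants `σ`, `δ`, `δ_Γ` being one). -/
structure IsDiscreteSolution {d : ℕ} (Ω : Set (E d)) (T TΓ : Finset (Finset (E d)))
    (m mΓ κ τ : ℝ) (Fp Fm Gp Gm : ℝ → ℝ) (N : ℕ) (φ μ μΓ : ℕ → E d → ℝ) : Prop where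
  phi_mem : ∀ n ≤ N, IsFE T (φ n)
  mu_mem : ∀ n ∈ Finset.Icc 1 N, IsFE T (μ n)
  muG_mem : ∀ n ∈ Finset.Icc 1 N, IsFE TΓ (μΓ n)
  eq_bulk : ∀ n ∈ Finset.Icc 1 N, ∀ θ, IsFE T θ →
    ∫ x, interp T (fun y => φ n y * θ y) x ∂(bulk Ω)
        + τ * m * ∫ x, inner ℝ (∇ (μ n) x) (∇ θ x) ∂(bulk Ω)
      = ∫ x, interp T (fun y => φ (n - 1) y * θ y) x ∂(bulk Ω)
  eq_surf : ∀ n ∈ Finset.Icc 1 N, ∀ θ, IsFE T θ →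
    ∫ x, interp TΓ (fun y => φ n y * θ y) x ∂(surf Ω)
        + τ * mΓ * ∫ x, inner ℝ (surfGrad Ω (μΓ n) x) (surfGrad Ω θ x) ∂(surf Ω)
      = ∫ x, interp TΓ (fun y => φ (n - 1) y * θ y) x ∂(surf Ω)
  eq_potential : ∀ n ∈ Finset.Icc 1 N, ∀ θ, IsFE T θ →
    ∫ x, interp T (fun y => μ n y * θ y) x ∂(bulk Ω)
        + ∫ x, interp TΓ (fun y => μΓ n y * θ y) x ∂(surf Ω)
      = ∫ x, inner ℝ (∇ (φ n) x) (∇ θ x) ∂(bulk Ω)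
        + ∫ x, interp T
            (fun y => (deriv Fp (φ n y) + deriv Fm (φ (n - 1) y)) * θ y) x ∂(bulk Ω)
        + κ * ∫ x, inner ℝ (surfGrad Ω (φ n) x) (surfGrad Ω θ x) ∂(surf Ω)
        + ∫ x, interp TΓ
            (fun y => (deriv Gp (φ n y) + deriv Gm (φ (n - 1) y)) * θ y) x ∂(surf Ω)

/-- The backward difference quotient `∂_τ⁻ φⁿ = τ⁻¹ (φⁿ - φⁿ⁻¹)`, for `n ≥ 1`. -/
def diffQuot {d : ℕ} (τ : ℝ) (φ : ℕ → E d → ℝ) (n : ℕ) (x : E d) : ℝ :=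
  τ⁻¹ * (φ n x - φ (n - 1) x)

end CHDyn

end

namespace CHDyn

variable {d : ℕ}

/-! The scheme has the structure of a gradient flow. Testing the evolution equations with the
chemical potentials and the equation for the potentials with `φ n - φ (n - 1)` makes the lumped
mixed terms cancel. The convex parts are implicit and the concave parts explicit, so the discrete
energy drops by at least the dissipation in each step (`energy_step`). As the energy is bounded
below, and bounded above at time zero, the time integral of `m |∇μ|² + mΓ |∇_Γ μΓ|²` is bounded
uniformly in the discretisation (`energy_estimate`).

For the dual norms, a test function θ in H¹ has to be replaced by a finite element function. The
mass-lumped quasi-interpolant Qθ, with nodal values `∫ θ χ_p / ∫ χ_p` (`clement`), does this without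
error: for a finite element function f, `∫ f θ` equals the lumped product of f and Qθ
(`integral_mul_eq_sum_clement`). For the difference quotient of φ the scheme turns this product into
`-m ∫ ∇μ · ∇Qθ`. What remains is the stability of Q in the H¹ seminorm,
`ofReal_dirichletForm_clement_le`.

Stability is local. Shape regularity bounds the gradient of Qθ on a simplex by a difference of nodal
values over h. Such a difference is a weighted average of `θ x - θ y`, hence controlled by
Poincaré's inequality on a ball of radius `3 * h`, and these balls overlap boundedly. `FEMeasure`
and `PoincareMeasure` collect what the argument needs, so that bulk and boundary are treated at
once.

In the bulk, Poincaré's inequality holds because a ball meets Ω in a convex set. On Γ, which has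
edges and corners, θ is extended to be constant along rays from an interior point c. The extension
is weakly differentiable near Γ, with gradient controlled by that of θ
(`isWeakGrad_radialExtension`). Poincaré's inequality for it on a small ball returns to Γ through
polar coordinates about c (`exists_radialSurface`). -/

theorem mem_verts {T : Finset (Finset (E d))} {p : E d} : p ∈ verts T ↔ ∃ s ∈ T, p ∈ s := by
  simp [verts]

/-! ### Affine functions on a simplex -/

theorem inner_add_le_of_mem_hull {s : Finset (E d)} {A : E d} {c M : ℝ}
    (h : ∀ p ∈ s, inner ℝ A p + c ≤ M) {x : E d} (hx : x ∈ hull s) : inner ℝ A x + c ≤ M := by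
  have hc : Convex ℝ {y : E d | inner ℝ A y ≤ M - c} :=
    convex_halfSpace_le (innerSL ℝ A).toLinearMap.isLinear _
  have := convexHull_min (s := (s : Set (E d))) (fun p hp => by
    have := h p hp
    simp only [mem_ofPred_eq]; linarith) hc hx
  simp only [mem_ofPred_eq] at this
  linarith

theorem le_inner_add_of_mem_hull {s : Finset (E d)} {A : E d} {c M : ℝ}
    (h : ∀ p ∈ s, M ≤ inner ℝ A p + c) {x : E d} (hx : x ∈ hull s) : M ≤ inner ℝ A x + c := by
  have := inner_add_le_of_mem_hull (s := s) (A := -A) (c := -c) (M := -M)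
    (fun p hp => by have := h p hp; rw [inner_neg_left]; linarith) hx
  rw [inner_neg_left] at this
  linarith

theorem inner_add_eq_of_mem_hull {s : Finset (E d)} {A B : E d} {a b : ℝ}
    (h : ∀ p ∈ s, inner ℝ A p + a = inner ℝ B p + b) {x : E d} (hx : x ∈ hull s) :
    inner ℝ A x + a = inner ℝ B x + b := by
  have h1 := inner_add_le_of_mem_hull (s := s) (A := A - B) (c := a - b) (M := 0)
    (fun p hp => by have := h p hp; rw [inner_sub_left]; linarith) hx
  have h2 := le_inner_add_of_mem_hull (s := s) (A := A - B) (c := a - b) (M := 0)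
    (fun p hp => by have := h p hp; rw [inner_sub_left]; linarith) hx
  rw [inner_sub_left] at h1 h2
  linarith

/-- The edges issuing from one vertex are linearly independent, so a linear functional with
prescribed values on them exists on their span. It extends to the whole space, and Riesz
representation gives its gradient. -/
theorem exists_affine_interpolation {s : Finset (E d)}
    (hs : AffineIndependent ℝ ((↑) : s → E d)) (a : E d → ℝ) :
    ∃ (A : E d) (c : ℝ), ∀ p ∈ s, inner ℝ A p + c = a p := by
  rcases s.eq_empty_or_nonempty with rfl | ⟨p₀, hp₀⟩
  · exact ⟨0, 0, by simp⟩
  have hli := (affineIndependent_iff_linearIndependent_vsub ℝ _ (⟨p₀, hp₀⟩ : s)).1 hs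
  obtain ⟨f, hf⟩ := LinearMap.exists_extend
    ((Module.Basis.span hli).constr ℝ (fun i => a i.1 - a p₀))
  have hfv : ∀ p ∈ s, f (p - p₀) = a p - a p₀ := by
    intro p hp
    by_cases hpp : p = p₀
    · simp [hpp]
    let i : {x : s // x ≠ ⟨p₀, hp₀⟩} := ⟨⟨p, hp⟩, fun h => hpp (congrArg Subtype.val h)⟩
    have h1 := congrArg (fun F => F (Module.Basis.span hli i)) hf
    simp only [LinearMap.comp_apply, Module.Basis.constr_basis] at h1
    have h2 : ((Module.Basis.span hli i : Submodule.span ℝ _) : E d) = p - p₀ := by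
      rw [Module.Basis.span_apply]; rfl
    rw [Submodule.subtype_apply, h2] at h1
    exact h1
  refine ⟨(InnerProductSpace.toDual ℝ (E d)).symm f.toContinuousLinearMap,
    a p₀ - f p₀, fun p hp => ?_⟩
  rw [InnerProductSpace.toDual_symm_apply]
  have := hfv p hp
  rw [map_sub] at this
  simp only [LinearMap.coe_toContinuousLinearMap']
  linarith

/-! ### The gradient of an affine function along a simplex -/

open Classical in
/-- The gradient, along the simplex `s`, of the affine function with the vertex values of `v`. -/
noncomputable def locGrad (s : Finset (E d)) (v : E d → ℝ) : E d :=
  if h : ∃ b ∈ vectorSpan ℝ (s : Set (E d)), ∀ p ∈ s, ∀ q ∈ s, inner ℝ b (p - q) = v p - v q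
  then h.choose else 0

/-- The difference of the two vectors is orthogonal to all edges, which span the space it lies in,
hence to itself. -/
theorem eq_of_inner_sub_eq {s : Finset (E d)} {b b' : E d}
    (hb : b ∈ vectorSpan ℝ (s : Set (E d))) (hb' : b' ∈ vectorSpan ℝ (s : Set (E d)))
    (h : ∀ p ∈ s, ∀ q ∈ s, inner ℝ b (p - q) = inner ℝ b' (p - q)) : b = b' := by
  have h1 : ∀ w ∈ vectorSpan ℝ (s : Set (E d)), inner ℝ (b - b') w = 0 := by
    intro w hw
    induction hw using Submodule.span_induction with
    | mem x hx =>
      obtain ⟨p, hp, q, hq, rfl⟩ := hx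
      have := h p hp q hq
      simp only [vsub_eq_sub, inner_sub_left] at this ⊢
      linarith
    | zero => simp
    | add x y _ _ hx hy => rw [inner_add_right, hx, hy, add_zero]
    | smul a x _ hx => rw [inner_smul_right, hx, mul_zero]
  exact sub_eq_zero.1 (inner_self_eq_zero.1 (h1 _ (Submodule.sub_mem _ hb hb')))

/-- Projecting the gradient of any affine interpolant to the direction of the simplex leaves its
pairing with edges unchanged. For a boundary simplex this projection is the tangential gradient. -/
theorem locGrad_spec {s : Finset (E d)} (hs : AffineIndependent ℝ ((↑) : s → E d))
    (v : E d → ℝ) : locGrad s v ∈ vectorSpan ℝ (s : Set (E d)) ∧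
      ∀ p ∈ s, ∀ q ∈ s, inner ℝ (locGrad s v) (p - q) = v p - v q := by
  have h : ∃ b ∈ vectorSpan ℝ (s : Set (E d)), ∀ p ∈ s, ∀ q ∈ s,
      inner ℝ b (p - q) = v p - v q := by
    obtain ⟨A, c, hA⟩ := exists_affine_interpolation hs v
    refine ⟨(vectorSpan ℝ (s : Set (E d))).starProjection A,
      Submodule.starProjection_apply_mem _ _, fun p hp q hq => ?_⟩
    have hpq : p - q ∈ vectorSpan ℝ (s : Set (E d)) := vsub_mem_vectorSpan ℝ hp hq
    rw [Submodule.inner_starProjection_left_eq_right,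
      Submodule.starProjection_eq_self_iff.2 hpq, inner_sub_right]
    have h1 := hA p hp
    have h2 := hA q hq
    linarith
  unfold locGrad
  rw [dif_pos h]
  exact h.choose_spec

theorem locGrad_eq {s : Finset (E d)} (hs : AffineIndependent ℝ ((↑) : s → E d))
    {v : E d → ℝ} {b : E d} (hb : b ∈ vectorSpan ℝ (s : Set (E d)))
    (h : ∀ p ∈ s, ∀ q ∈ s, inner ℝ b (p - q) = v p - v q) : locGrad s v = b :=
  eq_of_inner_sub_eq (locGrad_spec hs v).1 hb fun p hp q hq => by
    rw [(locGrad_spec hs v).2 p hp q hq, h p hp q hq]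

theorem locGrad_congr {s : Finset (E d)} (hs : AffineIndependent ℝ ((↑) : s → E d))
    {v w : E d → ℝ} (h : ∀ p ∈ s, v p = w p) : locGrad s v = locGrad s w :=
  locGrad_eq hs (locGrad_spec hs w).1 fun p hp q hq => by
    rw [(locGrad_spec hs w).2 p hp q hq, h p hp, h q hq]

theorem locGrad_sub {s : Finset (E d)} (hs : AffineIndependent ℝ ((↑) : s → E d))
    (v w : E d → ℝ) : locGrad s (fun x => v x - w x) = locGrad s v - locGrad s w :=
  locGrad_eq hs (Submodule.sub_mem _ (locGrad_spec hs v).1 (locGrad_spec hs w).1)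
    fun p hp q hq => by
      rw [inner_sub_left, (locGrad_spec hs v).2 p hp q hq, (locGrad_spec hs w).2 p hp q hq]
      ring

/-! ### Finite element functions -/

theorem IsFE.exists_affine {T : Finset (Finset (E d))} {v : E d → ℝ} (hv : IsFE T v)
    {s : Finset (E d)} (hs : s ∈ T) :
    ∃ (a : E d) (c : ℝ), ∀ x ∈ hull s, v x = inner ℝ a x + c := hv.2 s hs

theorem mem_hull_of_mem {s : Finset (E d)} {p : E d} (hp : p ∈ s) : p ∈ hull s :=
  subset_convexHull ℝ _ hp

theorem isCompact_hull (s : Finset (E d)) : IsCompact (hull s) :=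
  s.finite_toSet.isCompact_convexHull ℝ

theorem IsFE.le_of_forall_mem {T : Finset (Finset (E d))} {v : E d → ℝ} (hv : IsFE T v)
    {s : Finset (E d)} (hs : s ∈ T) {M : ℝ} (h : ∀ p ∈ s, v p ≤ M) {x : E d}
    (hx : x ∈ hull s) : v x ≤ M := by
  obtain ⟨a, c, hac⟩ := hv.exists_affine hs
  rw [hac x hx]
  exact inner_add_le_of_mem_hull
    (fun p hp => by rw [← hac p (mem_hull_of_mem hp)]; exact h p hp) hx

theorem IsFE.ge_of_forall_mem {T : Finset (Finset (E d))} {v : E d → ℝ} (hv : IsFE T v)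
    {s : Finset (E d)} (hs : s ∈ T) {M : ℝ} (h : ∀ p ∈ s, M ≤ v p) {x : E d}
    (hx : x ∈ hull s) : M ≤ v x := by
  obtain ⟨a, c, hac⟩ := hv.exists_affine hs
  rw [hac x hx]
  exact le_inner_add_of_mem_hull
    (fun p hp => by rw [← hac p (mem_hull_of_mem hp)]; exact h p hp) hx

theorem IsFE.eqOn_hull {T T' : Finset (Finset (E d))} {v w : E d → ℝ} (hv : IsFE T v)
    (hw : IsFE T' w) {s : Finset (E d)} (hs : s ∈ T) (hs' : s ∈ T') (h : ∀ p ∈ s, v p = w p)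
    {x : E d} (hx : x ∈ hull s) : v x = w x := by
  obtain ⟨a, c, hac⟩ := hv.exists_affine hs
  obtain ⟨a', c', hac'⟩ := hw.exists_affine hs'
  rw [hac x hx, hac' x hx]
  exact inner_add_eq_of_mem_hull (fun p hp => by
    rw [← hac p (mem_hull_of_mem hp), ← hac' p (mem_hull_of_mem hp), h p hp]) hx

theorem IsFE.eqOn {T : Finset (Finset (E d))} {v w : E d → ℝ} (hv : IsFE T v) (hw : IsFE T w)
    (h : ∀ p ∈ verts T, v p = w p) {x : E d} (hx : x ∈ ⋃ s ∈ T, hull s) : v x = w x := by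
  simp only [mem_iUnion, exists_prop] at hx
  obtain ⟨s, hs, hx⟩ := hx
  exact hv.eqOn_hull hw hs hs (fun p hp => h p (mem_verts.2 ⟨s, hs, hp⟩)) hx

theorem IsFE.sub {T : Finset (Finset (E d))} {v w : E d → ℝ} (hv : IsFE T v) (hw : IsFE T w) :
    IsFE T (fun x => v x - w x) := by
  refine ⟨hv.1.sub hw.1, fun s hs => ?_⟩
  obtain ⟨a, c, hac⟩ := hv.2 s hs
  obtain ⟨a', c', hac'⟩ := hw.2 s hs
  exact ⟨a - a', c - c', fun x hx => by
    simp only [hac x hx, hac' x hx, inner_sub_left]; ring⟩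

theorem IsFE.const_mul {T : Finset (Finset (E d))} {v : E d → ℝ} (hv : IsFE T v) (r : ℝ) :
    IsFE T (fun x => r * v x) := by
  refine ⟨hv.1.const_mul r, fun s hs => ?_⟩
  obtain ⟨a, c, hac⟩ := hv.2 s hs
  exact ⟨r • a, r * c, fun x hx => by
    simp only [hac x hx, real_inner_smul_left]; ring⟩

theorem isFE_zero (T : Finset (Finset (E d))) : IsFE T (fun _ => 0) :=
  ⟨continuousOn_const, fun s _ => ⟨0, 0, by simp⟩⟩

theorem isFE_const (T : Finset (Finset (E d))) (r : ℝ) : IsFE T (fun _ => r) :=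
  ⟨continuousOn_const, fun s _ => ⟨0, r, by simp⟩⟩

theorem IsFE.add {T : Finset (Finset (E d))} {v w : E d → ℝ} (hv : IsFE T v) (hw : IsFE T w) :
    IsFE T (fun x => v x + w x) := by
  have := hv.sub (hw.const_mul (-1))
  simpa using this

theorem IsFE.sum {T : Finset (Finset (E d))} {α : Type*} (A : Finset α) {v : α → E d → ℝ}
    (hv : ∀ i ∈ A, IsFE T (v i)) : IsFE T (fun x => ∑ i ∈ A, v i x) := by
  classical
  induction A using Finset.induction_on with
  | empty => simpa using isFE_zero T
  | insert a A ha ih =>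
    simp only [Finset.sum_insert ha]
    exact (hv a (by simp)).add (ih fun i hi => hv i (by simp [hi]))

/-- Affine interpolants on the single simplices are glued. By conformity two simplices meet in the
hull of their common vertices, where both interpolants have the same vertex values; continuity then
follows from the finite closed cover. -/
theorem exists_isFE {T : Finset (Finset (E d))}
    (hai : ∀ s ∈ T, AffineIndependent ℝ ((↑) : s → E d))
    (hconf : ∀ s ∈ T, ∀ t ∈ T, hull s ∩ hull t = convexHull ℝ ((s : Set (E d)) ∩ (t : Set (E d))))
    (a : E d → ℝ) : ∃ v, IsFE T v ∧ ∀ p ∈ verts T, v p = a p := by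
  classical
  have hex : ∀ s : Finset (E d), ∃ Ac : E d × ℝ, s ∈ T → ∀ p ∈ s, inner ℝ Ac.1 p + Ac.2 = a p := by
    intro s
    by_cases hs : s ∈ T
    · obtain ⟨A, c, h⟩ := exists_affine_interpolation (hai s hs) a
      exact ⟨(A, c), fun _ => h⟩
    · exact ⟨0, fun h => absurd h hs⟩
  choose Ac hAc using hex
  let v : E d → ℝ := fun x => if h : ∃ s ∈ T, x ∈ hull s then
    inner ℝ (Ac h.choose).1 x + (Ac h.choose).2 else 0
  have hv : ∀ s ∈ T, ∀ x ∈ hull s, v x = inner ℝ (Ac s).1 x + (Ac s).2 := by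
    intro s hs x hx
    have h : ∃ s ∈ T, x ∈ hull s := ⟨s, hs, hx⟩
    simp only [v, dif_pos h]
    obtain ⟨ht, hxt⟩ := h.choose_spec
    set t := h.choose
    have hmem : x ∈ hull (s ∩ t) := by
      have : x ∈ hull s ∩ hull t := ⟨hx, hxt⟩
      rw [hconf s hs t ht] at this
      simpa [hull] using this
    refine inner_add_eq_of_mem_hull (s := s ∩ t) (fun p hp => ?_) hmem
    rw [Finset.mem_inter] at hp
    rw [hAc t ht p hp.2, hAc s hs p hp.1]
  refine ⟨v, ⟨?_, fun s hs => ⟨_, _, hv s hs⟩⟩, fun p hp => ?_⟩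
  · have hf : (⋃ s ∈ T, hull s) = ⋃ s : T, hull s.1 := by
      ext x; simp
    rw [hf]
    refine LocallyFinite.continuousOn_iUnion (locallyFinite_of_finite _)
      (fun s => (isCompact_hull s.1).isClosed) fun s => ?_
    refine ContinuousOn.congr (f := fun x => inner ℝ (Ac s.1).1 x + (Ac s.1).2) ?_
      (fun x hx => hv s.1 s.2 x hx)
    fun_prop
  · obtain ⟨s, hs, hp⟩ := mem_verts.1 hp
    rw [hv s hs p (mem_hull_of_mem hp), hAc s hs p hp]

/-! ### Nodal basis and interpolation -/

section Triangulation

variable {k : ℕ} {T : Finset (Finset (E d))} {S : Set (E d)} {ρ h : ℝ}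

theorem IsTriangulation.exists_isFE (hT : IsTriangulation k T S ρ h) (a : E d → ℝ) :
    ∃ v, IsFE T v ∧ ∀ p ∈ verts T, v p = a p :=
  CHDyn.exists_isFE hT.affineIndependent hT.conforming a

theorem IsTriangulation.isFE_nodalBasis (hT : IsTriangulation k T S ρ h) (p : E d) :
    IsFE T (nodalBasis T p) ∧ ∀ q ∈ verts T, nodalBasis T p q = if q = p then 1 else 0 := by
  classical
  have h : ∃ χ : E d → ℝ, IsFE T χ ∧ ∀ q ∈ verts T, χ q = if q = p then 1 else 0 := by
    obtain ⟨v, hv, hv'⟩ := hT.exists_isFE (fun q => if q = p then 1 else 0)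
    exact ⟨v, hv, hv'⟩
  have h2 := h.choose_spec
  unfold nodalBasis
  rw [dif_pos h]
  refine ⟨h2.1, fun q hq => ?_⟩
  rw [h2.2 q hq]

theorem IsTriangulation.isFE_interp (hT : IsTriangulation k T S ρ h) (a : E d → ℝ) :
    IsFE T (interp T a) ∧ ∀ q ∈ verts T, interp T a q = a q := by
  classical
  refine ⟨IsFE.sum _ fun p _ => (hT.isFE_nodalBasis p).1.const_mul (a p), fun q hq => ?_⟩
  unfold interp
  rw [Finset.sum_eq_single q]
  · rw [(hT.isFE_nodalBasis q).2 q hq]; simp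
  · intro p _ hpq
    rw [(hT.isFE_nodalBasis p).2 q hq, if_neg (Ne.symm hpq), mul_zero]
  · exact fun h => absurd hq h

theorem IsTriangulation.interp_eq (hT : IsTriangulation k T S ρ h) {v : E d → ℝ} (hv : IsFE T v)
    {x : E d} (hx : x ∈ S) : interp T v x = v x := by
  rw [← hT.cover] at hx
  exact (hT.isFE_interp v).1.eqOn hv (hT.isFE_interp v).2 hx

theorem IsTriangulation.nodalBasis_nonneg (hT : IsTriangulation k T S ρ h) (p : E d)
    {x : E d} (hx : x ∈ S) : 0 ≤ nodalBasis T p x := by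
  classical
  rw [← hT.cover] at hx
  simp only [mem_iUnion, exists_prop] at hx
  obtain ⟨s, hs, hx⟩ := hx
  refine (hT.isFE_nodalBasis p).1.ge_of_forall_mem hs (fun q hq => ?_) hx
  rw [(hT.isFE_nodalBasis p).2 q (mem_verts.2 ⟨s, hs, hq⟩)]
  split_ifs <;> norm_num

theorem IsTriangulation.nodalBasis_le_one (hT : IsTriangulation k T S ρ h) (p : E d)
    {x : E d} (hx : x ∈ S) : nodalBasis T p x ≤ 1 := by
  classical
  rw [← hT.cover] at hx
  simp only [mem_iUnion, exists_prop] at hx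
  obtain ⟨s, hs, hx⟩ := hx
  refine (hT.isFE_nodalBasis p).1.le_of_forall_mem hs (fun q hq => ?_) hx
  rw [(hT.isFE_nodalBasis p).2 q (mem_verts.2 ⟨s, hs, hq⟩)]
  split_ifs <;> norm_num

theorem IsTriangulation.dist_le (hT : IsTriangulation k T S ρ h) {s : Finset (E d)} (hs : s ∈ T)
    {x y : E d} (hx : x ∈ hull s) (hy : y ∈ hull s) : dist x y ≤ h :=
  (Metric.dist_le_diam_of_mem (isCompact_hull s).isBounded hx hy).trans (hT.diam_le s hs)

/-- A simplex that contains `x` has all its vertices within distance `h` of `x`, so `p` is not one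
of them. -/
theorem IsTriangulation.nodalBasis_eq_zero (hT : IsTriangulation k T S ρ h) {p : E d}
    {x : E d} (hx : x ∈ S) (hpx : h < dist x p) : nodalBasis T p x = 0 := by
  classical
  rw [← hT.cover] at hx
  simp only [mem_iUnion, exists_prop] at hx
  obtain ⟨s, hs, hx⟩ := hx
  refine (hT.isFE_nodalBasis p).1.eqOn_hull (isFE_zero T) hs hs (fun q hq => ?_) hx
  rw [(hT.isFE_nodalBasis p).2 q (mem_verts.2 ⟨s, hs, hq⟩), if_neg]
  rintro rfl
  exact absurd (hT.dist_le hs hx (mem_hull_of_mem hq)) (not_le.2 hpx)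

theorem IsTriangulation.sum_nodalBasis (hT : IsTriangulation k T S ρ h) {x : E d} (hx : x ∈ S) :
    ∑ p ∈ verts T, nodalBasis T p x = 1 := by
  have := hT.interp_eq (isFE_const T 1) hx
  simpa [interp] using this

theorem IsTriangulation.isCompact (hT : IsTriangulation k T S ρ h) : IsCompact S := by
  rw [← hT.cover]
  exact T.finite_toSet.isCompact_biUnion fun s _ => isCompact_hull s

theorem IsTriangulation.hull_subset (hT : IsTriangulation k T S ρ h) {s : Finset (E d)}
    (hs : s ∈ T) : hull s ⊆ S := by
  rw [← hT.cover]
  exact subset_biUnion_of_mem (u := fun s => hull s) hs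

theorem IsTriangulation.mem_of_mem_verts (hT : IsTriangulation k T S ρ h) {p : E d}
    (hp : p ∈ verts T) : p ∈ S := by
  obtain ⟨s, hs, hp⟩ := mem_verts.1 hp
  exact hT.hull_subset hs (mem_hull_of_mem hp)

end Triangulation

/-! ### Hausdorff measures of simplices -/

theorem finrank_vectorSpan_lt {k : ℕ} (hk : 1 ≤ k) {u : Finset (E d)} (hu : u.card ≤ k) :
    Module.finrank ℝ (vectorSpan ℝ (u : Set (E d))) < k := by
  classical
  rcases u.eq_empty_or_nonempty with rfl | hne
  · rw [Finset.coe_empty, vectorSpan_empty, finrank_bot]; omega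
  · have h1 : u.card = (u.card - 1) + 1 := by have := hne.card_pos; omega
    have := finrank_vectorSpan_image_finset_le ℝ (id : E d → E d) u h1
    rw [Finset.coe_image, image_id] at this
    omega

/-- At most `k` points span an affine space of dimension less than `k`, and the hull lies in a
Lipschitz image of its direction. -/
theorem euclideanHausdorffMeasure_hull_eq_zero {k : ℕ} (hk : 1 ≤ k) {u : Finset (E d)}
    (hu : u.card ≤ k) : (μHE[k] : Measure (E d)) (hull u) = 0 := by
  rcases u.eq_empty_or_nonempty with rfl | ⟨p, hp⟩
  · simp [hull]
  set V := vectorSpan ℝ (u : Set (E d))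
  have hsub : hull u ⊆ (fun w : V => (w : E d) + p) '' univ := by
    intro x hx
    have hx' : x ∈ affineSpan ℝ (u : Set (E d)) := convexHull_subset_affineSpan _ hx
    have hp' : p ∈ affineSpan ℝ (u : Set (E d)) := subset_affineSpan ℝ _ hp
    have := AffineSubspace.vsub_mem_direction hx' hp'
    rw [direction_affineSpan] at this
    exact ⟨⟨x - p, this⟩, mem_univ _, by simp⟩
  have hlip : LipschitzWith 1 (fun w : V => (w : E d) + p) :=
    LipschitzWith.of_dist_le_mul fun x y => by simp [dist_add_right, Subtype.dist_eq]
  have hdim : dimH (hull u) < ((k : ℝ≥0) : ℝ≥0∞) := by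
    refine lt_of_le_of_lt (dimH_mono hsub) ((hlip.dimH_image_le _).trans_lt ?_)
    rw [Real.dimH_univ_eq_finrank]
    have : Module.finrank ℝ V < k := finrank_vectorSpan_lt hk hu
    exact_mod_cast this
  rw [Measure.euclideanHausdorffMeasure_def, Measure.smul_apply]
  have := hausdorffMeasure_of_dimH_lt hdim
  simp only [NNReal.coe_natCast] at this
  rw [this, smul_zero]

/-- Such an isometry identifies the `k`-dimensional Hausdorff measure on the plane of the simplex
with Lebesgue measure on ℝᵏ. -/
theorem exists_isometry_affineSpan {k : ℕ} {s : Finset (E d)} (hcard : s.card = k + 1)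
    (hs : AffineIndependent ℝ ((↑) : s → E d)) {x : E d}
    (hx : x ∈ affineSpan ℝ (s : Set (E d))) :
    ∃ j : E k → E d, Isometry j ∧ j 0 = x ∧ range j = affineSpan ℝ (s : Set (E d)) := by
  have hfr : Module.finrank ℝ (vectorSpan ℝ (s : Set (E d))) = k := by
    have := hs.finrank_vectorSpan (n := k) (by simpa using hcard)
    have hr : vectorSpan ℝ (range ((↑) : s → E d)) = vectorSpan ℝ (s : Set (E d)) := by
      congr 1; ext; simp
    rw [← this]
    exact (LinearEquiv.ofEq _ _ hr).finrank_eq.symm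
  let b := (stdOrthonormalBasis ℝ (vectorSpan ℝ (s : Set (E d)))).reindex (finCongr hfr)
  refine ⟨fun w => (b.repr.symm w : E d) + x, ?_, by simp, ?_⟩
  · refine Isometry.of_dist_eq fun y z => ?_
    rw [dist_add_right, ← Subtype.dist_eq]
    exact b.repr.symm.isometry.dist_eq y z
  · ext y
    constructor
    · rintro ⟨w, rfl⟩
      have h1 : (b.repr.symm w : E d) ∈ (affineSpan ℝ (s : Set (E d))).direction := by
        rw [direction_affineSpan]; exact (b.repr.symm w).2
      exact AffineSubspace.vadd_mem_of_mem_direction h1 hx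
    · intro hy
      have := AffineSubspace.vsub_mem_direction hy hx
      rw [direction_affineSpan] at this
      exact ⟨b.repr ⟨y - x, this⟩, by simp⟩

theorem euclideanHausdorffMeasure_closedBall_inter {k : ℕ} {s : Finset (E d)}
    (hcard : s.card = k + 1) (hs : AffineIndependent ℝ ((↑) : s → E d)) {x : E d}
    (hx : x ∈ affineSpan ℝ (s : Set (E d))) (t : ℝ) :
    (μHE[k] : Measure (E d)) (Metric.closedBall x t ∩ affineSpan ℝ (s : Set (E d)))
      = volume (Metric.closedBall (0 : E k) t) := by
  obtain ⟨j, hj, hj0, hjr⟩ := exists_isometry_affineSpan hcard hs hx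
  rw [← hjr, ← hj0, ← hj.euclideanHausdorffMeasure_preimage, hj.preimage_closedBall,
    EuclideanSpace.euclideanHausdorffMeasure_eq_volume]

theorem euclideanHausdorffMeasure_hull_lt_top {k : ℕ} {s : Finset (E d)}
    (hcard : s.card = k + 1) (hs : AffineIndependent ℝ ((↑) : s → E d)) :
    (μHE[k] : Measure (E d)) (hull s) < ⊤ := by
  obtain ⟨p, hp⟩ : s.Nonempty := Finset.card_pos.1 (by omega)
  have hp' : p ∈ affineSpan ℝ (s : Set (E d)) := subset_affineSpan ℝ _ hp
  refine lt_of_le_of_lt (measure_mono (t := Metric.closedBall p (Metric.diam (hull s)) ∩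
    affineSpan ℝ (s : Set (E d))) fun x hx => ⟨?_, convexHull_subset_affineSpan _ hx⟩) ?_
  · exact Metric.dist_le_diam_of_mem (isCompact_hull s).isBounded hx (mem_hull_of_mem hp)
  · rw [euclideanHausdorffMeasure_closedBall_inter hcard hs hp']
    exact measure_closedBall_lt_top

/-! ### Finite elements with respect to a measure -/

/-- A triangulation of `S`, a finite measure `σ` on `S` for which different simplices overlap in null
sets only, and a gradient `D` that acts on finite element functions, simplex by simplex, as the
gradient along the simplex. -/
structure FEMeasure (k : ℕ) (T : Finset (Finset (E d))) (S : Set (E d)) (ρ h : ℝ)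
    (σ : Measure (E d)) (D : (E d → ℝ) → E d → E d) : Prop where
  tri : IsTriangulation k T S ρ h
  finite : IsFiniteMeasure σ
  compl_null : σ Sᶜ = 0
  overlap_null : ∀ s ∈ T, ∀ t ∈ T, s ≠ t → σ (hull s ∩ hull t) = 0
  grad : ∀ v, IsFE T v → ∀ s ∈ T, ∀ᵐ x ∂(σ.restrict (hull s)), D v x = locGrad s v

theorem card_inter_le {k : ℕ} {s t : Finset (E d)} [DecidableEq (E d)] (hs : s.card = k + 1)
    (ht : t.card = k + 1) (hst : s ≠ t) : (s ∩ t).card ≤ k := by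
  have h1 : (s ∩ t).card ≤ s.card := Finset.card_le_card Finset.inter_subset_left
  rcases h1.lt_or_eq with h1 | h1
  · omega
  · have h2 : s ∩ t = s := Finset.eq_of_subset_of_card_le Finset.inter_subset_left h1.ge
    have h3 : s ⊆ t := Finset.inter_eq_left.1 h2
    exact absurd (Finset.eq_of_subset_of_card_le h3 (by omega)) hst

theorem IsTriangulation.overlap_null {k : ℕ} (hk : 1 ≤ k) {T : Finset (Finset (E d))}
    {S : Set (E d)} {ρ h : ℝ} (hT : IsTriangulation k T S ρ h) {s t : Finset (E d)} (hs : s ∈ T)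
    (ht : t ∈ T) (hst : s ≠ t) : (μHE[k] : Measure (E d)) (hull s ∩ hull t) = 0 := by
  classical
  rw [hT.conforming s hs t ht, ← Finset.coe_inter]
  exact euclideanHausdorffMeasure_hull_eq_zero hk
    (card_inter_le (hT.card_eq s hs) (hT.card_eq t ht) hst)

theorem IsTriangulation.euclideanHausdorffMeasure_lt_top {k : ℕ} {T : Finset (Finset (E d))}
    {S : Set (E d)} {ρ h : ℝ} (hT : IsTriangulation k T S ρ h) :
    (μHE[k] : Measure (E d)) S < ⊤ := by
  rw [← hT.cover]
  refine lt_of_le_of_lt (measure_biUnion_finset_le _ _) (ENNReal.sum_lt_top.2 fun s hs => ?_)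
  exact euclideanHausdorffMeasure_hull_lt_top (hT.card_eq s hs) (hT.affineIndependent s hs)

/-! ### The domain -/

theorem IsConvexPolytopalDomain.isOpen {Ω : Set (E d)} (hΩ : IsConvexPolytopalDomain Ω) :
    IsOpen Ω := by
  obtain ⟨-, s, rfl⟩ := hΩ
  exact isOpen_interior

theorem IsConvexPolytopalDomain.convex {Ω : Set (E d)} (hΩ : IsConvexPolytopalDomain Ω) :
    Convex ℝ Ω := by
  obtain ⟨-, s, rfl⟩ := hΩ
  exact (convex_convexHull ℝ _).interior

theorem IsConvexPolytopalDomain.isBounded {Ω : Set (E d)} (hΩ : IsConvexPolytopalDomain Ω) :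
    Bornology.IsBounded Ω := by
  obtain ⟨-, s, rfl⟩ := hΩ
  exact (isCompact_hull s).isBounded.subset interior_subset

theorem euclideanHausdorffMeasure_eq_volume : (μHE[d] : Measure (E d)) = volume :=
  EuclideanSpace.euclideanHausdorffMeasure_eq_volume d

theorem bulk_feMeasure (hd : 1 ≤ d) {Ω : Set (E d)} (hΩ : Bornology.IsBounded Ω)
    {T : Finset (Finset (E d))} {ρ h : ℝ} (hT : IsTriangulation d T (closure Ω) ρ h) :
    FEMeasure d T (closure Ω) ρ h (bulk Ω) (fun v => ∇ v) where
  tri := hT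
  finite := ⟨by
    rw [bulk, Measure.restrict_apply_univ]
    exact hΩ.measure_lt_top⟩
  compl_null := by
    rw [bulk, Measure.restrict_apply isClosed_closure.measurableSet.compl]
    have : (closure Ω)ᶜ ∩ Ω = ∅ := by
      ext x; simp only [mem_inter_iff, mem_compl_iff, mem_empty_iff_false, iff_false]
      exact fun hx => hx.1 (subset_closure hx.2)
    rw [this, measure_empty]
  overlap_null s hs t ht hst := by
    refine le_antisymm ((Measure.restrict_apply_le _ _).trans ?_) zero_le
    rw [← euclideanHausdorffMeasure_eq_volume, hT.overlap_null hd hs ht hst]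
  grad v hv s hs := by
    -- The boundary of a convex set is a null set, and at interior points of the simplex the
    -- function is affine in a full neighbourhood.
    have hfr : ∀ᵐ x ∂(volume.restrict (hull s) : Measure (E d)), x ∈ interior (hull s) := by
      rw [ae_restrict_iff' (isCompact_hull s).isClosed.measurableSet]
      have h0 : (volume : Measure (E d)) (frontier (hull s)) = 0 :=
        (convex_convexHull ℝ _).addHaar_frontier _
      rw [← compl_mem_ae_iff] at h0
      filter_upwards [h0] with x hx hxs
      by_contra hcon
      exact hx ⟨subset_closure hxs, hcon⟩
    have hle : (bulk Ω).restrict (hull s) ≤ volume.restrict (hull s) :=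
      Measure.restrict_mono le_rfl Measure.restrict_le_self
    obtain ⟨a, c, hac⟩ := hv.exists_affine hs
    have hai := hT.affineIndependent s hs
    have hloc : locGrad s v = a := by
      refine locGrad_eq hai ?_ fun p hp q hq => ?_
      · have htop : vectorSpan ℝ (s : Set (E d)) = ⊤ := by
          have := hai.vectorSpan_eq_top_of_card_eq_finrank_add_one (by
            simpa using hT.card_eq s hs)
          simpa using this
        rw [htop]; trivial
      · rw [hac p (mem_hull_of_mem hp), hac q (mem_hull_of_mem hq), inner_sub_right]; ring
    rw [hloc]
    refine (Measure.absolutelyContinuous_of_le hle).ae_le ?_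
    filter_upwards [hfr] with x hx
    have heq : v =ᶠ[𝓝 x] fun y => inner ℝ a y + c := by
      filter_upwards [mem_interior_iff_mem_nhds.1 hx] with y hy using hac y hy
    have hg : HasGradientAt (fun y => inner ℝ a y + c) a x := by
      rw [hasGradientAt_iff_hasFDerivAt]
      exact ((InnerProductSpace.toDual ℝ (E d) a).hasFDerivAt (x := x)).add_const c
    exact (hg.congr_of_eventuallyEq heq).gradient

/-! ### Outer normals -/

/-- Hahn-Banach separates the open convex set from the boundary point; the normalised Riesz vector
of the functional is a normal. -/
theorem exists_isOuterUnitNormal {Ω : Set (E d)} (ho : IsOpen Ω) (hc : Convex ℝ Ω)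
    (hne : Ω.Nonempty) {x : E d} (hx : x ∈ frontier Ω) : ∃ ν, IsOuterUnitNormal Ω x ν := by
  have hxΩ : x ∉ Ω := by
    rw [ho.frontier_eq] at hx; exact hx.2
  obtain ⟨f, hf⟩ := geometric_hahn_banach_open_point hc ho hxΩ
  set ν₀ := (InnerProductSpace.toDual ℝ (E d)).symm f
  have hν₀ : ∀ y, inner ℝ ν₀ y = f y := fun y => InnerProductSpace.toDual_symm_apply
  obtain ⟨y₀, hy₀⟩ := hne
  have hne0 : ν₀ ≠ 0 := by
    intro h
    have h1 := hf y₀ hy₀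
    rw [← hν₀, ← hν₀, h] at h1
    simp at h1
  refine ⟨‖ν₀‖⁻¹ • ν₀, norm_smul_inv_norm hne0, fun y hy => ?_⟩
  rw [real_inner_smul_left, inner_sub_right, hν₀, hν₀]
  exact mul_nonpos_of_nonneg_of_nonpos (by positivity) (by linarith [hf y hy])

theorem isOuterUnitNormal_outerNormal {Ω : Set (E d)} (ho : IsOpen Ω) (hc : Convex ℝ Ω)
    (hne : Ω.Nonempty) {x : E d} (hx : x ∈ frontier Ω) :
    IsOuterUnitNormal Ω x (outerNormal Ω x) := by
  have h := exists_isOuterUnitNormal ho hc hne hx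
  unfold outerNormal
  rw [dif_pos h]
  exact h.choose_spec

theorem IsOuterUnitNormal.inner_le_of_mem_closure {Ω : Set (E d)} {x ν : E d} (h : IsOuterUnitNormal Ω x ν) :
    ∀ y ∈ closure Ω, inner ℝ ν (y - x) ≤ 0 := by
  have hcl : IsClosed {y : E d | inner ℝ ν (y - x) ≤ 0} :=
    isClosed_le (by fun_prop) continuous_const
  exact closure_minimal h.2 hcl

/-- The supporting half-space contains the extreme point `c + r • ν` of the ball. This positive
lower bound keeps the Jacobian of polar coordinates about `c` away from zero. -/
theorem IsOuterUnitNormal.le_inner {Ω : Set (E d)} {x ν c : E d} {r : ℝ}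
    (h : IsOuterUnitNormal Ω x ν) (hr : 0 < r) (hball : Metric.ball c r ⊆ Ω) :
    r ≤ inner ℝ ν (x - c) := by
  have h1 : c + r • ν ∈ closure Ω := by
    refine closure_mono hball ?_
    rw [closure_ball _ hr.ne', Metric.mem_closedBall, dist_eq_norm, add_sub_cancel_left, norm_smul,
      h.1, mul_one, Real.norm_of_nonneg hr.le]
  have h2 := h.inner_le_of_mem_closure _ h1
  have h3 : inner ℝ ν (c + r • ν - x) = r - inner ℝ ν (x - c) := by
    rw [show c + r • ν - x = r • ν - (x - c) by abel, inner_sub_right, real_inner_smul_right,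
      real_inner_self_eq_norm_sq, h.1]
    ring
  linarith

/-! ### The relative interior of a simplex -/

open Classical in
/-- The points of a simplex that lie on none of its proper faces. -/
def simplexCore (s : Finset (E d)) : Set (E d) :=
  {x ∈ hull s | ∀ p ∈ s, x ∉ hull (s.erase p)}

theorem exists_pos_weights {s : Finset (E d)} {x : E d} (hx : x ∈ simplexCore s) :
    ∃ w : E d → ℝ, (∀ p ∈ s, 0 < w p) ∧ ∑ p ∈ s, w p = 1 ∧ ∑ p ∈ s, w p • p = x := by
  classical
  obtain ⟨hxs, hxe⟩ := hx
  obtain ⟨w, hw0, hw1, hwx⟩ := Finset.mem_convexHull'.1 hxs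
  refine ⟨w, fun p hp => (hw0 p hp).lt_of_ne fun h0 => ?_, hw1, hwx⟩
  refine hxe p hp (Finset.mem_convexHull'.2 ⟨w, fun q hq => hw0 q (Finset.mem_of_mem_erase hq),
    ?_, ?_⟩)
  · rw [← hw1, ← Finset.add_sum_erase s w hp, ← h0, zero_add]
  · rw [← hwx, ← Finset.add_sum_erase s (fun p => w p • p) hp, ← h0, zero_smul, zero_add]

theorem simplexCore_diff_null {k : ℕ} (hk : 1 ≤ k) {s : Finset (E d)} (hs : s.card = k + 1) :
    (μHE[k] : Measure (E d)) (hull s \ simplexCore s) = 0 := by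
  classical
  refine measure_mono_null (t := ⋃ p ∈ s, hull (s.erase p)) ?_ ?_
  · intro x hx
    by_contra hcon
    simp only [mem_iUnion, exists_prop, not_exists, not_and] at hcon
    exact hx.2 ⟨hx.1, by convert hcon⟩
  · refine (measure_biUnion_null_iff s.countable_toSet).2 ?_
    intro p hp
    refine euclideanHausdorffMeasure_hull_eq_zero hk ?_
    rw [Finset.card_erase_of_mem hp]; omega

/-- If `t` missed a vertex of `s`, conformity would put `x` into the face of `s` opposite to that
vertex. -/
theorem IsTriangulation.eq_of_mem_simplexCore {k : ℕ} {T : Finset (Finset (E d))} {S : Set (E d)}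
    {ρ h : ℝ} (hT : IsTriangulation k T S ρ h) {s t : Finset (E d)} (hs : s ∈ T) (ht : t ∈ T)
    {x : E d} (hx : x ∈ simplexCore s) (hxt : x ∈ hull t) : s = t := by
  classical
  have hx2 : x ∈ hull s ∩ hull t := ⟨hx.1, hxt⟩
  rw [hT.conforming s hs t ht] at hx2
  refine Finset.eq_of_subset_of_card_le (fun p hp => ?_)
    (by rw [hT.card_eq s hs, hT.card_eq t ht])
  by_contra hpt
  have hsub : (s : Set (E d)) ∩ (t : Set (E d)) ⊆ (s.erase p : Finset (E d)) := by
    intro q hq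
    simp only [Finset.coe_erase, Set.mem_sdiff, mem_singleton_iff]
    exact ⟨hq.1, fun h => hpt (by rw [← h]; exact hq.2)⟩
  refine hx.2 p hp ?_
  convert convexHull_mono hsub hx2

/-- The point is a convex combination of the vertices with positive weights, and nonpositive numbers
whose sum with positive weights vanishes are all zero. Thus a supporting hyperplane at a relative
interior point contains the whole simplex. -/
theorem inner_eq_zero_of_mem_simplexCore {s : Finset (E d)} {x ν : E d} (hx : x ∈ simplexCore s)
    (h : ∀ p ∈ s, inner ℝ ν (p - x) ≤ 0) : ∀ p ∈ s, inner ℝ ν (p - x) = 0 := by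
  obtain ⟨w, hw0, hw1, hwx⟩ := exists_pos_weights hx
  have hsum : ∑ p ∈ s, w p * inner ℝ ν (p - x) = 0 := by
    have h1 : ∑ p ∈ s, w p • (p - x) = 0 := by
      simp only [smul_sub, Finset.sum_sub_distrib, ← Finset.sum_smul, hw1, hwx, one_smul, sub_self]
    have h2 := congrArg (inner ℝ ν) h1
    rw [inner_sum, inner_zero_right] at h2
    simpa only [real_inner_smul_right] using h2
  intro p hp
  have h3 := (Finset.sum_eq_zero_iff_of_nonpos
    (fun q hq => mul_nonpos_of_nonneg_of_nonpos (hw0 q hq).le (h q hq))).1 hsum p hp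
  exact (mul_eq_zero.1 h3).resolve_left (hw0 p hp).ne'

theorem mem_vectorSpan_orthogonal {s : Finset (E d)} {x ν : E d}
    (h : ∀ p ∈ s, inner ℝ ν (p - x) = 0) : ν ∈ (vectorSpan ℝ (s : Set (E d)))ᗮ := by
  rw [Submodule.mem_orthogonal']
  intro w hw
  induction hw using Submodule.span_induction with
  | mem y hy =>
    obtain ⟨p, hp, q, hq, rfl⟩ := hy
    have h1 := h p hp
    have h2 := h q hq
    show inner ℝ ν (p - q) = 0
    rw [show p - q = (p - x) - (q - x) by abel, inner_sub_right, h1, h2, sub_self]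
  | zero => simp
  | add y z _ _ hy hz => rw [inner_add_right, hy, hz, add_zero]
  | smul a y _ hy => rw [inner_smul_right, hy, mul_zero]

/-- The direction of the simplex has codimension one, so its orthogonal complement is the line
through `n`. -/
theorem mem_vectorSpan_of_inner_eq_zero {s : Finset (E d)} (hcard : s.card = d)
    (hd : 1 ≤ d) (hs : AffineIndependent ℝ ((↑) : s → E d)) {n : E d} (hn : ‖n‖ = 1)
    (hnp : n ∈ (vectorSpan ℝ (s : Set (E d)))ᗮ) {b : E d} (hb : inner ℝ n b = 0) :
    b ∈ vectorSpan ℝ (s : Set (E d)) := by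
  obtain ⟨k, rfl⟩ : ∃ k, d = k + 1 := ⟨d - 1, by omega⟩
  have hfr : Module.finrank ℝ (vectorSpan ℝ (s : Set (E (k + 1)))) = k := by
    have := hs.finrank_vectorSpan (n := k) (by simpa using hcard)
    have hr : vectorSpan ℝ (range ((↑) : s → E (k + 1))) = vectorSpan ℝ (s : Set (E (k + 1))) := by
      congr 1; ext; simp
    exact (LinearEquiv.ofEq _ _ hr).finrank_eq.symm.trans this
  have hfr' : Module.finrank ℝ ((vectorSpan ℝ (s : Set (E (k + 1))))ᗮ : Submodule ℝ _) = 1 := by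
    have := Submodule.finrank_add_finrank_orthogonal (vectorSpan ℝ (s : Set (E (k + 1))))
    rw [hfr, finrank_euclideanSpace_fin] at this
    omega
  rw [← Submodule.orthogonal_orthogonal (vectorSpan ℝ (s : Set (E (k + 1)))),
    Submodule.mem_orthogonal]
  intro w hw
  have hn0 : (⟨n, hnp⟩ : ((vectorSpan ℝ (s : Set (E (k + 1))))ᗮ : Submodule ℝ _)) ≠ 0 := by
    intro h0
    have : n = 0 := congrArg Subtype.val h0
    rw [this, norm_zero] at hn
    exact zero_ne_one hn
  obtain ⟨a, ha⟩ := (finrank_eq_one_iff_of_nonzero' _ hn0).1 hfr' ⟨w, hw⟩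
  have ha' : a • n = w := congrArg Subtype.val ha
  rw [← ha', real_inner_smul_left, hb, mul_zero]

theorem IsTriangulation.simplexCore_nonempty {k : ℕ} (hk : 1 ≤ k) {T : Finset (Finset (E d))}
    {S : Set (E d)} {ρ h : ℝ} (hT : IsTriangulation k T S ρ h) (hρh : 0 < ρ * h)
    {s : Finset (E d)} (hs : s ∈ T) : (simplexCore s).Nonempty := by
  by_contra hcon
  rw [not_nonempty_iff_eq_empty] at hcon
  have h0 := simplexCore_diff_null hk (hT.card_eq s hs)
  rw [hcon, sdiff_empty] at h0
  obtain ⟨x, hx, hsub⟩ := hT.containsBall s hs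
  have h1 := measure_mono_null hsub h0
  rw [euclideanHausdorffMeasure_closedBall_inter (hT.card_eq s hs) (hT.affineIndependent s hs) hx]
    at h1
  exact (Metric.measure_closedBall_pos volume _ hρh).ne' h1

theorem outerNormal_mem_orthogonal {Ω : Set (E d)} (ho : IsOpen Ω) (hc : Convex ℝ Ω)
    (hne : Ω.Nonempty) {s : Finset (E d)} (hs : hull s ⊆ frontier Ω) {x : E d}
    (hx : x ∈ simplexCore s) :
    (∀ p ∈ s, inner ℝ (outerNormal Ω x) (p - x) = 0) ∧
      outerNormal Ω x ∈ (vectorSpan ℝ (s : Set (E d)))ᗮ := by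
  have hn := isOuterUnitNormal_outerNormal ho hc hne (hs hx.1)
  have h1 := inner_eq_zero_of_mem_simplexCore hx fun p hp =>
    hn.inner_le_of_mem_closure p (frontier_subset_closure (hs (mem_hull_of_mem hp)))
  exact ⟨h1, mem_vectorSpan_orthogonal h1⟩

/-- The outer normal is constant on the relative interior of a boundary simplex. -/
theorem IsTriangulation.exists_normal (hd : 2 ≤ d) {Ω : Set (E d)} (ho : IsOpen Ω)
    (hc : Convex ℝ Ω) {c : E d} {r : ℝ} (hr : 0 < r) (hball : Metric.ball c r ⊆ Ω)
    {T : Finset (Finset (E d))} {ρ h : ℝ} (hT : IsTriangulation (d - 1) T (frontier Ω) ρ h)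
    (hρh : 0 < ρ * h) {s : Finset (E d)} (hs : s ∈ T) :
    ∃ (n : E d) (a : ℝ), ‖n‖ = 1 ∧ r ≤ a ∧ n ∈ (vectorSpan ℝ (s : Set (E d)))ᗮ ∧
      (∀ x ∈ simplexCore s, outerNormal Ω x = n) ∧ ∀ x ∈ hull s, inner ℝ n (x - c) = a := by
  have hne : Ω.Nonempty := ⟨c, hball (Metric.mem_ball_self hr)⟩
  have hsub := hT.hull_subset hs
  obtain ⟨x₀, hx₀⟩ := hT.simplexCore_nonempty (by omega) hρh hs
  have hn₀ := isOuterUnitNormal_outerNormal ho hc hne (hsub hx₀.1)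
  obtain ⟨h1, h2⟩ := outerNormal_mem_orthogonal ho hc hne hsub hx₀
  set n := outerNormal Ω x₀
  have hcst : ∀ x ∈ hull s, inner ℝ n x + 0 = inner ℝ (0 : E d) x + inner ℝ n x₀ := by
    intro x hx
    refine inner_add_eq_of_mem_hull (fun p hp => ?_) hx
    have := h1 p hp
    rw [inner_sub_right] at this
    rw [inner_zero_left]
    linarith
  simp only [inner_zero_left, add_zero, zero_add] at hcst
  refine ⟨n, inner ℝ n (x₀ - c), hn₀.1, hn₀.le_inner hr hball, h2, fun x hx => ?_, fun x hx => ?_⟩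
  · have hnx := isOuterUnitNormal_outerNormal ho hc hne (hsub hx.1)
    obtain ⟨h1', h2'⟩ := outerNormal_mem_orthogonal ho hc hne hsub hx
    set m := outerNormal Ω x
    -- The part of `m` orthogonal to `n` lies in the direction of the simplex and in its orthogonal
    -- complement, so it vanishes and `m` is a multiple of `n`.
    have hmem : m - (inner ℝ n m) • n ∈ vectorSpan ℝ (s : Set (E d)) := by
      refine mem_vectorSpan_of_inner_eq_zero (by rw [hT.card_eq s hs]; omega) (by omega)
        (hT.affineIndependent s hs) hn₀.1 h2 ?_
      rw [inner_sub_right, real_inner_smul_right, real_inner_self_eq_norm_sq, hn₀.1]; ring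
    have hmem' : m - (inner ℝ n m) • n ∈ (vectorSpan ℝ (s : Set (E d)))ᗮ :=
      Submodule.sub_mem _ h2' (Submodule.smul_mem _ _ h2)
    have hz : m - (inner ℝ n m) • n = 0 := by
      rw [← inner_self_eq_zero (𝕜 := ℝ)]
      exact Submodule.inner_right_of_mem_orthogonal hmem hmem'
    have hm : m = (inner ℝ n m) • n := sub_eq_zero.1 hz
    set lam := inner ℝ n m
    have habs : |lam| = 1 := by
      have := congrArg norm hm
      rw [norm_smul, hnx.1, hn₀.1, mul_one, Real.norm_eq_abs] at this
      exact this.symm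
    have hp1 := hnx.le_inner hr hball
    have hp2 := hn₀.le_inner hr hball
    -- Only the sign is still open. Both normals pair positively with the vector from `c` to the
    -- common hyperplane, which excludes `-n`.
    have hpos : 0 < lam := by
      rw [hm, real_inner_smul_left] at hp1
      have h3 : inner ℝ n (x - c) = inner ℝ n (x₀ - c) := by
        rw [inner_sub_right, inner_sub_right, hcst x hx.1]
      rw [h3] at hp1
      by_contra hcon
      have : lam * inner ℝ n (x₀ - c) ≤ 0 :=
        mul_nonpos_of_nonpos_of_nonneg (not_lt.1 hcon) (by linarith)
      linarith
    rw [abs_of_pos hpos] at habs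
    rw [hm, habs, one_smul]
  · rw [inner_sub_right, inner_sub_right, hcst x hx]

theorem surf_feMeasure (hd : 2 ≤ d) {Ω : Set (E d)} (ho : IsOpen Ω) (hc : Convex ℝ Ω)
    (hne : Ω.Nonempty) {T : Finset (Finset (E d))} {ρ h : ℝ}
    (hT : IsTriangulation (d - 1) T (frontier Ω) ρ h) :
    FEMeasure (d - 1) T (frontier Ω) ρ h (surf Ω) (surfGrad Ω) where
  tri := hT
  finite := ⟨by
    rw [surf, Measure.restrict_apply_univ]
    exact hT.euclideanHausdorffMeasure_lt_top⟩
  compl_null := by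
    rw [surf, Measure.restrict_apply isClosed_frontier.measurableSet.compl, compl_inter_self,
      measure_empty]
  overlap_null s hs t ht hst := by
    refine le_antisymm ((Measure.restrict_apply_le _ _).trans ?_) zero_le
    rw [hT.overlap_null (by omega) hs ht hst]
  grad v hv s hs := by
    have hai := hT.affineIndependent s hs
    have hsub := hT.hull_subset hs
    have hle : (surf Ω).restrict (hull s) ≤ (μHE[d - 1] : Measure (E d)).restrict (hull s) :=
      Measure.restrict_mono le_rfl Measure.restrict_le_self
    refine (Measure.absolutelyContinuous_of_le hle).ae_le ?_
    have hcore : ∀ᵐ x ∂((μHE[d - 1] : Measure (E d)).restrict (hull s)), x ∈ simplexCore s := by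
      rw [ae_restrict_iff' (isCompact_hull s).isClosed.measurableSet]
      have h0 := simplexCore_diff_null (by omega) (hT.card_eq s hs)
      rw [← compl_mem_ae_iff] at h0
      filter_upwards [h0] with x hx hxs
      by_contra hcon
      exact hx ⟨hxs, hcon⟩
    filter_upwards [hcore] with x hx
    obtain ⟨a, b, hab⟩ := hv.exists_affine hs
    -- The other boundary simplices are closed and miss `x`, so near `x` the boundary coincides with
    -- this simplex.
    have hnear : hull s ∈ 𝓝[frontier Ω] x := by
      have hopen : IsOpen (⋃ t ∈ {t | t ∈ T ∧ t ≠ s}, hull t)ᶜ := by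
        refine IsClosed.isOpen_compl (self := ?_)
        refine Set.Finite.isClosed_biUnion ?_ fun t _ => (isCompact_hull t).isClosed
        exact T.finite_toSet.subset fun t ht => ht.1
      have hxm : x ∈ (⋃ t ∈ {t | t ∈ T ∧ t ≠ s}, hull t)ᶜ := by
        simp only [mem_compl_iff, mem_iUnion, not_exists]
        intro t ht hxt
        exact ht.2 (hT.eq_of_mem_simplexCore hs ht.1 hx hxt).symm
      filter_upwards [mem_nhdsWithin_of_mem_nhds (hopen.mem_nhds hxm), self_mem_nhdsWithin]
        with y hy hyf
      rw [← hT.cover] at hyf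
      simp only [mem_iUnion, exists_prop] at hyf
      obtain ⟨t, ht, hyt⟩ := hyf
      by_cases hts : t = s
      · rw [← hts]; exact hyt
      · exact absurd (mem_biUnion (show t ∈ {t | t ∈ T ∧ t ≠ s} from ⟨ht, hts⟩) hyt) hy
    have hg : HasGradientWithinAt (fun y => inner ℝ a y + b) a (frontier Ω) x := by
      rw [hasGradientWithinAt_iff_hasFDerivWithinAt]
      exact (((InnerProductSpace.toDual ℝ (E d) a).hasFDerivAt (x := x)).add_const b).hasFDerivWithinAt
    have hgv : HasGradientWithinAt v a (frontier Ω) x := by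
      rw [hasGradientWithinAt_iff_hasFDerivWithinAt] at hg ⊢
      refine hg.congr_of_eventuallyEq ?_ (hab x hx.1)
      filter_upwards [hnear] with y hy using hab y hy
    have hG : HasGradientWithinAt v (gradientWithin v (frontier Ω) x) (frontier Ω) x :=
      (show DifferentiableWithinAt ℝ v (frontier Ω) x from
        hgv.hasFDerivWithinAt.differentiableWithinAt).hasGradientWithinAt
    set G := gradientWithin v (frontier Ω) x
    -- A gradient within Γ is determined only on the tangent cone, which contains the directions
    -- from `x` to the vertices. Its normal component is removed in `surfGrad`.
    have heq : ∀ p ∈ s, inner ℝ G (p - x) = inner ℝ a (p - x) := by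
      intro p hp
      have h1 := hG.hasFDerivWithinAt.unique_on hgv.hasFDerivWithinAt
      have h2 : p - x ∈ tangentConeAt ℝ (frontier Ω) x :=
        mem_tangentConeAt_of_segment_subset
          (((convex_convexHull ℝ _).segment_subset hx.1 (mem_hull_of_mem hp)).trans hsub)
      simpa using h1 h2
    obtain ⟨-, h2⟩ := outerNormal_mem_orthogonal ho hc hne hsub hx
    have hn := isOuterUnitNormal_outerNormal ho hc hne (hsub hx.1)
    rw [surfGrad]
    set n := outerNormal Ω x
    refine (locGrad_eq hai ?_ fun p hp q hq => ?_).symm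
    · refine mem_vectorSpan_of_inner_eq_zero (by rw [hT.card_eq s hs]; omega) (by omega)
        hai hn.1 h2 ?_
      rw [inner_sub_right, real_inner_smul_right, real_inner_self_eq_norm_sq, hn.1]; ring
    · rw [inner_sub_left, real_inner_smul_left,
        show inner ℝ n (p - q) = 0 from
          Submodule.inner_left_of_mem_orthogonal (vsub_mem_vectorSpan ℝ hp hq) h2, mul_zero, sub_zero,
        show p - q = (p - x) - (q - x) by abel, inner_sub_right, heq p hp, heq q hq,
        hab p (mem_hull_of_mem hp), hab q (mem_hull_of_mem hq), inner_sub_right, inner_sub_right]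
      ring

/-- The weights of the mass-lumped inner product. -/
noncomputable def nodalMass (σ : Measure (E d)) (T : Finset (Finset (E d))) (p : E d) : ℝ :=
  ∫ x, nodalBasis T p x ∂σ

/-- The Dirichlet form on finite element functions. -/
noncomputable def dirichletForm (σ : Measure (E d)) (T : Finset (Finset (E d)))
    (v w : E d → ℝ) : ℝ :=
  ∑ s ∈ T, σ.real (hull s) * inner ℝ (locGrad s v) (locGrad s w)

/-! ### Lumped masses and integrals over a triangulation -/

namespace FEMeasure

variable {k : ℕ} {T : Finset (Finset (E d))} {S : Set (E d)} {ρ h : ℝ} {σ : Measure (E d)}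
  {D : (E d → ℝ) → E d → E d}

theorem ae_mem (H : FEMeasure k T S ρ h σ D) : ∀ᵐ x ∂σ, x ∈ S := by
  have := H.compl_null
  rwa [← mem_ae_iff] at this

theorem restrict_eq (H : FEMeasure k T S ρ h σ D) : σ.restrict S = σ :=
  Measure.restrict_eq_self_of_ae_mem H.ae_mem

/-- The simplices cover `S`, and their overlaps are null sets; integrals may therefore be computed
simplex by simplex. -/
theorem eq_sum_restrict (H : FEMeasure k T S ρ h σ D) :
    σ = ∑ s ∈ T, σ.restrict (hull s) := by
  have h1 : S = ⋃ s : T, hull s.1 := by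
    rw [← H.tri.cover]; ext x; simp
  have h2 : σ.restrict (⋃ s : T, hull s.1) = Measure.sum fun s : T => σ.restrict (hull s.1) :=
    Measure.restrict_iUnion_ae
      (fun s t hst => H.overlap_null s.1 s.2 t.1 t.2 fun h => hst (Subtype.ext h))
      fun s => (isCompact_hull s.1).isClosed.measurableSet.nullMeasurableSet
  rw [← h1, H.restrict_eq, Measure.sum_fintype] at h2
  conv_lhs => rw [h2]
  exact Finset.sum_coe_sort T fun s => σ.restrict (hull s)

theorem integrable_of_continuousOn (H : FEMeasure k T S ρ h σ D) {v : E d → ℝ}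
    (hv : ContinuousOn v S) : Integrable v σ := by
  have := H.finite
  have h1 := hv.integrableOn_compact (μ := σ) H.tri.isCompact
  rwa [IntegrableOn, H.restrict_eq] at h1

theorem integrable (H : FEMeasure k T S ρ h σ D) {v : E d → ℝ} (hv : IsFE T v) :
    Integrable v σ := by
  have := hv.1
  rw [H.tri.cover] at this
  exact H.integrable_of_continuousOn this

theorem integral_interp (H : FEMeasure k T S ρ h σ D) (a : E d → ℝ) :
    ∫ x, interp T a x ∂σ = ∑ p ∈ verts T, a p * nodalMass σ T p := by
  unfold interp nodalMass
  rw [integral_finsetSum _ fun p _ =>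
    (H.integrable (H.tri.isFE_nodalBasis p).1).const_mul (a p)]
  simp only [integral_const_mul]

theorem nodalMass_nonneg (H : FEMeasure k T S ρ h σ D) (p : E d) : 0 ≤ nodalMass σ T p := by
  refine integral_nonneg_of_ae ?_
  filter_upwards [H.ae_mem] with x hx using H.tri.nodalBasis_nonneg p hx

theorem sum_nodalMass (H : FEMeasure k T S ρ h σ D) :
    ∑ p ∈ verts T, nodalMass σ T p = σ.real univ := by
  have h1 := H.integral_interp (fun _ => 1)
  simp only [one_mul] at h1
  rw [← h1, integral_congr_ae (g := fun _ => 1)]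
  · simp
  · filter_upwards [H.ae_mem] with x hx
    simpa [interp] using H.tri.sum_nodalBasis hx

theorem integral_inner_grad (H : FEMeasure k T S ρ h σ D) {v w : E d → ℝ} (hv : IsFE T v)
    (hw : IsFE T w) : ∫ x, inner ℝ (D v x) (D w x) ∂σ = dirichletForm σ T v w := by
  have := H.finite
  have hae : ∀ s ∈ T, (fun x => inner ℝ (D v x) (D w x)) =ᵐ[σ.restrict (hull s)]
      fun _ => inner ℝ (locGrad s v) (locGrad s w) := by
    intro s hs
    filter_upwards [H.grad v hv s hs, H.grad w hw s hs] with x h1 h2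
    rw [h1, h2]
  conv_lhs => rw [H.eq_sum_restrict]
  rw [integral_finsetSum_measure fun s hs => (integrable_const _).congr (hae s hs).symm]
  refine Finset.sum_congr rfl fun s hs => ?_
  rw [integral_congr_ae (hae s hs)]
  simp

theorem integral_norm_sq_grad (H : FEMeasure k T S ρ h σ D) {v : E d → ℝ} (hv : IsFE T v) :
    ∫ x, ‖D v x‖ ^ 2 ∂σ = dirichletForm σ T v v := by
  rw [← H.integral_inner_grad hv hv]
  simp only [real_inner_self_eq_norm_sq]

end FEMeasure

/-! ### The discrete Dirichlet form -/

section DirichletForm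

variable (σ : Measure (E d)) (T : Finset (Finset (E d))) (v w : E d → ℝ)

theorem dirichletForm_self_nonneg : 0 ≤ dirichletForm σ T v v :=
  Finset.sum_nonneg fun _ _ => mul_nonneg measureReal_nonneg real_inner_self_nonneg

/-- The two sides differ by half the Dirichlet energy of the difference; this is the numerical
dissipation of the implicit Euler method. -/
theorem half_dirichletForm_sub_le (hT : ∀ s ∈ T, AffineIndependent ℝ ((↑) : s → E d)) :
    (dirichletForm σ T v v - dirichletForm σ T w w) / 2
      ≤ dirichletForm σ T v (fun x => v x - w x) := by
  unfold dirichletForm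
  rw [← Finset.sum_sub_distrib, Finset.sum_div]
  refine Finset.sum_le_sum fun s hs => ?_
  rw [locGrad_sub (hT s hs), ← mul_sub, mul_div_assoc]
  refine mul_le_mul_of_nonneg_left ?_ measureReal_nonneg
  have := real_inner_self_nonneg (x := locGrad s v - locGrad s w)
  rw [inner_sub_left, inner_sub_right, inner_sub_right,
    real_inner_comm (locGrad s v) (locGrad s w)] at this
  rw [inner_sub_right]
  linarith

/-- Cauchy-Schwarz is used twice: for the gradients on each simplex, and for the sum over simplices
with the square roots of their measures as weights. -/
theorem dirichletForm_sq_le :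
    dirichletForm σ T v w ^ 2 ≤ dirichletForm σ T v v * dirichletForm σ T w w := by
  unfold dirichletForm
  simp only [real_inner_self_eq_norm_sq]
  have h1 : |∑ s ∈ T, σ.real (hull s) * inner ℝ (locGrad s v) (locGrad s w)| ≤
      ∑ s ∈ T, (√(σ.real (hull s)) * ‖locGrad s v‖) * (√(σ.real (hull s)) * ‖locGrad s w‖) := by
    refine (Finset.abs_sum_le_sum_abs _ _).trans (Finset.sum_le_sum fun s _ => ?_)
    rw [abs_mul, abs_of_nonneg (measureReal_nonneg (μ := σ))]
    have h2 := abs_real_inner_le_norm (locGrad s v) (locGrad s w)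
    have h3 : √(σ.real (hull s)) * √(σ.real (hull s)) = σ.real (hull s) :=
      Real.mul_self_sqrt measureReal_nonneg
    calc σ.real (hull s) * |inner ℝ (locGrad s v) (locGrad s w)|
        ≤ σ.real (hull s) * (‖locGrad s v‖ * ‖locGrad s w‖) :=
          mul_le_mul_of_nonneg_left h2 measureReal_nonneg
      _ = _ := by rw [mul_mul_mul_comm, h3]
  have h4 := Finset.sum_mul_sq_le_sq_mul_sq T (fun s => √(σ.real (hull s)) * ‖locGrad s v‖)
    (fun s => √(σ.real (hull s)) * ‖locGrad s w‖)
  simp only [mul_pow, Real.sq_sqrt (measureReal_nonneg (μ := σ))] at h4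
  rw [← sq_abs]
  exact (pow_le_pow_left₀ (abs_nonneg _) h1 2).trans h4

variable {T v w}

theorem dirichletForm_congr (hT : ∀ s ∈ T, AffineIndependent ℝ ((↑) : s → E d))
    {v' w' : E d → ℝ} (hv : ∀ p ∈ verts T, v p = v' p) (hw : ∀ p ∈ verts T, w p = w' p) :
    dirichletForm σ T v w = dirichletForm σ T v' w' :=
  Finset.sum_congr rfl fun s hs => by
    rw [locGrad_congr (hT s hs) fun p hp => hv p (mem_verts.2 ⟨s, hs, hp⟩),
      locGrad_congr (hT s hs) fun p hp => hw p (mem_verts.2 ⟨s, hs, hp⟩)]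

end DirichletForm

/-! ### Potentials -/

theorem convexOn_sub_le_deriv_mul {f : ℝ → ℝ} (hf : ConvexOn ℝ univ f) (hd : Differentiable ℝ f)
    (s t : ℝ) : f s - f t ≤ deriv f s * (s - t) := by
  rcases lt_trichotomy s t with hst | rfl | hst
  · have := hf.le_slope_of_hasDerivAt (mem_univ s) (mem_univ t) hst (hd s).hasDerivAt
    rw [slope_def_field, le_div_iff₀ (by linarith)] at this
    linarith
  · simp
  · have := hf.slope_le_of_hasDerivAt (mem_univ t) (mem_univ s) hst (hd s).hasDerivAt
    rw [slope_def_field, div_le_iff₀ (by linarith)] at this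
    linarith

/-- The tangent of the convex part at the new value and that of the concave part at the old value
both give an inequality in the same direction. This is the reason for the implicit-explicit
splitting. -/
theorem IsPotential.sub_le {Fp Fm : ℝ → ℝ} (hF : IsPotential Fp Fm) (s t : ℝ) :
    (Fp s + Fm s) - (Fp t + Fm t) ≤ (deriv Fp s + deriv Fm t) * (s - t) := by
  have h1 := convexOn_sub_le_deriv_mul hF.convex
    (hF.contDiff_convex.differentiable one_ne_zero) s t
  have h2 := convexOn_sub_le_deriv_mul hF.concave.neg
    (hF.contDiff_concave.differentiable one_ne_zero).neg t s
  rw [deriv.neg] at h2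
  simp only [Pi.neg_apply] at h2
  linarith

/-! ### The energy estimate -/

/-- The discrete energy. -/
noncomputable def energy (σ σΓ : Measure (E d)) (T TΓ : Finset (Finset (E d))) (κ : ℝ)
    (F G : ℝ → ℝ) (v : E d → ℝ) : ℝ :=
  dirichletForm σ T v v / 2 + ∑ p ∈ verts T, F (v p) * nodalMass σ T p
    + κ * (dirichletForm σΓ TΓ v v / 2) + ∑ p ∈ verts TΓ, G (v p) * nodalMass σΓ TΓ p

theorem IsMesh.isFE_surf {Ω : Set (E d)} {T TΓ : Finset (Finset (E d))} {ρ h : ℝ}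
    (hM : IsMesh Ω T TΓ ρ h) {v : E d → ℝ} (hv : IsFE T v) : IsFE TΓ v := by
  refine ⟨hv.1.mono ?_, fun s hs => ?_⟩
  · rw [hM.bulk.cover, hM.surf.cover]
    exact frontier_subset_closure
  · obtain ⟨K, hK, hsK⟩ := hM.compatible s hs
    obtain ⟨a, c, hac⟩ := hv.2 K hK
    exact ⟨a, c, fun x hx => hac x (convexHull_mono (by exact_mod_cast hsK) hx)⟩

section Energy

variable {Ω : Set (E d)} {T TΓ : Finset (Finset (E d))} {ρ h m mΓ κ τ : ℝ}
  {Fp Fm Gp Gm : ℝ → ℝ} {N : ℕ} {φ μ μΓ : ℕ → E d → ℝ}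

theorem sum_sub_mul_nodalMass {k : ℕ} {S : Set (E d)} {σ : Measure (E d)}
    {D : (E d → ℝ) → E d → E d} (H : FEMeasure k T S ρ h σ D) (hF : IsPotential Fp Fm)
    (v w : E d → ℝ) :
    ∑ p ∈ verts T, (Fp (v p) + Fm (v p)) * nodalMass σ T p
        - ∑ p ∈ verts T, (Fp (w p) + Fm (w p)) * nodalMass σ T p
      ≤ ∑ p ∈ verts T, (deriv Fp (v p) + deriv Fm (w p)) * (v p - w p) * nodalMass σ T p := by
  rw [← Finset.sum_sub_distrib]
  refine Finset.sum_le_sum fun p _ => ?_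
  rw [← sub_mul]
  exact mul_le_mul_of_nonneg_right (hF.sub_le _ _) (H.nodalMass_nonneg p)

/-- The bulk equation is tested with `μ n`, the surface equation with an extension of `μΓ n`, and
the equation for the potentials with `φ n - φ (n - 1)`. The lumped products of potentials and
increments cancel, and the remaining terms are bounded by convexity. -/
theorem energy_step (H : FEMeasure d T (closure Ω) ρ h (bulk Ω) (fun v => ∇ v))
    (HΓ : FEMeasure (d - 1) TΓ (frontier Ω) ρ h (surf Ω) (surfGrad Ω))
    (hM : IsMesh Ω T TΓ ρ h) (hκ : 0 ≤ κ)
    (hF : IsPotential Fp Fm) (hG : IsPotential Gp Gm)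
    (hsol : IsDiscreteSolution Ω T TΓ m mΓ κ τ Fp Fm Gp Gm N φ μ μΓ) {n : ℕ}
    (hn : n ∈ Finset.Icc 1 N) :
    energy (bulk Ω) (surf Ω) T TΓ κ (fun s => Fp s + Fm s) (fun s => Gp s + Gm s) (φ n)
        + τ * (m * dirichletForm (bulk Ω) T (μ n) (μ n)
          + mΓ * dirichletForm (surf Ω) TΓ (μΓ n) (μΓ n))
      ≤ energy (bulk Ω) (surf Ω) T TΓ κ (fun s => Fp s + Fm s) (fun s => Gp s + Gm s)
          (φ (n - 1)) := by
  have hn' := Finset.mem_Icc.1 hn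
  have hφ := hsol.phi_mem n hn'.2
  have hφ' := hsol.phi_mem (n - 1) (by omega)
  have hμ := hsol.mu_mem n hn
  have hμΓ := hsol.muG_mem n hn
  have haiΓ := HΓ.tri.affineIndependent
  -- The surface equation admits traces of bulk functions only. Any bulk finite element function
  -- with the values of `μΓ n` at the boundary vertices will do, since the lumped product and the
  -- Dirichlet form see vertex values only.
  obtain ⟨θ, hθ, hθv⟩ := H.tri.exists_isFE (μΓ n)
  have hvert : ∀ p ∈ verts TΓ, p ∈ verts T := by
    intro p hp
    obtain ⟨s, hs, hps⟩ := mem_verts.1 hp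
    obtain ⟨K, hK, hsK⟩ := hM.compatible s hs
    exact mem_verts.2 ⟨K, hK, hsK hps⟩
  have hθΓ : ∀ p ∈ verts TΓ, θ p = μΓ n p := fun p hp => hθv p (hvert p hp)
  have e1 := hsol.eq_bulk n hn (μ n) hμ
  have e2 := hsol.eq_surf n hn θ hθ
  have e3 := hsol.eq_potential n hn _ (hφ.sub hφ')
  rw [H.integral_inner_grad hμ hμ, H.integral_interp, H.integral_interp] at e1
  rw [HΓ.integral_inner_grad hμΓ (hM.isFE_surf hθ), HΓ.integral_interp, HΓ.integral_interp,
    dirichletForm_congr (surf Ω) haiΓ (v' := μΓ n) (fun _ _ => rfl) hθΓ] at e2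
  rw [H.integral_inner_grad hφ (hφ.sub hφ'),
    HΓ.integral_inner_grad (hM.isFE_surf hφ) (hM.isFE_surf (hφ.sub hφ')), H.integral_interp,
    HΓ.integral_interp, H.integral_interp, HΓ.integral_interp] at e3
  have e2' : ∑ p ∈ verts TΓ, φ n p * θ p * nodalMass (surf Ω) TΓ p
      - ∑ p ∈ verts TΓ, φ (n - 1) p * θ p * nodalMass (surf Ω) TΓ p
      = ∑ p ∈ verts TΓ, μΓ n p * (φ n p - φ (n - 1) p) * nodalMass (surf Ω) TΓ p := by
    rw [← Finset.sum_sub_distrib]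
    exact Finset.sum_congr rfl fun p hp => by rw [hθΓ p hp]; ring
  have e1' : ∑ p ∈ verts T, φ n p * μ n p * nodalMass (bulk Ω) T p
      - ∑ p ∈ verts T, φ (n - 1) p * μ n p * nodalMass (bulk Ω) T p
      = ∑ p ∈ verts T, μ n p * (φ n p - φ (n - 1) p) * nodalMass (bulk Ω) T p := by
    rw [← Finset.sum_sub_distrib]
    exact Finset.sum_congr rfl fun p hp => by ring
  have f1 := sum_sub_mul_nodalMass H hF (φ n) (φ (n - 1))
  have f2 := sum_sub_mul_nodalMass HΓ hG (φ n) (φ (n - 1))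
  have f3 := half_dirichletForm_sub_le (bulk Ω) T (φ n) (φ (n - 1)) H.tri.affineIndependent
  have f4 := mul_le_mul_of_nonneg_left
    (half_dirichletForm_sub_le (surf Ω) TΓ (φ n) (φ (n - 1)) haiΓ) hκ
  unfold energy
  linarith

theorem neg_le_sum_mul_nodalMass {k : ℕ} {S : Set (E d)} {σ : Measure (E d)}
    {D : (E d → ℝ) → E d → E d} (H : FEMeasure k T S ρ h σ D) {F : ℝ → ℝ} {c : ℝ}
    (hc : ∀ s, -c < F s) (v : E d → ℝ) :
    -(c * σ.real univ) ≤ ∑ p ∈ verts T, F (v p) * nodalMass σ T p := by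
  rw [← H.sum_nodalMass, Finset.mul_sum, ← Finset.sum_neg_distrib]
  refine Finset.sum_le_sum fun p _ => ?_
  rw [← neg_mul]
  exact mul_le_mul_of_nonneg_right (hc _).le (H.nodalMass_nonneg p)

/-- The energy steps telescope; the final energy is bounded below by the lower bounds of the
potentials times the total masses. -/
theorem energy_estimate (H : FEMeasure d T (closure Ω) ρ h (bulk Ω) (fun v => ∇ v))
    (HΓ : FEMeasure (d - 1) TΓ (frontier Ω) ρ h (surf Ω) (surfGrad Ω))
    (hM : IsMesh Ω T TΓ ρ h) (hκ : 0 ≤ κ)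
    (hF : IsPotential Fp Fm) (hG : IsPotential Gp Gm)
    (hsol : IsDiscreteSolution Ω T TΓ m mΓ κ τ Fp Fm Gp Gm N φ μ μΓ) {C₀ cF cG : ℝ}
    (hC₀ : initialEnergy Ω T TΓ κ Fp Fm Gp Gm (φ 0) ≤ C₀)
    (hcF : ∀ s, -cF < Fp s + Fm s) (hcG : ∀ s, -cG < Gp s + Gm s) :
    τ * ∑ n ∈ Finset.Icc 1 N, (m * dirichletForm (bulk Ω) T (μ n) (μ n)
        + mΓ * dirichletForm (surf Ω) TΓ (μΓ n) (μΓ n))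
      ≤ C₀ + cF * (bulk Ω).real univ + cG * (surf Ω).real univ := by
  set En := energy (bulk Ω) (surf Ω) T TΓ κ (fun s => Fp s + Fm s) (fun s => Gp s + Gm s)
    with hEn
  have hsum : ∀ n ≤ N, En (φ n) + τ * ∑ j ∈ Finset.Icc 1 n,
      (m * dirichletForm (bulk Ω) T (μ j) (μ j) + mΓ * dirichletForm (surf Ω) TΓ (μΓ j) (μΓ j))
      ≤ En (φ 0) := by
    intro n
    induction n with
    | zero => simp
    | succ n ih =>
      intro hn
      have h1 := ih (by omega)
      have h2 := energy_step H HΓ hM hκ hF hG hsol (n := n + 1) (Finset.mem_Icc.2 ⟨by omega, hn⟩)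
      rw [← hEn, Nat.add_sub_cancel] at h2
      rw [Finset.sum_Icc_succ_top (by omega), mul_add]
      linarith
  have hN := hsum N le_rfl
  have hlow : -(cF * (bulk Ω).real univ) - cG * (surf Ω).real univ ≤ En (φ N) := by
    have h1 := neg_le_sum_mul_nodalMass H (F := fun s => Fp s + Fm s) hcF (φ N)
    have h2 := neg_le_sum_mul_nodalMass HΓ (F := fun s => Gp s + Gm s) hcG (φ N)
    have h3 := dirichletForm_self_nonneg (bulk Ω) T (φ N)
    have h4 := mul_nonneg hκ (div_nonneg (dirichletForm_self_nonneg (surf Ω) TΓ (φ N)) two_pos.le)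
    rw [hEn]
    unfold energy
    linarith
  -- The bounded initial quantity has the full Dirichlet integrals where the energy has halves of
  -- them, so it dominates the energy.
  have hupp : En (φ 0) ≤ C₀ := by
    have h0 := hsol.phi_mem 0 (Nat.zero_le _)
    unfold initialEnergy at hC₀
    rw [H.integral_norm_sq_grad h0, HΓ.integral_norm_sq_grad (hM.isFE_surf h0),
      H.integral_interp, HΓ.integral_interp] at hC₀
    have h3 := dirichletForm_self_nonneg (bulk Ω) T (φ 0)
    have h4 := mul_nonneg hκ (div_nonneg (dirichletForm_self_nonneg (surf Ω) TΓ (φ 0)) two_pos.le)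
    rw [hEn]
    unfold energy
    linarith
  linarith

end Energy

/-! ### A Poincaré inequality on convex sets -/

theorem lintegral_mul_sq_le {α : Type*} [MeasurableSpace α] {μ : Measure α} {f g : α → ℝ≥0∞}
    (hf : AEMeasurable f μ) (hg : AEMeasurable g μ) :
    (∫⁻ a, f a * g a ∂μ) ^ 2 ≤ (∫⁻ a, f a ^ 2 ∂μ) * ∫⁻ a, g a ^ 2 ∂μ := by
  have h := ENNReal.lintegral_mul_le_Lp_mul_Lq μ Real.HolderConjugate.two_two hf hg
  simp only [Pi.mul_apply, ENNReal.rpow_two] at h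
  refine (pow_le_pow_left' h 2).trans (le_of_eq ?_)
  rw [mul_pow, ← ENNReal.rpow_two, ← ENNReal.rpow_two, ← ENNReal.rpow_mul, ← ENNReal.rpow_mul]
  norm_num

theorem lintegral_sq_le {α : Type*} [MeasurableSpace α] {μ : Measure α} {f : α → ℝ≥0∞}
    (hf : AEMeasurable f μ) : (∫⁻ a, f a ∂μ) ^ 2 ≤ μ univ * ∫⁻ a, f a ^ 2 ∂μ := by
  have h := lintegral_mul_sq_le (g := fun _ => 1) hf aemeasurable_const
  simp only [mul_one, one_pow, lintegral_one] at h
  rwa [mul_comm] at h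

theorem inner_gradient_eq {ψ : E d → ℝ} (x v : E d) :
    inner ℝ (∇ ψ x) v = fderiv ℝ ψ x v := by
  simp [gradient]

theorem inner_eq_sum_coord (x y : E d) : inner ℝ x y = ∑ i, x i * y i := by
  rw [PiLp.inner_apply]
  exact Finset.sum_congr rfl fun i _ => by simp [mul_comm]

theorem gradient_comp_sub {ψ : E d → ℝ} (a x : E d) :
    ∇ (fun y => ψ (y - a)) x = ∇ ψ (x - a) := by
  simp only [gradient]
  rw [fderiv_comp_sub]

/-- The gradient of a smooth function with compact support is continuous with compact support. -/
theorem continuous_gradient {ψ : E d → ℝ} (hψ : ContDiff ℝ ∞ ψ) : Continuous (∇ ψ) :=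
  (InnerProductSpace.toDual ℝ (E d)).symm.continuous.comp
    (hψ.continuous_fderiv (by simp))

theorem hasCompactSupport_gradient {ψ : E d → ℝ} (hs : HasCompactSupport ψ) :
    HasCompactSupport (∇ ψ) :=
  (hs.fderiv (𝕜 := ℝ)).comp_left (g := (InnerProductSpace.toDual ℝ (E d)).symm) (map_zero _)

theorem tsupport_gradient_subset {ψ : E d → ℝ} : tsupport (∇ ψ) ⊆ tsupport ψ := by
  refine (closure_mono ?_).trans (tsupport_fderiv_subset ℝ (f := ψ))
  intro x hx hx0
  exact hx (by simp [gradient, hx0])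

section Translation

variable {U : Set (E d)} {θ : E d → ℝ} {g : E d → E d}

/-- The fundamental theorem of calculus is moved to a test function ψ: Fubini and the weak identity
for the translates `ψ (· - t • v)` reduce the claim to `ψ x - ψ (x - v)` being the integral of its
derivative along the segment. -/
theorem ae_translate_sub_eq (hU : IsOpen U) (hc : Convex ℝ U) (hθi : Integrable θ)
    (hgm : Measurable g) (hgi : Integrable g)
    (hw : ∀ ψ : E d → ℝ, ContDiff ℝ ∞ ψ → HasCompactSupport ψ → tsupport ψ ⊆ U →
      ∀ v : E d, ∫ x, θ x * inner ℝ (∇ ψ x) v = -∫ x, inner ℝ (g x) v * ψ x) (v : E d) :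
    ∀ᵐ x : E d, x ∈ {x | x ∈ U ∧ x + v ∈ U} →
      θ (x + v) - θ x = ∫ t in (0 : ℝ)..1, inner ℝ (g (x + t • v)) v := by
  have hUv : IsOpen {x : E d | x ∈ U ∧ x + v ∈ U} :=
    hU.inter (hU.preimage (continuous_id.add continuous_const))
  have hHi : Integrable (fun z : E d × ℝ => inner ℝ (g (z.1 + z.2 • v)) v)
      ((volume : Measure (E d)).prod (volume.restrict (Ioc (0 : ℝ) 1))) := by
    have hm : Measurable (fun z : E d × ℝ => inner ℝ (g (z.1 + z.2 • v)) v) := by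
      fun_prop
    rw [integrable_prod_iff' hm.aestronglyMeasurable]
    constructor
    · exact Eventually.of_forall fun t => ((hgi.comp_add_right (t • v)).inner_const v)
    · have : ∀ t : ℝ, ∫ x : E d, ‖(inner ℝ (g (x + t • v)) v : ℝ)‖ = ∫ x : E d, ‖(inner ℝ (g x) v : ℝ)‖ :=
        fun t => integral_add_right_eq_self (fun x => ‖(inner ℝ (g x) v : ℝ)‖) (t • v)
      simp only [this]
      exact integrable_const _
  have hHi1 := hHi.integral_prod_left
  simp only at hHi1
  have hθv : Integrable fun x => θ (x + v) := hθi.comp_add_right v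
  have hf : Integrable fun x => θ (x + v) - θ x - ∫ t in Ioc (0 : ℝ) 1, inner ℝ (g (x + t • v)) v :=
    (hθv.sub hθi).sub hHi1
  have key := hUv.ae_eq_zero_of_integral_contDiff_smul_eq_zero (μ := volume)
    (hf.locallyIntegrable.locallyIntegrableOn _) ?_
  · filter_upwards [key] with x hx hxU
    rw [intervalIntegral.integral_of_le zero_le_one]
    exact sub_eq_zero.1 (hx hxU)
  intro ψ hψ hψc hψs
  have hψcont := hψ.continuous
  obtain ⟨M, hM⟩ := hψc.exists_bound_of_continuous hψcont
  have hbd : ∀ {f : E d → ℝ}, Integrable f → Integrable fun x => ψ x * f x := fun hf =>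
    hf.bdd_mul hψcont.aestronglyMeasurable (Eventually.of_forall hM)
  -- the translates of the test function
  have hψt : ∀ t ∈ Ioc (0 : ℝ) 1, ∫ x, ψ x * inner ℝ (g (x + t • v)) v
      = -∫ x, θ x * inner ℝ (∇ ψ (x - t • v)) v := by
    intro t ht
    have h1 := hw (fun y => ψ (y - t • v)) (hψ.comp (contDiff_id.sub contDiff_const))
      (hψc.comp_homeomorph (Homeomorph.subRight (t • v))) ?_ v
    · simp only [gradient_comp_sub] at h1
      rw [h1, neg_neg, ← integral_add_right_eq_self (fun x => inner ℝ (g x) v * ψ (x - t • v)) (t • v)]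
      exact integral_congr_ae (Eventually.of_forall fun x => by simp [mul_comm])
    -- Convexity enters here: if `x` and `x + v` lie in `U`, so does `x + t • v`, and the translates
    -- remain admissible test functions on `U`.
    · have h2 : tsupport (fun y => ψ (y - t • v)) = (fun y => y - t • v) ⁻¹' tsupport ψ :=
        tsupport_comp_eq_preimage ψ (Homeomorph.subRight (t • v))
      rw [h2]
      intro y hy
      have hy' := hψs hy
      have := hc hy'.1 hy'.2 (sub_nonneg.2 ht.2) ht.1.le (by ring)
      convert this using 1
      module
  have hgrad := continuous_gradient hψ
  obtain ⟨M', hM'⟩ := (hasCompactSupport_gradient hψc).exists_bound_of_continuous hgrad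
  have hFi : Integrable (fun z : E d × ℝ => θ z.1 * inner ℝ (∇ ψ (z.1 - z.2 • v)) v)
      ((volume : Measure (E d)).prod (volume.restrict (Ioc (0 : ℝ) 1))) := by
    refine Integrable.mul_bdd (c := M' * ‖v‖) (hθi.comp_fst _) ?_ ?_
    · exact (Continuous.inner (hgrad.comp (by fun_prop)) continuous_const).aestronglyMeasurable
    · exact Eventually.of_forall fun z => (norm_inner_le_norm _ _).trans
        (mul_le_mul_of_nonneg_right (hM' _) (norm_nonneg _))
  have hftc : ∀ x : E d, ∫ t in Ioc (0 : ℝ) 1, inner ℝ (∇ ψ (x - t • v)) v = ψ x - ψ (x - v) := by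
    intro x
    have hd : ∀ t ∈ uIcc (0 : ℝ) 1, HasDerivAt (fun t : ℝ => -ψ (x - t • v))
        (inner ℝ (∇ ψ (x - t • v)) v) t := by
      intro t _
      have h1 : HasDerivAt (fun t : ℝ => x - t • v) (-v) t := by
        simpa using ((hasDerivAt_id t).smul_const v).const_sub x
      have h2 := (hψ.differentiable (by simp) (x - t • v)).hasFDerivAt.comp_hasDerivAt t h1
      rw [inner_gradient_eq]
      have h3 := h2.neg
      rw [map_neg, neg_neg] at h3
      exact h3
    rw [← intervalIntegral.integral_of_le zero_le_one,
      intervalIntegral.integral_eq_sub_of_hasDerivAt hd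
        (Continuous.intervalIntegrable
          (Continuous.inner (hgrad.comp (by fun_prop)) continuous_const) _ _)]
    simp
    ring
  have e1 : ∫ x, ψ x * θ (x + v) = ∫ x, ψ (x - v) * θ x := by
    rw [← integral_add_right_eq_self (fun x => ψ (x - v) * θ x) v]
    simp
  have e2 : ∫ x, ψ x * ∫ t in Ioc (0 : ℝ) 1, inner ℝ (g (x + t • v)) v
      = -∫ x, θ x * (ψ x - ψ (x - v)) := by
    have hHψ : Integrable (fun z : E d × ℝ => ψ z.1 * inner ℝ (g (z.1 + z.2 • v)) v)
        ((volume : Measure (E d)).prod (volume.restrict (Ioc (0 : ℝ) 1))) :=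
      hHi.bdd_mul (hψcont.comp continuous_fst).aestronglyMeasurable
        (Eventually.of_forall fun z => hM z.1)
    simp only [← integral_const_mul]
    rw [integral_integral_swap hHψ, setIntegral_congr_fun measurableSet_Ioc hψt, integral_neg,
      ← integral_integral_swap hFi]
    simp only [integral_const_mul, hftc]
  simp only [smul_eq_mul, mul_sub]
  have i1 : Integrable fun x => ψ x * θ (x + v) := hbd hθv
  have i2 : Integrable fun x => ψ x * θ x := hbd hθi
  have i3 : Integrable fun x => ψ (x - v) * θ x :=
    hθi.bdd_mul (hψcont.comp (by fun_prop)).aestronglyMeasurable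
      (Eventually.of_forall fun x => hM _)
  rw [integral_sub (f := fun x => ψ x * θ (x + v) - ψ x * θ x) (i1.sub i2) (hbd hHi1),
    integral_sub i1 i2, e1, e2]
  have e3 : ∫ x, θ x * (ψ x - ψ (x - v)) = (∫ x, ψ x * θ x) - ∫ x, ψ (x - v) * θ x := by
    rw [← integral_sub i2 i3]
    exact integral_congr_ae (Eventually.of_forall fun x => by ring)
  rw [e3]
  ring

/-- Cauchy-Schwarz in `t`, followed by Tonelli and translation invariance. -/
theorem lintegral_translate_sub_sq_le (hU : IsOpen U) (hc : Convex ℝ U) (hθi : Integrable θ)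
    (hgm : Measurable g) (hgi : Integrable g)
    (hw : ∀ ψ : E d → ℝ, ContDiff ℝ ∞ ψ → HasCompactSupport ψ → tsupport ψ ⊆ U →
      ∀ v : E d, ∫ x, θ x * inner ℝ (∇ ψ x) v = -∫ x, inner ℝ (g x) v * ψ x) (v : E d) :
    ∫⁻ x in {x | x ∈ U ∧ x + v ∈ U}, ‖θ (x + v) - θ x‖ₑ ^ 2 ≤ ‖v‖ₑ ^ 2 * ∫⁻ x, ‖g x‖ₑ ^ 2 := by
  have hUv : IsOpen {x : E d | x ∈ U ∧ x + v ∈ U} :=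
    hU.inter (hU.preimage (continuous_id.add continuous_const))
  have h1 : ∀ᵐ x ∂(volume.restrict {x : E d | x ∈ U ∧ x + v ∈ U}),
      ‖θ (x + v) - θ x‖ₑ ^ 2 ≤ ∫⁻ t in Ioc (0 : ℝ) 1, ‖v‖ₑ ^ 2 * ‖g (x + t • v)‖ₑ ^ 2 := by
    rw [ae_restrict_iff' hUv.measurableSet]
    filter_upwards [ae_translate_sub_eq hU hc hθi hgm hgi hw v] with x hx hxU
    rw [hx hxU, intervalIntegral.integral_of_le zero_le_one]
    have hm : Measurable fun t : ℝ => ‖v‖ₑ * ‖g (x + t • v)‖ₑ := by fun_prop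
    calc ‖∫ t in Ioc (0 : ℝ) 1, (inner ℝ (g (x + t • v)) v : ℝ)‖ₑ ^ 2
        ≤ (∫⁻ t in Ioc (0 : ℝ) 1, ‖v‖ₑ * ‖g (x + t • v)‖ₑ) ^ 2 := by
          refine pow_le_pow_left' ((enorm_integral_le_lintegral_enorm _).trans
            (lintegral_mono fun t => ?_)) 2
          have := norm_inner_le_norm (𝕜 := ℝ) (g (x + t • v)) v
          rw [← ofReal_norm, ← ofReal_norm, ← ofReal_norm,
            ← ENNReal.ofReal_mul (norm_nonneg _), mul_comm ‖v‖]
          exact ENNReal.ofReal_le_ofReal this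
      _ ≤ _ := by
          refine (lintegral_sq_le hm.aemeasurable).trans ?_
          simp [mul_pow]
  refine (lintegral_mono_ae h1).trans ?_
  -- The integral in `x` is enlarged to the whole space, so that each shift by `t • v` can be
  -- undone.
  refine (lintegral_mono' Measure.restrict_le_self le_rfl).trans ?_
  rw [lintegral_lintegral_swap (by fun_prop)]
  have h2 : ∀ t : ℝ, ∫⁻ x : E d, ‖v‖ₑ ^ 2 * ‖g (x + t • v)‖ₑ ^ 2
      = ‖v‖ₑ ^ 2 * ∫⁻ x, ‖g x‖ₑ ^ 2 := by
    intro t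
    rw [lintegral_const_mul _ (by fun_prop),
      lintegral_add_right_eq_self (fun x => ‖g x‖ₑ ^ 2) (t • v)]
  simp [h2]

/-- With `y = x + v` the double integral becomes an integral over shifts `v`, which are confined to
a ball of radius `δ`. This form of Poincaré's inequality avoids mean values. -/
theorem lintegral_lintegral_sub_sq_le (hU : IsOpen U) (hc : Convex ℝ U) (hθi : Integrable θ)
    (hθm : Measurable θ) (hgm : Measurable g) (hgi : Integrable g)
    (hw : ∀ ψ : E d → ℝ, ContDiff ℝ ∞ ψ → HasCompactSupport ψ → tsupport ψ ⊆ U →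
      ∀ v : E d, ∫ x, θ x * inner ℝ (∇ ψ x) v = -∫ x, inner ℝ (g x) v * ψ x)
    {δ : ℝ} (hδ : ∀ x ∈ U, ∀ y ∈ U, dist x y ≤ δ) :
    ∫⁻ x in U, ∫⁻ y in U, ‖θ x - θ y‖ₑ ^ 2
      ≤ ENNReal.ofReal δ ^ 2 * volume (Metric.closedBall (0 : E d) δ) * ∫⁻ x, ‖g x‖ₑ ^ 2 := by
  have hUm := hU.measurableSet
  set K : E d → E d → ℝ≥0∞ := fun x y =>
    U.indicator 1 x * (U.indicator 1 y * ‖θ y - θ x‖ₑ ^ 2) with hK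
  have hind : Measurable (U.indicator (1 : E d → ℝ≥0∞)) := measurable_one.indicator hUm
  have e1 : ∫⁻ x in U, ∫⁻ y in U, ‖θ x - θ y‖ₑ ^ 2 = ∫⁻ x, ∫⁻ y, K x y := by
    rw [← lintegral_indicator hUm]
    refine lintegral_congr fun x => ?_
    by_cases hx : x ∈ U
    · rw [indicator_of_mem hx, ← lintegral_indicator hUm]
      refine lintegral_congr fun y => ?_
      by_cases hy : y ∈ U
      · simp [hK, hx, hy, enorm_sub_rev (θ x)]
      · simp [hK, hx, hy]
    · simp [hK, hx]
  have e2 : ∀ x, ∫⁻ y, K x y = ∫⁻ v, K x (v + x) := fun x =>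
    (lintegral_add_right_eq_self (K x) x).symm
  rw [e1]
  simp only [e2]
  rw [lintegral_lintegral_swap (by
    refine Measurable.aemeasurable ?_
    simp only [hK]
    fun_prop)]
  have e3 : ∀ v, ∫⁻ x, K x (v + x) ≤ (Metric.closedBall (0 : E d) δ).indicator
      (fun _ => ENNReal.ofReal δ ^ 2 * ∫⁻ x, ‖g x‖ₑ ^ 2) v := by
    intro v
    have hUv : IsOpen {x : E d | x ∈ U ∧ x + v ∈ U} :=
      hU.inter (hU.preimage (continuous_id.add continuous_const))
    have h1 : ∫⁻ x, K x (v + x) = ∫⁻ x in {x | x ∈ U ∧ x + v ∈ U}, ‖θ (x + v) - θ x‖ₑ ^ 2 := by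
      rw [← lintegral_indicator hUv.measurableSet]
      refine lintegral_congr fun x => ?_
      by_cases hx : x ∈ U <;> by_cases hy : x + v ∈ U <;> simp [hK, hx, hy, add_comm v x]
    by_cases hv : v ∈ Metric.closedBall (0 : E d) δ
    · rw [indicator_of_mem hv, h1]
      refine (lintegral_translate_sub_sq_le hU hc hθi hgm hgi hw v).trans ?_
      gcongr
      rw [← ofReal_norm]
      exact ENNReal.ofReal_le_ofReal (by simpa using hv)
    · rw [indicator_of_notMem hv, h1]
      have : {x : E d | x ∈ U ∧ x + v ∈ U} = ∅ := by
        ext x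
        simp only [mem_ofPred_eq, mem_empty_iff_false, iff_false]
        rintro ⟨hx, hxv⟩
        exact hv (by simpa [dist_eq_norm] using hδ _ hxv _ hx)
      rw [this]; simp
  refine (lintegral_mono e3).trans (le_of_eq ?_)
  rw [lintegral_indicator Metric.isClosed_closedBall.measurableSet, setLIntegral_const]
  ring

end Translation

theorem integral_bulk_eq_integral {U : Set (E d)} {f : E d → ℝ}
    (hf : ∀ x ∉ U, f x = 0) : ∫ x, f x ∂(bulk U) = ∫ x, f x := by
  rw [bulk, setIntegral_eq_integral_of_forall_compl_eq_zero hf]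

/-- Poincaré's inequality on a bounded convex open set. -/
theorem IsWeakGrad.lintegral_sub_sq_le {U : Set (E d)} {θ : E d → ℝ} {g : E d → E d}
    (hU : IsOpen U) (hc : Convex ℝ U) (hb : Bornology.IsBounded U) (hθ : IsWeakGrad U θ g)
    {δ : ℝ} (hδ : ∀ x ∈ U, ∀ y ∈ U, dist x y ≤ δ) :
    ∫⁻ x in U, ∫⁻ y in U, ‖θ x - θ y‖ₑ ^ 2
      ≤ ENNReal.ofReal δ ^ 2 * volume (Metric.closedBall (0 : E d) δ)
        * ∫⁻ x in U, ‖g x‖ₑ ^ 2 := by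
  have hUm := hU.measurableSet
  have : IsFiniteMeasure (bulk U) := ⟨by
    rw [bulk, Measure.restrict_apply_univ]; exact hb.measure_lt_top⟩
  have hθs := hθ.memLp.aestronglyMeasurable
  have hgs := hθ.memLp_grad.aestronglyMeasurable
  have hθi : Integrable θ (bulk U) := hθ.memLp.integrable (by norm_num)
  have hgi : Integrable g (bulk U) := hθ.memLp_grad.integrable (by norm_num)
  -- Measurable representatives are extended by zero, so that translations act on functions on the
  -- whole space.
  set θ' : E d → ℝ := U.indicator (hθs.mk θ)
  set g' : E d → E d := U.indicator (hgs.mk g)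
  have hθae : θ =ᵐ[bulk U] θ' := hθs.ae_eq_mk.trans (indicator_ae_eq_restrict hUm).symm
  have hgae : g =ᵐ[bulk U] g' := hgs.ae_eq_mk.trans (indicator_ae_eq_restrict hUm).symm
  have hθ'i : Integrable θ' := by
    rw [integrable_indicator_iff hUm]
    exact hθi.congr hθs.ae_eq_mk
  have hg'i : Integrable g' := by
    rw [integrable_indicator_iff hUm]
    exact hgi.congr hgs.ae_eq_mk
  have hw : ∀ ψ : E d → ℝ, ContDiff ℝ ∞ ψ → HasCompactSupport ψ → tsupport ψ ⊆ U →
      ∀ v : E d, ∫ x, θ' x * inner ℝ (∇ ψ x) v = -∫ x, inner ℝ (g' x) v * ψ x := by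
    intro ψ hψ hψc hψs v
    obtain ⟨M, hM⟩ := hψc.exists_bound_of_continuous hψ.continuous
    obtain ⟨M', hM'⟩ := (hasCompactSupport_gradient hψc).exists_bound_of_continuous
      (continuous_gradient hψ)
    have h1 : ∀ i : Fin d, ∫ x, θ' x * (∇ ψ x) i = -∫ x, g' x i * ψ x := by
      intro i
      have h2 : ∫ x, θ x * (∇ ψ x) i ∂(bulk U) = ∫ x, θ' x * (∇ ψ x) i := by
        rw [← integral_bulk_eq_integral (U := U) (fun x hx => by simp [θ', hx])]
        exact integral_congr_ae (by filter_upwards [hθae] with x hx; rw [hx])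
      have h3 : ∫ x, g x i * ψ x ∂(bulk U) = ∫ x, g' x i * ψ x := by
        rw [← integral_bulk_eq_integral (U := U) (fun x hx => by simp [g', hx])]
        exact integral_congr_ae (by filter_upwards [hgae] with x hx; rw [hx])
      rw [← h2, ← h3]
      exact hθ.weak ψ hψ hψc hψs i
    simp only [inner_eq_sum_coord, Finset.mul_sum, Finset.sum_mul]
    rw [integral_finsetSum, integral_finsetSum, ← Finset.sum_neg_distrib]
    · refine Finset.sum_congr rfl fun i _ => ?_
      have h2 := h1 i
      simp only [← mul_assoc]
      rw [integral_mul_const, h2]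
      simp only [mul_right_comm _ (v i)]
      rw [integral_mul_const]
      ring
    · intro i _
      refine Integrable.mul_bdd (c := M) ?_ hψ.continuous.aestronglyMeasurable
        (Eventually.of_forall hM)
      exact ((EuclideanSpace.proj (𝕜 := ℝ) i).integrable_comp hg'i).mul_const _
    · intro i _
      refine Integrable.mul_bdd (c := M' * ‖v i‖) hθ'i ?_ (Eventually.of_forall fun x => ?_)
      · have : Continuous fun x => (∇ ψ x) i :=
          (EuclideanSpace.proj (𝕜 := ℝ) i).continuous.comp (continuous_gradient hψ)
        exact (this.mul continuous_const).aestronglyMeasurable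
      · rw [norm_mul]
        exact mul_le_mul_of_nonneg_right ((PiLp.norm_apply_le _ _).trans (hM' x)) (norm_nonneg _)
  have hmain := lintegral_lintegral_sub_sq_le hU hc hθ'i
    (hθs.stronglyMeasurable_mk.measurable.indicator hUm)
    (hgs.stronglyMeasurable_mk.measurable.indicator hUm) hg'i hw hδ
  have e1 : ∫⁻ x in U, ∫⁻ y in U, ‖θ x - θ y‖ₑ ^ 2 = ∫⁻ x in U, ∫⁻ y in U, ‖θ' x - θ' y‖ₑ ^ 2 := by
    refine lintegral_congr_ae ?_
    filter_upwards [hθae] with x hx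
    refine lintegral_congr_ae ?_
    filter_upwards [hθae] with y hy
    rw [hx, hy]
  have e2 : ∫⁻ x, ‖g' x‖ₑ ^ 2 = ∫⁻ x in U, ‖g x‖ₑ ^ 2 := by
    have : (fun x => ‖g' x‖ₑ ^ 2) = U.indicator (fun x => ‖g' x‖ₑ ^ 2) := by
      ext x; by_cases hx : x ∈ U <;> simp [g', hx]
    rw [this, lintegral_indicator hUm]
    refine lintegral_congr_ae ?_
    filter_upwards [hgae] with x hx
    rw [hx]
  rw [e1, ← e2]
  exact hmain

theorem IsWeakGrad.mono {U V : Set (E d)} {θ : E d → ℝ} {g : E d → E d} (hθ : IsWeakGrad U θ g)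
    (hVU : V ⊆ U) : IsWeakGrad V θ g where
  memLp := hθ.memLp.mono_measure (Measure.restrict_mono hVU le_rfl)
  memLp_grad := hθ.memLp_grad.mono_measure (Measure.restrict_mono hVU le_rfl)
  weak ψ hψ hψc hψs i := by
    have h0 : ∀ x ∉ V, ψ x = 0 := fun x hx => image_eq_zero_of_notMem_tsupport fun h => hx (hψs h)
    have h1 : ∀ x ∉ V, ∇ ψ x = 0 := fun x hx =>
      image_eq_zero_of_notMem_tsupport fun h => hx (hψs (tsupport_gradient_subset h))
    have := hθ.weak ψ hψ hψc (hψs.trans hVU) i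
    rw [integral_bulk_eq_integral fun x hx => by simp [h1 x fun h => hx (hVU h)],
      integral_bulk_eq_integral fun x hx => by simp [h0 x fun h => hx (hVU h)]] at this
    rw [integral_bulk_eq_integral fun x hx => by simp [h1 x hx],
      integral_bulk_eq_integral fun x hx => by simp [h0 x hx], this]

/-! ### Polar coordinates about an interior point of a convex set -/

/-- The point at relative distance `s` on the ray from `c` through `x`. -/
def ray (c : E d) (z : E d × ℝ) : E d := c + z.2 • (z.1 - c)

theorem continuous_ray (c : E d) : Continuous (ray c) := by
  unfold ray; fun_prop

/-- The gauge of `Ω` with respect to the point `c`. -/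
noncomputable def gaugeAt (Ω : Set (E d)) (c : E d) (x : E d) : ℝ := gauge {y | c + y ∈ Ω} (x - c)

/-- The radial projection to the boundary of `Ω`. -/
noncomputable def radialProj (Ω : Set (E d)) (c : E d) (x : E d) : E d :=
  c + (gaugeAt Ω c x)⁻¹ • (x - c)

section Gauge

variable {Ω : Set (E d)} {c : E d} {r : ℝ}

theorem convex_translate (hc : Convex ℝ Ω) : Convex ℝ {y | c + y ∈ Ω} :=
  hc.translate_preimage_right c

theorem ball_subset_translate (hball : Metric.ball c r ⊆ Ω) :
    Metric.ball (0 : E d) r ⊆ {y | c + y ∈ Ω} := fun y hy =>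
  hball (by simpa using hy)

/-- The gauge of a convex set that contains a ball of radius `r` about the origin is Lipschitz with
constant `1 / r`. This controls the radial coordinate near Γ. -/
theorem abs_gaugeAt_sub_le (hc : Convex ℝ Ω) (hr : 0 < r) (hball : Metric.ball c r ⊆ Ω)
    (x y : E d) : |gaugeAt Ω c x - gaugeAt Ω c y| ≤ dist x y / r := by
  have h := (convex_translate hc).lipschitzWith_gauge (r := r.toNNReal) (Real.toNNReal_pos.2 hr)
    (by rw [Real.coe_toNNReal _ hr.le]; exact ball_subset_translate hball)
  have := h.dist_le_mul (x - c) (y - c)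
  rw [Real.dist_eq, dist_sub_right] at this
  rw [NNReal.coe_inv, Real.coe_toNNReal _ hr.le] at this
  rw [div_eq_inv_mul]
  exact this

theorem continuous_gaugeAt (hc : Convex ℝ Ω) (hr : 0 < r) (hball : Metric.ball c r ⊆ Ω) :
    Continuous (gaugeAt Ω c) := by
  have h := continuous_gauge (convex_translate hc)
    (Filter.mem_of_superset (Metric.ball_mem_nhds _ hr) (ball_subset_translate hball))
  exact h.comp (continuous_id.sub continuous_const)

theorem measurable_radialProj (hc : Convex ℝ Ω) (hr : 0 < r) (hball : Metric.ball c r ⊆ Ω) :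
    Measurable (radialProj Ω c) := by
  have := (continuous_gaugeAt hc hr hball).measurable
  unfold radialProj
  fun_prop

theorem mem_frontier_iff_gaugeAt (hc : Convex ℝ Ω) (hr : 0 < r) (hball : Metric.ball c r ⊆ Ω)
    {x : E d} : x ∈ frontier Ω ↔ gaugeAt Ω c x = 1 := by
  unfold gaugeAt
  rw [gauge_eq_one_iff_mem_frontier (convex_translate hc)
    (Filter.mem_of_superset (Metric.ball_mem_nhds _ hr) (ball_subset_translate hball))]
  have : {y | c + y ∈ Ω} = (Homeomorph.addLeft c) ⁻¹' Ω := rfl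
  rw [this, ← Homeomorph.preimage_frontier]
  simp

theorem gaugeAt_ray (hc : Convex ℝ Ω) (hr : 0 < r) (hball : Metric.ball c r ⊆ Ω)
    {x : E d} (hx : x ∈ frontier Ω) {s : ℝ} (hs : 0 ≤ s) : gaugeAt Ω c (ray c (x, s)) = s := by
  rw [mem_frontier_iff_gaugeAt hc hr hball] at hx
  unfold gaugeAt ray at *
  rw [add_sub_cancel_left, gauge_smul_of_nonneg hs, hx, smul_eq_mul, mul_one]

theorem radialProj_ray (hc : Convex ℝ Ω) (hr : 0 < r) (hball : Metric.ball c r ⊆ Ω)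
    {x : E d} (hx : x ∈ frontier Ω) {s : ℝ} (hs : 0 < s) : radialProj Ω c (ray c (x, s)) = x := by
  unfold radialProj
  rw [gaugeAt_ray hc hr hball hx hs.le, ray]
  simp only [add_sub_cancel_left]
  rw [smul_smul, inv_mul_cancel₀ hs.ne', one_smul]
  abel

theorem gaugeAt_pos (hb : Bornology.IsBounded Ω) (hr : 0 < r)
    (hball : Metric.ball c r ⊆ Ω) {x : E d} (hx : x ≠ c) : 0 < gaugeAt Ω c x := by
  refine (gauge_pos ((absorbent_ball_zero hr).mono (ball_subset_translate hball)) ?_).2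
    (sub_ne_zero.2 hx)
  rw [NormedSpace.isVonNBounded_iff]
  have := (Homeomorph.addLeft c).isClosedEmbedding
  have h2 : {y | c + y ∈ Ω} = (fun y => -c + y) '' Ω := by
    ext y
    simp
  rw [h2]
  exact (LipschitzWith.of_dist_le_mul (K := 1) (by simp)).isBounded_image hb

theorem radialProj_mem_frontier (hc : Convex ℝ Ω) (hb : Bornology.IsBounded Ω) (hr : 0 < r)
    (hball : Metric.ball c r ⊆ Ω) {x : E d} (hx : x ≠ c) : radialProj Ω c x ∈ frontier Ω := by
  have hpos := gaugeAt_pos hb hr hball hx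
  rw [mem_frontier_iff_gaugeAt hc hr hball]
  unfold radialProj
  unfold gaugeAt at *
  rw [add_sub_cancel_left, gauge_smul_of_nonneg (inv_nonneg.2 hpos.le), smul_eq_mul,
    inv_mul_cancel₀ hpos.ne']

theorem ray_radialProj (hb : Bornology.IsBounded Ω) (hr : 0 < r)
    (hball : Metric.ball c r ⊆ Ω) {x : E d} (hx : x ≠ c) :
    ray c (radialProj Ω c x, gaugeAt Ω c x) = x := by
  have hpos := gaugeAt_pos hb hr hball hx
  simp only [ray, radialProj, add_sub_cancel_left]
  rw [smul_smul, mul_inv_cancel₀ hpos.ne', one_smul]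
  abel

end Gauge

/-! ### The formula for volume in polar coordinates -/

theorem euclideanHausdorffMeasure_homothety (k : ℕ) (c : E d) {s : ℝ} (hs : 0 < s)
    (A : Set (E d)) :
    (μHE[k] : Measure (E d)) ((fun x => ray c (x, s)) '' A)
      = ENNReal.ofReal (s ^ k) * (μHE[k] : Measure (E d)) A := by
  have h1 : (fun x => ray c (x, s)) = AffineMap.homothety c s := by
    ext x : 1
    simp [ray, AffineMap.homothety_apply, add_comm]
  rw [h1, euclideanHausdorffMeasure_homothety_image k c hs.ne', ENNReal.smul_def, smul_eq_mul,
    ENNReal.ofReal_pow hs.le]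
  congr 1
  rw [ENNReal.coe_pow, ← enorm_eq_nnnorm, Real.enorm_eq_ofReal hs.le]

/-- The volume of a subset of the cone with apex `c` over a flat set. -/
theorem volume_cone {c n : E d} (hn : ‖n‖ = 1) {a : ℝ} (ha : 0 < a) {F : Set (E d)}
    (hF : MeasurableSet F) (hFa : ∀ x ∈ F, inner ℝ n (x - c) = a) {t : Set (E d)}
    (ht : MeasurableSet t) (hcone : ∀ y ∈ t, ∃ x ∈ F, ∃ s : ℝ, 0 < s ∧ y = ray c (x, s)) :
    volume t = ∫⁻ s in Ioi (0 : ℝ), ENNReal.ofReal (a * s ^ (d - 1))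
      * ((μHE[d - 1] : Measure (E d)).restrict F) {x | ray c (x, s) ∈ t} := by
  have hn0 : n ≠ 0 := by rintro rfl; simp at hn
  have hv : a • n ≠ 0 := smul_ne_zero ha.ne' hn0
  -- Volume is sliced by the hyperplanes orthogonal to `n`. With `a • n` as unit of height, the
  -- slice of the cone at height `s` is the flat base scaled by `s` about `c`.
  have h1 := EuclideanGeometry.euclideanHausdorffMeasure_eq_lintegral (V := E d) c hv ht
  rw [finrank_euclideanSpace_fin, euclideanHausdorffMeasure_eq_volume] at h1
  have hnorm : ‖a • n‖ₑ = ENNReal.ofReal a := by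
    rw [← ofReal_norm, norm_smul, hn, mul_one, Real.norm_of_nonneg ha.le]
  rw [h1, hnorm, ← lintegral_const_mul' _ _ ENNReal.ofReal_ne_top,
    ← lintegral_indicator measurableSet_Ioi]
  refine lintegral_congr fun s => ?_
  have hmem : ∀ y : E d, y ∈ (AffineSubspace.mk' (s • (a • n) +ᵥ c) (ℝ ∙ (a • n))ᗮ : Set (E d)) ↔
      inner ℝ n (y - c) = s * a := by
    intro y
    rw [SetLike.mem_coe, AffineSubspace.mem_mk', Submodule.mem_orthogonal_singleton_iff_inner_right,
      vsub_eq_sub, vadd_eq_add, show y - (s • a • n + c) = (y - c) - (s * a) • n by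
        rw [smul_smul]; abel, inner_sub_right, real_inner_smul_right, real_inner_smul_left,
      real_inner_smul_left, real_inner_self_eq_norm_sq, hn]
    constructor
    · intro h
      have : a * (inner ℝ n (y - c) - s * a) = 0 := by linarith
      rcases mul_eq_zero.1 this with h | h
      · exact absurd h ha.ne'
      · linarith
    · intro h; rw [h]; ring
  have hray : ∀ x ∈ F, ∀ s' : ℝ, inner ℝ n (ray c (x, s') - c) = s' * a := by
    intro x hx s'
    simp only [ray, add_sub_cancel_left]
    rw [real_inner_smul_right, hFa x hx]
  by_cases hs : 0 < s
  · rw [indicator_of_mem (mem_Ioi.2 hs), ENNReal.ofReal_mul ha.le, mul_assoc]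
    congr 1
    have himg : t ∩ (AffineSubspace.mk' (s • (a • n) +ᵥ c) (ℝ ∙ (a • n))ᗮ : Set (E d))
        = (fun x => ray c (x, s)) '' ({x | ray c (x, s) ∈ t} ∩ F) := by
      ext y
      constructor
      · rintro ⟨hyt, hy⟩
        obtain ⟨x, hx, s', hs', rfl⟩ := hcone y hyt
        rw [hmem, hray x hx] at hy
        have : s' = s := mul_right_cancel₀ ha.ne' hy
        subst this
        exact ⟨x, ⟨hyt, hx⟩, rfl⟩
      · rintro ⟨x, ⟨hxt, hx⟩, rfl⟩
        exact ⟨hxt, (hmem _).2 (hray x hx s)⟩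
    rw [himg, euclideanHausdorffMeasure_homothety _ _ hs, Measure.restrict_apply' hF]
  · rw [indicator_of_notMem (by simpa using hs)]
    have : t ∩ (AffineSubspace.mk' (s • (a • n) +ᵥ c) (ℝ ∙ (a • n))ᗮ : Set (E d)) = ∅ := by
      ext y
      simp only [mem_inter_iff, mem_empty_iff_false, iff_false, not_and]
      intro hyt hy
      obtain ⟨x, hx, s', hs', rfl⟩ := hcone y hyt
      rw [hmem, hray x hx] at hy
      have : s' = s := mul_right_cancel₀ ha.ne' hy
      exact hs (this ▸ hs')
    rw [this, measure_empty, mul_zero]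

/-- A bounded convex open set with an interior ball and a measurable version `n` of its outer normal,
for which polar coordinates about the centre of the ball are available. -/
structure RadialSurface (Ω : Set (E d)) (c : E d) (r R : ℝ) (n : E d → E d) : Prop where
  convex : Convex ℝ Ω
  pos : 0 < r
  ball_subset : Metric.ball c r ⊆ Ω
  dist_le : ∀ x ∈ frontier Ω, dist x c ≤ R
  finite : IsFiniteMeasure (surf Ω)
  measurable_normal : Measurable n
  normal_eq : ∀ᵐ x ∂(surf Ω), outerNormal Ω x = n x
  norm_normal : ∀ᵐ x ∂(surf Ω), ‖n x‖ = 1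
  le_inner : ∀ᵐ x ∂(surf Ω), r ≤ inner ℝ (n x) (x - c)
  volume_eq : (volume : Measure (E d)) = (((surf Ω).prod (volume.restrict (Ioi (0 : ℝ)))).withDensity
    fun z => ENNReal.ofReal (inner ℝ (n z.1) (z.1 - c) * z.2 ^ (d - 1))).map (ray c)

theorem surf_restrict_hull {Ω : Set (E d)} {s : Finset (E d)} (hs : hull s ⊆ frontier Ω) :
    (surf Ω).restrict (hull s) = (μHE[d - 1] : Measure (E d)).restrict (hull s) := by
  rw [surf, Measure.restrict_restrict (isCompact_hull s).isClosed.measurableSet,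
    inter_eq_left.2 hs]

theorem ae_mem_simplexCore (hd : 2 ≤ d) {Ω : Set (E d)} {T : Finset (Finset (E d))} {ρ h : ℝ}
    (hT : IsTriangulation (d - 1) T (frontier Ω) ρ h) {s : Finset (E d)} (hs : s ∈ T) :
    ∀ᵐ x ∂((surf Ω).restrict (hull s)), x ∈ simplexCore s := by
  rw [surf_restrict_hull (hT.hull_subset hs),
    ae_restrict_iff' (isCompact_hull s).isClosed.measurableSet]
  have h0 := simplexCore_diff_null (by omega) (hT.card_eq s hs)
  rw [← compl_mem_ae_iff] at h0
  filter_upwards [h0] with x hx hxs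
  by_contra hcon
  exact hx ⟨hxs, hcon⟩

/-- The cones with apex `c` over the boundary simplices partition space up to a null set. On each of
them the normal is constant, and `volume_cone` gives the formula. -/
theorem exists_radialSurface (hd : 2 ≤ d) {Ω : Set (E d)} (ho : IsOpen Ω) (hc : Convex ℝ Ω)
    (hb : Bornology.IsBounded Ω) {c : E d} {r R : ℝ} (hr : 0 < r) (hball : Metric.ball c r ⊆ Ω)
    (hR : ∀ x ∈ frontier Ω, dist x c ≤ R) {T : Finset (Finset (E d))} {ρ h : ℝ}
    (hT : IsTriangulation (d - 1) T (frontier Ω) ρ h) (hρh : 0 < ρ * h) :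
    ∃ n, RadialSurface Ω c r R n := by
  classical
  have hne : Ω.Nonempty := ⟨c, hball (Metric.mem_ball_self hr)⟩
  have H := surf_feMeasure hd ho hc hne hT
  have hfin := H.finite
  have hex : ∀ s : Finset (E d), ∃ na : E d × ℝ, s ∈ T → ‖na.1‖ = 1 ∧ r ≤ na.2 ∧
      (∀ x ∈ simplexCore s, outerNormal Ω x = na.1) ∧ ∀ x ∈ hull s, inner ℝ na.1 (x - c) = na.2 := by
    intro s
    by_cases hs : s ∈ T
    · obtain ⟨n, a, h1, h2, -, h3, h4⟩ := hT.exists_normal hd ho hc hr hball hρh hs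
      exact ⟨(n, a), fun _ => ⟨h1, h2, h3, h4⟩⟩
    · exact ⟨0, fun h => absurd h hs⟩
  choose na hna using hex
  -- A sum of indicators is measurable, unlike the normal obtained by choice; at a relative interior
  -- point of a simplex exactly one term is present.
  set n : E d → E d := fun x => ∑ s ∈ T, (hull s).indicator (fun _ => (na s).1) x with hn
  have hcl : ∀ s : Finset (E d), MeasurableSet (hull s) := fun s =>
    (isCompact_hull s).isClosed.measurableSet
  have hncore : ∀ s ∈ T, ∀ x ∈ simplexCore s, n x = (na s).1 := by
    intro s hs x hx
    rw [hn]
    simp only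
    rw [Finset.sum_eq_single s, indicator_of_mem hx.1]
    · intro t ht hts
      exact indicator_of_notMem (fun hxt => hts (hT.eq_of_mem_simplexCore hs ht hx hxt).symm) _
    · exact fun h => absurd hs h
  have hall : ∀ {P : E d → Prop}, (∀ s ∈ T, ∀ x ∈ simplexCore s, P x) → ∀ᵐ x ∂(surf Ω), P x := by
    intro P hP
    have h1 : ∀ s ∈ T, ∀ᵐ x ∂(surf Ω), x ∈ hull s → P x := fun s hs => by
      rw [← ae_restrict_iff' (hcl s)]
      filter_upwards [ae_mem_simplexCore hd hT hs] with x hx using hP s hs x hx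
    have h2 : ∀ᵐ x ∂(surf Ω), ∀ s ∈ T, x ∈ hull s → P x := (ae_ball_iff T.countable_toSet).2 h1
    filter_upwards [h2, H.ae_mem] with x hx hxS
    rw [← hT.cover] at hxS
    simp only [mem_iUnion, exists_prop] at hxS
    obtain ⟨s, hs, hxs⟩ := hxS
    exact hx s hs hxs
  have hnm : Measurable n := Finset.measurable_fun_sum _ fun s _ =>
    measurable_const.indicator (hcl s)
  refine ⟨n, hc, hr, hball, hR, hfin, hnm, ?_, ?_, ?_, ?_⟩
  · exact hall fun s hs x hx => by rw [hncore s hs x hx, (hna s hs).2.2.1 x hx]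
  · exact hall fun s hs x hx => by rw [hncore s hs x hx, (hna s hs).1]
  · exact hall fun s hs x hx => by
      rw [hncore s hs x hx, (hna s hs).2.2.2 x hx.1]; exact (hna s hs).2.1
  have hraym := (continuous_ray c).measurable
  have hpm := measurable_radialProj hc hr hball
  -- the cones over the boundary simplices
  set cone : Finset (E d) → Set (E d) := fun s => {x | x ≠ c ∧ radialProj Ω c x ∈ hull s} with hcone
  have hconem : ∀ s, MeasurableSet (cone s) := fun s =>
    (measurableSet_singleton c).compl.inter (hpm (hcl s))
  have hconev : ∀ s ∈ T, ∀ t : Set (E d), MeasurableSet t → volume (t ∩ cone s)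
      = ∫⁻ u in Ioi (0 : ℝ), ENNReal.ofReal ((na s).2 * u ^ (d - 1))
        * ((surf Ω).restrict (hull s)) {x | ray c (x, u) ∈ t} := by
    intro s hs t ht
    rw [volume_cone (hna s hs).1 (hr.trans_le (hna s hs).2.1) (hcl s)
      (hna s hs).2.2.2 (ht.inter (hconem s)) ?_, surf_restrict_hull (hT.hull_subset hs)]
    · refine setLIntegral_congr_fun measurableSet_Ioi fun u hu => ?_
      simp only
      congr 1
      refine measure_congr ?_
      rw [Filter.eventuallyEq_set, ae_restrict_iff' (hcl s)]
      refine Eventually.of_forall fun x hx => ?_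
      have hxf := hT.hull_subset hs hx
      have h1 : ray c (x, u) ≠ c := by
        intro h
        have h2 := gaugeAt_ray hc hr hball hxf (le_of_lt hu)
        rw [h] at h2
        simp only [gaugeAt, sub_self, gauge_zero] at h2
        exact (ne_of_gt hu) h2.symm
      simp only [mem_ofPred_eq, mem_inter_iff, hcone, radialProj_ray hc hr hball hxf hu, h1, hx,
        ne_eq, not_false_eq_true, and_self, and_true]
    · rintro y ⟨-, hy, hyF⟩
      exact ⟨_, hyF, _, gaugeAt_pos hb hr hball hy, (ray_radialProj hb hr hball hy).symm⟩
  refine Measure.ext fun t ht => ?_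
  -- left-hand side
  have hL : volume t = ∑ s ∈ T, volume (t ∩ cone s) := by
    have : Nontrivial (E d) := by
      have : Nonempty (Fin d) := ⟨⟨0, by omega⟩⟩
      infer_instance
    rw [← measure_biUnion_finset₀]
    · refine measure_congr ?_
      have hc0 : ∀ᵐ x : E d, x ≠ c := by
        rw [ae_iff]; simp
      rw [Filter.eventuallyEq_set]
      filter_upwards [hc0] with x hx
      have hxf := radialProj_mem_frontier hc hb hr hball hx
      rw [← hT.cover] at hxf
      simp only [mem_iUnion, exists_prop] at hxf ⊢
      obtain ⟨s, hs, hxs⟩ := hxf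
      exact ⟨fun h => ⟨s, hs, h, hx, hxs⟩, fun ⟨_, _, h, _⟩ => h⟩
    -- The cone formula itself shows that two cones overlap in a null set: each of its slices comes
    -- from the common part of two boundary simplices.
    · intro s hs s' hs' hss
      refine measure_mono_null (t := cone s' ∩ cone s) (fun x hx => ⟨hx.2.2, hx.1.2⟩) ?_
      rw [hconev s hs _ (hconem s')]
      have : ∀ u ∈ Ioi (0 : ℝ), ENNReal.ofReal ((na s).2 * u ^ (d - 1))
          * ((surf Ω).restrict (hull s)) {x | ray c (x, u) ∈ cone s'} = 0 := by
        intro u hu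
        rw [Measure.restrict_apply' (hcl s)]
        have : (surf Ω) ({x | ray c (x, u) ∈ cone s'} ∩ hull s) = 0 := by
          refine measure_mono_null ?_ (H.overlap_null s hs s' hs' hss)
          rintro x ⟨hx1, hx2⟩
          have := hx1.2
          rw [radialProj_ray hc hr hball (hT.hull_subset hs hx2) hu] at this
          exact ⟨hx2, this⟩
        rw [this, mul_zero]
      rw [setLIntegral_congr_fun measurableSet_Ioi this]
      simp
    · exact fun s _ => (ht.inter (hconem s)).nullMeasurableSet
  have hDm : Measurable fun z : E d × ℝ =>
      ENNReal.ofReal (inner ℝ (n z.1) (z.1 - c) * z.2 ^ (d - 1)) := by fun_prop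
  rw [Measure.map_apply hraym ht, withDensity_apply _ (hraym ht),
    ← lintegral_indicator (hraym ht), lintegral_prod_symm' _ (hDm.indicator (hraym ht)), hL]
  have hmm : ∀ s : Finset (E d), Measurable fun u : ℝ => ENNReal.ofReal ((na s).2 * u ^ (d - 1))
        * ((surf Ω).restrict (hull s)) {x | ray c (x, u) ∈ t} := fun s =>
    Measurable.mul (by fun_prop) (measurable_measure_prodMk_right (hraym ht))
  rw [Finset.sum_congr rfl fun s hs => hconev s hs t ht, ← lintegral_finsetSum _ fun s _ => hmm s]
  refine setLIntegral_congr_fun measurableSet_Ioi fun u hu => ?_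
  conv_rhs => rw [H.eq_sum_restrict]
  rw [lintegral_finsetSum_measure]
  refine Finset.sum_congr rfl fun s hs => ?_
  have hsec : MeasurableSet {x : E d | ray c (x, u) ∈ t} :=
    measurable_prodMk_right (hraym ht)
  rw [← lintegral_indicator_const hsec]
  refine lintegral_congr_ae ?_
  filter_upwards [ae_mem_simplexCore hd hT hs] with x hx
  by_cases hxt : ray c (x, u) ∈ t
  · rw [indicator_of_mem (show x ∈ {x : E d | ray c (x, u) ∈ t} from hxt),
      indicator_of_mem (show (x, u) ∈ ray c ⁻¹' t from hxt)]
    simp only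
    rw [hncore s hs x hx, (hna s hs).2.2.2 x hx.1]
  · rw [indicator_of_notMem (show x ∉ {x : E d | ray c (x, u) ∈ t} from hxt),
      indicator_of_notMem (show (x, u) ∉ ray c ⁻¹' t from hxt)]

namespace RadialSurface

variable {Ω : Set (E d)} {c : E d} {r R : ℝ} {n : E d → E d}

theorem ae_mem_frontier : ∀ᵐ x ∂(surf Ω), x ∈ frontier Ω :=
  ae_restrict_mem isClosed_frontier.measurableSet

theorem lintegral_eq (H : RadialSurface Ω c r R n) {f : E d → ℝ≥0∞} (hf : Measurable f) :
    ∫⁻ x, f x = ∫⁻ x, (∫⁻ s in Ioi (0 : ℝ),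
      ENNReal.ofReal (inner ℝ (n x) (x - c) * s ^ (d - 1)) * f (ray c (x, s))) ∂(surf Ω) := by
  have hm := H.measurable_normal
  have hray := (continuous_ray c).measurable
  have hfin := H.finite
  have hDm : Measurable fun z : E d × ℝ =>
      ENNReal.ofReal (inner ℝ (n z.1) (z.1 - c) * z.2 ^ (d - 1)) := by fun_prop
  conv_lhs => rw [H.volume_eq]
  rw [lintegral_map hf hray]
  refine (lintegral_withDensity_eq_lintegral_mul _ hDm (hf.comp hray)).trans ?_
  rw [lintegral_prod _ (hDm.mul (hf.comp hray)).aemeasurable]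
  rfl

/-- The gauge is `s` at the point on the ray and one at `p`, and it is Lipschitz. Sliding the point
along its ray to Γ moves it by at most `R * |s - 1|`. -/
theorem ray_mem_ball (H : RadialSurface Ω c r R n) {p x : E d} (hp : p ∈ frontier Ω)
    (hx : x ∈ frontier Ω) {s δ : ℝ} (hs : 0 ≤ s) (h : ray c (x, s) ∈ Metric.ball p δ) :
    |s - 1| < δ / r ∧ dist x p < R * (δ / r) + δ := by
  have hr := H.pos
  have h1 := abs_gaugeAt_sub_le H.convex hr H.ball_subset (ray c (x, s)) p
  rw [gaugeAt_ray H.convex hr H.ball_subset hx hs,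
    (mem_frontier_iff_gaugeAt H.convex hr H.ball_subset).1 hp] at h1
  have h2 : |s - 1| < δ / r := h1.trans_lt (by gcongr; exact h)
  refine ⟨h2, ?_⟩
  have h3 : dist x (ray c (x, s)) ≤ R * |s - 1| := by
    have : x - ray c (x, s) = (1 - s) • (x - c) := by
      simp only [ray]; module
    rw [dist_eq_norm, this, norm_smul, Real.norm_eq_abs, abs_sub_comm, mul_comm, ← dist_eq_norm]
    exact mul_le_mul_of_nonneg_right (H.dist_le x hx) (abs_nonneg _)
  have hR : 0 ≤ R := dist_nonneg.trans (H.dist_le x hx)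
  calc dist x p ≤ dist x (ray c (x, s)) + dist (ray c (x, s)) p := dist_triangle _ _ _
    _ < R * (δ / r) + δ := add_lt_add_of_le_of_lt
        (h3.trans (mul_le_mul_of_nonneg_left h2.le hR)) h

theorem mem_Ioo_of_ray_mem_ball (H : RadialSurface Ω c r R n) {p x : E d} (hp : p ∈ frontier Ω)
    (hx : x ∈ frontier Ω) {s δ : ℝ} (hs : 0 ≤ s) (hδ : δ ≤ r / 2)
    (h : ray c (x, s) ∈ Metric.ball p δ) : s ∈ Ioo (1 / 2 : ℝ) (3 / 2) := by
  have h1 := (H.ray_mem_ball hp hx hs h).1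
  have h2 : δ / r ≤ 1 / 2 := by
    rw [div_le_iff₀ H.pos]; linarith
  have h3 := abs_lt.1 (h1.trans_le h2)
  constructor <;> linarith [h3.1, h3.2]

theorem inner_le (H : RadialSurface Ω c r R n) : ∀ᵐ x ∂(surf Ω),
    r ≤ inner ℝ (n x) (x - c) ∧ inner ℝ (n x) (x - c) ≤ R ∧ ‖n x‖ = 1 ∧ x ∈ frontier Ω ∧
      ‖x - c‖ ≤ R := by
  filter_upwards [H.le_inner, H.norm_normal, ae_mem_frontier (Ω := Ω)] with x h1 h2 h3
  have h4 : ‖x - c‖ ≤ R := by rw [← dist_eq_norm]; exact H.dist_le x h3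
  refine ⟨h1, (real_inner_le_norm _ _).trans ?_, h2, h3, h4⟩
  rwa [h2, one_mul]

/-- In polar coordinates the ball lies over a surface ball of radius `R * (δ / r) + δ`, in a radial
interval of length `2 * (δ / r)`, where the density is at most `R * (3 / 2) ^ (d - 1)`. -/
theorem lintegral_ball_le (H : RadialSurface Ω c r R n) {p : E d} (hp : p ∈ frontier Ω) {δ : ℝ}
    (hδ : δ ≤ r / 2) {F f : E d → ℝ≥0∞} (hF : Measurable F) {K : ℝ≥0∞} (hK : K ≠ ⊤)
    (hFf : ∀ᵐ x ∂(surf Ω), ∀ s ∈ Ioo (1 / 2 : ℝ) (3 / 2), F (ray c (x, s)) ≤ K * f x) :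
    ∫⁻ x in Metric.ball p δ, F x ≤ ENNReal.ofReal (R * (3 / 2) ^ (d - 1)) *
      ENNReal.ofReal (2 * (δ / r)) * K *
        ∫⁻ x in Metric.ball p (R * (δ / r) + δ), f x ∂(surf Ω) := by
  have hBm : MeasurableSet (Metric.ball p δ) := Metric.isOpen_ball.measurableSet
  rw [← lintegral_indicator hBm, H.lintegral_eq (hF.indicator hBm),
    ← lintegral_indicator Metric.isOpen_ball.measurableSet]
  rw [← lintegral_const_mul' _ _
    (ENNReal.mul_ne_top (ENNReal.mul_ne_top ENNReal.ofReal_ne_top ENNReal.ofReal_ne_top) hK)]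
  refine lintegral_mono_ae ?_
  filter_upwards [H.inner_le, hFf] with x ⟨h1, h2, h3, hxf, h4⟩ hx
  by_cases hxp : x ∈ Metric.ball p (R * (δ / r) + δ)
  · rw [indicator_of_mem hxp]
    calc ∫⁻ s in Ioi (0 : ℝ), ENNReal.ofReal (inner ℝ (n x) (x - c) * s ^ (d - 1))
            * (Metric.ball p δ).indicator F (ray c (x, s))
        ≤ ∫⁻ s in Ioi (0 : ℝ), (Ioo (1 - δ / r) (1 + δ / r)).indicator
            (fun _ => ENNReal.ofReal (R * (3 / 2) ^ (d - 1)) * (K * f x)) s := by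
          refine setLIntegral_mono' measurableSet_Ioi fun s hs => ?_
          by_cases hsB : ray c (x, s) ∈ Metric.ball p δ
          · have h5 := H.mem_Ioo_of_ray_mem_ball hp hxf (le_of_lt hs) hδ hsB
            have h6 := abs_lt.1 (H.ray_mem_ball hp hxf (le_of_lt hs) hsB).1
            rw [indicator_of_mem hsB,
              indicator_of_mem (show s ∈ Ioo _ _ from ⟨by linarith [h6.1], by linarith [h6.2]⟩)]
            refine mul_le_mul' (ENNReal.ofReal_le_ofReal ?_) (hx s h5)
            have hR : 0 ≤ R := (norm_nonneg _).trans h4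
            have hs0 : (0 : ℝ) ≤ s := le_of_lt hs
            exact mul_le_mul h2 (pow_le_pow_left₀ hs0 h5.2.le _) (by positivity) hR
          · rw [indicator_of_notMem hsB, mul_zero]
            exact zero_le
      _ ≤ ∫⁻ s, (Ioo (1 - δ / r) (1 + δ / r)).indicator
            (fun _ => ENNReal.ofReal (R * (3 / 2) ^ (d - 1)) * (K * f x)) s :=
          lintegral_mono' Measure.restrict_le_self le_rfl
      _ = _ := by
          rw [lintegral_indicator measurableSet_Ioo, setLIntegral_const, Real.volume_Ioo,
            show 1 + δ / r - (1 - δ / r) = 2 * (δ / r) by ring]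
          ring
  · rw [indicator_of_notMem hxp]
    refine le_of_eq ?_
    rw [mul_zero, lintegral_eq_zero_of_ae_eq_zero]
    filter_upwards [ae_restrict_mem measurableSet_Ioi] with s hs
    have : ray c (x, s) ∉ Metric.ball p δ := fun h =>
      hxp (H.ray_mem_ball hp hxf (le_of_lt hs) h).2
    rw [indicator_of_notMem this, mul_zero]
    rfl

/-- Only the shell `1 < s < 1 + t` over the surface ball is kept. There the density is at least `r`,
and the points are within `R * t` of Γ along their rays, hence in the larger ball. -/
theorem le_lintegral_ball (H : RadialSurface Ω c r R n) {p : E d} {t : ℝ}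
    {F f : E d → ℝ≥0∞} (hF : Measurable F)
    (hFf : ∀ x ∈ frontier Ω, ∀ s, 0 < s → F (ray c (x, s)) = f x) :
    ENNReal.ofReal (r * t) * ∫⁻ x in Metric.ball p t, f x ∂(surf Ω)
      ≤ ∫⁻ x in Metric.ball p ((1 + R) * t), F x := by
  have hBm : MeasurableSet (Metric.ball p ((1 + R) * t)) := Metric.isOpen_ball.measurableSet
  rw [← lintegral_indicator hBm, H.lintegral_eq (hF.indicator hBm),
    ← lintegral_indicator Metric.isOpen_ball.measurableSet,
    ← lintegral_const_mul' _ _ ENNReal.ofReal_ne_top]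
  refine lintegral_mono_ae ?_
  filter_upwards [H.inner_le] with x ⟨h1, h2, h3, hxf, h4⟩
  by_cases hxp : x ∈ Metric.ball p t
  · rw [indicator_of_mem hxp]
    have hr := H.pos
    calc ENNReal.ofReal (r * t) * f x
        = ∫⁻ s in Ioo (1 : ℝ) (1 + t), ENNReal.ofReal r * f x := by
          rw [setLIntegral_const, Real.volume_Ioo, ENNReal.ofReal_mul hr.le, add_sub_cancel_left]
          ring
      _ ≤ ∫⁻ s in Ioo (1 : ℝ) (1 + t), ENNReal.ofReal (inner ℝ (n x) (x - c) * s ^ (d - 1))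
            * (Metric.ball p ((1 + R) * t)).indicator F (ray c (x, s)) := by
          refine setLIntegral_mono' measurableSet_Ioo fun s hs => ?_
          have hsB : ray c (x, s) ∈ Metric.ball p ((1 + R) * t) := by
            have h5 : dist (ray c (x, s)) x ≤ t * R := by
              have : ray c (x, s) - x = (s - 1) • (x - c) := by
                simp only [ray]; module
              rw [dist_eq_norm, this, norm_smul, Real.norm_of_nonneg (by linarith [hs.1])]
              exact mul_le_mul (by linarith [hs.2]) h4 (norm_nonneg _) (by linarith [hs.1, hs.2])
            have h6 := dist_triangle (ray c (x, s)) x p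
            have h7 : dist x p < t := hxp
            rw [Metric.mem_ball]
            linarith
          rw [indicator_of_mem hsB, hFf x hxf s (by linarith [hs.1])]
          refine mul_le_mul' (ENNReal.ofReal_le_ofReal ?_) le_rfl
          have h8 : 1 ≤ s ^ (d - 1) := one_le_pow₀ hs.1.le
          nlinarith
      _ ≤ _ := by
          refine lintegral_mono_set ?_
          intro s hs
          exact zero_lt_one.trans hs.1
  · rw [indicator_of_notMem hxp, mul_zero]
    exact zero_le

/-! ### The radial extension of a function on the boundary -/

/-- The bound on `δ` confines the support to radial coordinates between 1/2 and 3/2, where the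
product measure is finite and powers of `s` are harmless. -/
theorem integral_eq (H : RadialSurface Ω c r R n) {p : E d} (hp : p ∈ frontier Ω) {δ : ℝ}
    (hδ : δ ≤ r / 2) {f : E d → ℝ} (hf : Measurable f) (hf0 : ∀ x ∉ Metric.ball p δ, f x = 0) :
    ∫ x, f x = ∫ z, inner ℝ (n z.1) (z.1 - c) * z.2 ^ (d - 1) * f (ray c z)
      ∂((surf Ω).prod (volume.restrict (Ioc (1 / 2 : ℝ) (3 / 2)))) := by
  have hm := H.measurable_normal
  have hray := (continuous_ray c).measurable
  have hfin := H.finite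
  have hDm : Measurable fun z : E d × ℝ =>
      ENNReal.ofReal (inner ℝ (n z.1) (z.1 - c) * z.2 ^ (d - 1)) := by fun_prop
  have hsub : Ioc (1 / 2 : ℝ) (3 / 2) ⊆ Ioi 0 := fun s hs => lt_trans (by norm_num) hs.1
  have hres : (surf Ω).prod (volume.restrict (Ioc (1 / 2 : ℝ) (3 / 2)))
      = ((surf Ω).prod (volume.restrict (Ioi (0 : ℝ)))).restrict (univ ×ˢ Ioc (1 / 2 : ℝ) (3 / 2)) := by
    rw [← Measure.prod_restrict, Measure.restrict_univ, Measure.restrict_restrict measurableSet_Ioc,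
      inter_eq_left.2 hsub]
  have h1 : ∀ᵐ z ∂((surf Ω).prod (volume.restrict (Ioi (0 : ℝ)))),
      r ≤ inner ℝ (n z.1) (z.1 - c) ∧ z.1 ∈ frontier Ω ∧ z.2 ∈ Ioi (0 : ℝ) := by
    filter_upwards [Measure.quasiMeasurePreserving_fst.ae H.inner_le,
      Measure.quasiMeasurePreserving_snd.ae
        (ae_restrict_mem (μ := (volume : Measure ℝ)) (measurableSet_Ioi (a := (0 : ℝ))))]
      with z hz1 hz2
    exact ⟨hz1.1, hz1.2.2.2.1, hz2⟩
  conv_lhs => rw [H.volume_eq]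
  rw [integral_map hray.aemeasurable hf.aestronglyMeasurable,
    integral_withDensity_eq_integral_toReal_smul hDm (Eventually.of_forall fun _ => ENNReal.ofReal_lt_top),
    hres, setIntegral_eq_integral_of_ae_compl_eq_zero]
  · refine integral_congr_ae ?_
    filter_upwards [h1] with z hz
    rw [ENNReal.toReal_ofReal, smul_eq_mul]
    exact mul_nonneg (H.pos.le.trans hz.1) (pow_nonneg (le_of_lt hz.2.2) _)
  · filter_upwards [h1] with z hz hzI
    rw [hf0, mul_zero]
    intro hmem
    have h2 := H.mem_Ioo_of_ray_mem_ball hp hz.2.1 (le_of_lt hz.2.2) hδ hmem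
    exact hzI ⟨mem_univ _, h2.1, h2.2.le⟩

/-- The gradient of the radial extension of a function on the boundary with gradient `g`. -/
noncomputable def radialGrad (Ω : Set (E d)) (c : E d) (n g : E d → E d) (x : E d) : E d :=
  (gaugeAt Ω c x)⁻¹ • (g (radialProj Ω c x)
    - (inner ℝ (g (radialProj Ω c x)) (radialProj Ω c x - c)
      / inner ℝ (n (radialProj Ω c x)) (radialProj Ω c x - c)) • n (radialProj Ω c x))

/-- The multiple of `n x` is the one that makes the vector orthogonal to `x - c`, as it must be for
a function constant along rays; the factor `s⁻¹` reflects homogeneity of degree zero. -/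
theorem radialGrad_ray (H : RadialSurface Ω c r R n) {g : E d → E d} {x : E d}
    (hx : x ∈ frontier Ω) {s : ℝ} (hs : 0 < s) :
    radialGrad Ω c n g (ray c (x, s))
      = s⁻¹ • (g x - (inner ℝ (g x) (x - c) / inner ℝ (n x) (x - c)) • n x) := by
  unfold radialGrad
  rw [gaugeAt_ray H.convex H.pos H.ball_subset hx hs.le,
    radialProj_ray H.convex H.pos H.ball_subset hx hs]

theorem measurable_radialGrad (H : RadialSurface Ω c r R n) {g : E d → E d} (hg : Measurable g) :
    Measurable (radialGrad Ω c n g) := by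
  have h1 := measurable_radialProj H.convex H.pos H.ball_subset
  have h2 := (continuous_gaugeAt H.convex H.pos H.ball_subset).measurable
  have h3 := H.measurable_normal
  unfold radialGrad
  fun_prop

theorem enorm_radialGrad_le (H : RadialSurface Ω c r R n) (g : E d → E d) :
    ∀ᵐ x ∂(surf Ω), ∀ s ∈ Ioo (1 / 2 : ℝ) (3 / 2), ‖radialGrad Ω c n g (ray c (x, s))‖ₑ ^ 2
      ≤ ENNReal.ofReal ((2 * (1 + R / r)) ^ 2) * ‖g x‖ₑ ^ 2 := by
  filter_upwards [H.inner_le] with x ⟨h1, h2, h3, hxf, h4⟩ s hs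
  have hr := H.pos
  have hs0 : 0 < s := lt_trans (by norm_num) hs.1
  have hR : 0 ≤ R := (norm_nonneg _).trans h4
  rw [H.radialGrad_ray hxf hs0, ENNReal.ofReal_pow (by positivity), ← mul_pow]
  refine pow_le_pow_left' ?_ 2
  rw [← ofReal_norm, ← ofReal_norm, ← ENNReal.ofReal_mul (by positivity)]
  refine ENNReal.ofReal_le_ofReal ?_
  rw [norm_smul, norm_inv, Real.norm_of_nonneg hs0.le]
  have h5 : s⁻¹ ≤ 2 := by
    rw [inv_le_comm₀ hs0 (by norm_num)]
    have := hs.1; norm_num at this ⊢; linarith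
  have h6 : ‖g x - (inner ℝ (g x) (x - c) / inner ℝ (n x) (x - c)) • n x‖ ≤ (1 + R / r) * ‖g x‖ := by
    refine (norm_sub_le _ _).trans ?_
    rw [norm_smul, h3, mul_one, norm_div, add_mul, one_mul]
    gcongr
    rw [Real.norm_eq_abs, Real.norm_eq_abs, div_mul_eq_mul_div, mul_comm R]
    have h7 := abs_real_inner_le_norm (g x) (x - c)
    have h8 : r ≤ |inner ℝ (n x) (x - c)| := h1.trans (le_abs_self _)
    exact div_le_div₀ (by positivity) (h7.trans (by gcongr)) hr h8
  calc s⁻¹ * _ ≤ 2 * ((1 + R / r) * ‖g x‖) := mul_le_mul h5 h6 (norm_nonneg _) (by norm_num)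
    _ = _ := by ring

end RadialSurface

theorem hasFDerivAt_ray (c x : E d) (s : ℝ) :
    HasFDerivAt (fun y => ray c (y, s)) (s • ContinuousLinearMap.id ℝ (E d)) x := by
  have := (((hasFDerivAt_id (𝕜 := ℝ) x).sub_const c).const_smul s).const_add c
  exact this

theorem inner_single_left (i : Fin d) (x : E d) :
    inner ℝ x (EuclideanSpace.single i (1 : ℝ)) = x i := by
  simp [EuclideanSpace.inner_single_right]

theorem gradient_apply (ψ : E d → ℝ) (x : E d) (j : Fin d) :
    (∇ ψ x) j = fderiv ℝ ψ x (EuclideanSpace.single j 1) := by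
  rw [← inner_single_left, inner_gradient_eq]

theorem gradient_coord_mul_comp_ray {ψ : E d → ℝ} (hψ : ContDiff ℝ ∞ ψ) (c x : E d) (s : ℝ)
    (i j : Fin d) :
    (∇ (fun y => (y i - c i) * ψ (ray c (y, s))) x) j
      = (if i = j then ψ (ray c (x, s)) else 0) + (x i - c i) * (s * (∇ ψ (ray c (x, s))) j) := by
  have h1 : HasFDerivAt (fun y : E d => y i - c i) (EuclideanSpace.proj (𝕜 := ℝ) i) x :=
    ((EuclideanSpace.proj (𝕜 := ℝ) i).hasFDerivAt).sub_const _
  have h2 : HasFDerivAt (fun y => ψ (ray c (y, s)))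
      ((fderiv ℝ ψ (ray c (x, s))).comp (s • ContinuousLinearMap.id ℝ (E d))) x :=
    (hψ.differentiable (by simp) _).hasFDerivAt.comp x (hasFDerivAt_ray c x s)
  have h3 := h1.mul h2
  rw [gradient_apply, gradient_apply]
  have h4 : fderiv ℝ (fun y => (y i - c i) * ψ (ray c (y, s))) x = _ := h3.fderiv
  rw [h4]
  simp only [ContinuousLinearMap.add_apply, ContinuousLinearMap.smul_apply,
    ContinuousLinearMap.comp_apply, ContinuousLinearMap.id_apply, map_smul, smul_eq_mul,
    PiLp.proj_apply, EuclideanSpace.single_apply]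
  split_ifs <;> ring

/-! ### Weak differentiability of the radial extension -/

namespace RadialSurface

variable {Ω : Set (E d)} {c : E d} {r R : ℝ} {n : E d → E d} {θ : E d → ℝ} {g : E d → E d}

theorem ae_abs_coord_le (H : RadialSurface Ω c r R n) (i : Fin d) :
    ∀ᵐ x ∂(surf Ω), ‖n x i‖ ≤ 1 := by
  filter_upwards [H.norm_normal] with x hx
  rw [← hx]
  exact PiLp.norm_apply_le _ _

/-- The weak identities on Γ for the index pairs `(i, j)` are tested with `(y i - c i) * ψ (ray c
(y, s))` and summed over `i`. This contracts the normal with `x - c`, and the divergence of `y - c`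
leaves the factor `d - 1`. -/
theorem integral_slice_eq_zero (H : RadialSurface Ω c r R n) (hθi : Integrable θ (surf Ω))
    (hgi : Integrable g (surf Ω))
    (hw : ∀ ψ : E d → ℝ, ContDiff ℝ ∞ ψ → HasCompactSupport ψ → ∀ i j : Fin d,
      ∫ x, θ x * (n x i * (∇ ψ x) j - n x j * (∇ ψ x) i) ∂(surf Ω)
        = -∫ x, (n x i * g x j - n x j * g x i) * ψ x ∂(surf Ω))
    {ψ : E d → ℝ} (hψ : ContDiff ℝ ∞ ψ) (hψc : HasCompactSupport ψ) {s : ℝ} (hs : 0 < s)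
    (j : Fin d) :
    ∫ x, (s * inner ℝ (n x) (x - c) * θ x * (∇ ψ (ray c (x, s))) j
      + (inner ℝ (n x) (x - c) * g x j - inner ℝ (g x) (x - c) * n x j) * ψ (ray c (x, s))
      - θ x * n x j * ((d - 1) * ψ (ray c (x, s)) + s * inner ℝ (∇ ψ (ray c (x, s))) (x - c)))
      ∂(surf Ω) = 0 := by
  have hfin := H.finite
  have hnm := H.measurable_normal
  set χ : Fin d → E d → ℝ := fun i y => (y i - c i) * ψ (ray c (y, s)) with hχ
  have hrayc : Continuous fun y : E d => ray c (y, s) := (continuous_ray c).comp (by fun_prop)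
  have hχs : ∀ i, ContDiff ℝ ∞ (χ i) := by
    intro i
    have h1 : ContDiff ℝ ∞ fun y : E d => y i - c i :=
      (EuclideanSpace.proj (𝕜 := ℝ) i).contDiff.sub contDiff_const
    have h2 : ContDiff ℝ ∞ fun y : E d => ray c (y, s) := by
      unfold ray
      exact contDiff_const.add ((contDiff_id.sub contDiff_const).const_smul s)
    exact h1.mul (hψ.comp h2)
  have hχc : ∀ i, HasCompactSupport (χ i) := by
    intro i
    refine HasCompactSupport.mul_left ?_
    let e : E d ≃ₜ E d := ((Homeomorph.addRight (-c)).trans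
      (Homeomorph.smulOfNeZero s hs.ne')).trans (Homeomorph.addLeft c)
    have he : (fun y : E d => ψ (ray c (y, s))) = ψ ∘ e := by
      ext y
      simp [e, ray, sub_eq_add_neg]
    rw [he]
    exact hψc.comp_homeomorph e
  have hint : ∀ i, Integrable (fun x => θ x * (n x i * (∇ (χ i) x) j - n x j * (∇ (χ i) x) i))
      (surf Ω) := by
    intro i
    obtain ⟨M, hM⟩ := (hasCompactSupport_gradient (hχc i)).exists_bound_of_continuous
      (continuous_gradient (hχs i))
    have hcg : ∀ k : Fin d, Measurable fun x => (∇ (χ i) x) k := fun k =>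
      ((EuclideanSpace.proj (𝕜 := ℝ) k).continuous.comp (continuous_gradient (hχs i))).measurable
    have hcn : ∀ k : Fin d, Measurable fun x => n x k := fun k =>
      (EuclideanSpace.proj (𝕜 := ℝ) k).continuous.measurable.comp hnm
    refine hθi.mul_bdd (c := M + M) (((hcn i).mul (hcg j)).sub
      ((hcn j).mul (hcg i))).aestronglyMeasurable ?_
    filter_upwards [H.ae_abs_coord_le i, H.ae_abs_coord_le j] with x h1 h2
    refine (norm_sub_le _ _).trans (add_le_add ?_ ?_) <;> rw [norm_mul, ← one_mul M]
    · exact mul_le_mul h1 ((PiLp.norm_apply_le _ _).trans (hM x)) (norm_nonneg _) zero_le_one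
    · exact mul_le_mul h2 ((PiLp.norm_apply_le _ _).trans (hM x)) (norm_nonneg _) zero_le_one
  have hint' : ∀ i, Integrable (fun x => (n x i * g x j - n x j * g x i) * χ i x) (surf Ω) := by
    intro i
    obtain ⟨M, hM⟩ := (hχc i).exists_bound_of_continuous (hχs i).continuous
    have hcn : ∀ k : Fin d, Measurable fun x => n x k := fun k =>
      (EuclideanSpace.proj (𝕜 := ℝ) k).continuous.measurable.comp hnm
    refine Integrable.mul_bdd (c := M) ?_ (hχs i).continuous.aestronglyMeasurable
      (Eventually.of_forall hM)
    refine Integrable.sub ?_ ?_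
    · exact ((EuclideanSpace.proj (𝕜 := ℝ) j).integrable_comp hgi).bdd_mul
        (hcn i).aestronglyMeasurable (H.ae_abs_coord_le i)
    · exact ((EuclideanSpace.proj (𝕜 := ℝ) i).integrable_comp hgi).bdd_mul
        (hcn j).aestronglyMeasurable (H.ae_abs_coord_le j)
  have hsum : ∑ i, ∫ x, (θ x * (n x i * (∇ (χ i) x) j - n x j * (∇ (χ i) x) i)
      + (n x i * g x j - n x j * g x i) * χ i x) ∂(surf Ω) = 0 := by
    refine Finset.sum_eq_zero fun i _ => ?_
    rw [integral_add (hint i) (hint' i), hw (χ i) (hχs i) (hχc i) i j]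
    ring
  rw [← integral_finsetSum (f := fun i x => θ x * (n x i * (∇ (χ i) x) j - n x j * (∇ (χ i) x) i)
      + (n x i * g x j - n x j * g x i) * χ i x) _ fun i _ => (hint i).add (hint' i)] at hsum
  rw [← hsum]
  refine integral_congr_ae (Eventually.of_forall fun x => ?_)
  simp only [hχ, gradient_coord_mul_comp_ray hψ]
  simp only [inner_eq_sum_coord, PiLp.sub_apply, if_true]
  set P := ψ (ray c (x, s))
  set Q := ∇ ψ (ray c (x, s))
  have e1 : ∀ i, θ x * (n x i * ((if i = j then P else 0) + (x i - c i) * (s * Q j))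
        - n x j * (P + (x i - c i) * (s * Q i))) + (n x i * g x j - n x j * g x i) * ((x i - c i) * P)
      = θ x * (if i = j then n x i * P else 0) + (s * θ x * Q j) * (n x i * (x i - c i))
        - (θ x * n x j * P) - (s * θ x * n x j) * (Q i * (x i - c i))
        + (g x j * P) * (n x i * (x i - c i)) - (n x j * P) * (g x i * (x i - c i)) := by
    intro i
    split_ifs <;> ring
  simp only [e1, Finset.sum_sub_distrib, Finset.sum_add_distrib, ← Finset.mul_sum,
    Finset.sum_ite_eq', Finset.mem_univ, if_true, Finset.sum_const, Finset.card_univ,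
    Fintype.card_fin, nsmul_eq_mul]
  ring

/-- In polar coordinates the two sides of the weak identity are the integrals of `T₁` and `-T₂`. The
slice identity, weighted with `s ^ (d - 2)`, says that `T₁ + T₂ - T₃` integrates to zero, and `T₃`
drops out by integration along rays. -/
theorem isWeakGrad_radialExtension (hd : 2 ≤ d) (H : RadialSurface Ω c r R n) (hθm : Measurable θ)
    (hgm : Measurable g) (hθ2 : MemLp θ 2 (surf Ω)) (hg2 : MemLp g 2 (surf Ω))
    (hw : ∀ ψ : E d → ℝ, ContDiff ℝ ∞ ψ → HasCompactSupport ψ → ∀ i j : Fin d,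
      ∫ x, θ x * (n x i * (∇ ψ x) j - n x j * (∇ ψ x) i) ∂(surf Ω)
        = -∫ x, (n x i * g x j - n x j * g x i) * ψ x ∂(surf Ω))
    {p : E d} (hp : p ∈ frontier Ω) {δ : ℝ} (hδ : δ ≤ r / 2) :
    IsWeakGrad (Metric.ball p δ) (fun x => θ (radialProj Ω c x)) (radialGrad Ω c n g) := by
  have hfin := H.finite
  have hr := H.pos
  have hnm := H.measurable_normal
  have hπ := measurable_radialProj H.convex hr H.ball_subset
  have hΘm : Measurable fun x => θ (radialProj Ω c x) := hθm.comp hπ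
  have hGm := H.measurable_radialGrad hgm
  have hL2 : ∀ {F : Type} [NormedAddCommGroup F] {f : E d → F} {μ : Measure (E d)},
      AEStronglyMeasurable f μ → (MemLp f 2 μ ↔ ∫⁻ x, ‖f x‖ₑ ^ 2 ∂μ < ⊤) := by
    intro F _ f μ hf
    rw [MemLp, and_iff_right hf, eLpNorm_lt_top_iff_lintegral_rpow_enorm_lt_top (by norm_num)
      (by norm_num)]
    simp
  have hθi : Integrable θ (surf Ω) := hθ2.integrable (by norm_num)
  have hgi : Integrable g (surf Ω) := hg2.integrable (by norm_num)
  refine ⟨?_, ?_, ?_⟩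
  · rw [hL2 hΘm.aestronglyMeasurable]
    refine (H.lintegral_ball_le hp hδ (f := fun x => ‖θ x‖ₑ ^ 2) (K := 1) (by fun_prop)
      ENNReal.one_ne_top ?_).trans_lt ?_
    · filter_upwards [ae_mem_frontier (Ω := Ω)] with x hx s hs
      rw [radialProj_ray H.convex hr H.ball_subset hx (lt_trans (by norm_num) hs.1), one_mul]
    · refine ENNReal.mul_lt_top (by finiteness) ?_
      exact (setLIntegral_le_lintegral _ _).trans_lt ((hL2 hθ2.1).1 hθ2)
  · rw [hL2 hGm.aestronglyMeasurable]
    refine (H.lintegral_ball_le hp hδ (f := fun x => ‖g x‖ₑ ^ 2) (by fun_prop)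
      ENNReal.ofReal_ne_top (H.enorm_radialGrad_le g)).trans_lt ?_
    refine ENNReal.mul_lt_top (by finiteness) ?_
    exact (setLIntegral_le_lintegral _ _).trans_lt ((hL2 hg2.1).1 hg2)
  intro ψ hψ hψc hψs j
  have h0 : ∀ x ∉ Metric.ball p δ, ψ x = 0 := fun x hx =>
    image_eq_zero_of_notMem_tsupport fun h => hx (hψs h)
  have h1 : ∀ x ∉ Metric.ball p δ, ∇ ψ x = 0 := fun x hx =>
    image_eq_zero_of_notMem_tsupport fun h => hx (hψs (tsupport_gradient_subset h))
  have hψcont := hψ.continuous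
  have hgrad := continuous_gradient hψ
  have hcg : ∀ k : Fin d, Measurable fun x => (∇ ψ x) k := fun k =>
    ((EuclideanSpace.proj (𝕜 := ℝ) k).continuous.comp hgrad).measurable
  have hGk : Measurable fun x => radialGrad Ω c n g x j :=
    (EuclideanSpace.proj (𝕜 := ℝ) j).continuous.measurable.comp hGm
  rw [integral_bulk_eq_integral fun x hx => by simp [h1 x hx],
    integral_bulk_eq_integral fun x hx => by simp [h0 x hx],
    H.integral_eq (f := fun x => θ (radialProj Ω c x) * (∇ ψ x) j) hp hδ (hΘm.mul (hcg j)) fun x hx => by simp [h1 x hx],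
    H.integral_eq (f := fun x => radialGrad Ω c n g x j * ψ x) hp hδ (hGk.mul hψcont.measurable) fun x hx => by simp [h0 x hx]]
  set P := (surf Ω).prod (volume.restrict (Ioc (1 / 2 : ℝ) (3 / 2))) with hP
  have hae : ∀ᵐ z ∂P, (r ≤ inner ℝ (n z.1) (z.1 - c) ∧ inner ℝ (n z.1) (z.1 - c) ≤ R ∧
      ‖n z.1‖ = 1 ∧ z.1 ∈ frontier Ω ∧ ‖z.1 - c‖ ≤ R) ∧ z.2 ∈ Ioc (1 / 2 : ℝ) (3 / 2) := by
    filter_upwards [Measure.quasiMeasurePreserving_fst.ae H.inner_le,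
      Measure.quasiMeasurePreserving_snd.ae
        (ae_restrict_mem (μ := (volume : Measure ℝ)) (measurableSet_Ioc (a := (1 / 2 : ℝ))
          (b := 3 / 2)))] with z hz1 hz2
    exact ⟨hz1, hz2⟩
  obtain ⟨M, hM⟩ := hψc.exists_bound_of_continuous hψcont
  obtain ⟨M', hM'⟩ := (hasCompactSupport_gradient hψc).exists_bound_of_continuous hgrad
  have hrayc := continuous_ray c
  -- the three terms of the slice identity
  set T₁ : E d × ℝ → ℝ := fun z =>
    θ z.1 * (inner ℝ (n z.1) (z.1 - c) * z.2 ^ (d - 1) * (∇ ψ (ray c z)) j) with hT₁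
  set T₂ : E d × ℝ → ℝ := fun z =>
    z.2 ^ (d - 2) * (inner ℝ (n z.1) (z.1 - c) * g z.1 j - inner ℝ (g z.1) (z.1 - c) * n z.1 j)
      * ψ (ray c z) with hT₂
  set T₃ : E d × ℝ → ℝ := fun z =>
    θ z.1 * (n z.1 j * (z.2 ^ (d - 2) *
      ((d - 1) * ψ (ray c z) + z.2 * inner ℝ (∇ ψ (ray c z)) (z.1 - c)))) with hT₃
  have hcoordm : ∀ k : Fin d, Measurable fun x : E d => x k := fun k =>
    (EuclideanSpace.proj (𝕜 := ℝ) k).continuous.measurable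
  have hnj : Measurable fun z : E d × ℝ => n z.1 j := (hcoordm j).comp (hnm.comp measurable_fst)
  have hgj : Measurable fun z : E d × ℝ => g z.1 j := (hcoordm j).comp (hgm.comp measurable_fst)
  have hcgr : Measurable fun z : E d × ℝ => (∇ ψ (ray c z)) j := (hcg j).comp hrayc.measurable
  have hψr : Measurable fun z : E d × ℝ => ψ (ray c z) := hψcont.measurable.comp hrayc.measurable
  have hgradr : Measurable fun z : E d × ℝ => ∇ ψ (ray c z) :=
    hgrad.measurable.comp hrayc.measurable
  have hpow : ∀ (k : ℕ) (s : ℝ), s ∈ Ioc (1 / 2 : ℝ) (3 / 2) → ‖s ^ k‖ ≤ (3 / 2) ^ k := by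
    intro k s hs
    have : (0 : ℝ) ≤ s := le_trans (by norm_num) hs.1.le
    rw [Real.norm_of_nonneg (pow_nonneg this k)]
    exact pow_le_pow_left₀ this hs.2 k
  have hI₁ : Integrable T₁ P := by
    refine (hθi.comp_fst _).mul_bdd (c := R * (3 / 2) ^ (d - 1) * M')
      (Measurable.aestronglyMeasurable (by fun_prop)) ?_
    filter_upwards [hae] with z ⟨⟨h2, h3, h4, h5, h6⟩, h7⟩
    have hR : 0 ≤ R := (norm_nonneg _).trans h6
    rw [norm_mul, norm_mul, Real.norm_of_nonneg (hr.le.trans h2)]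
    exact mul_le_mul (mul_le_mul h3 (hpow _ _ h7) (norm_nonneg _) hR)
      ((PiLp.norm_apply_le _ _).trans (hM' _)) (norm_nonneg _) (by positivity)
  have hI₂ : Integrable T₂ P := by
    refine Integrable.mono' (g := fun z => (3 / 2) ^ (d - 2) * (2 * R) * M * ‖g z.1‖)
      ((hgi.norm.comp_fst _).const_mul _) (Measurable.aestronglyMeasurable (by fun_prop)) ?_
    filter_upwards [hae] with z ⟨⟨h2, h3, h4, h5, h6⟩, h7⟩
    have hR : 0 ≤ R := (norm_nonneg _).trans h6
    have hb1 : ‖inner ℝ (n z.1) (z.1 - c) * g z.1 j - inner ℝ (g z.1) (z.1 - c) * n z.1 j‖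
        ≤ 2 * R * ‖g z.1‖ := by
      refine (norm_sub_le _ _).trans ?_
      rw [norm_mul, norm_mul, Real.norm_of_nonneg (hr.le.trans h2)]
      have hb2 : ‖(inner ℝ (g z.1) (z.1 - c) : ℝ)‖ ≤ ‖g z.1‖ * R :=
        (norm_inner_le_norm _ _).trans (mul_le_mul_of_nonneg_left h6 (norm_nonneg _))
      have hb3 : ‖n z.1 j‖ ≤ 1 := by rw [← h4]; exact PiLp.norm_apply_le _ _
      have hb4 : ‖g z.1 j‖ ≤ ‖g z.1‖ := PiLp.norm_apply_le _ _
      have hb5 := mul_le_mul h3 hb4 (norm_nonneg _) hR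
      have hb6 := mul_le_mul hb2 hb3 (norm_nonneg _) (by positivity)
      linarith
    rw [hT₂]
    simp only
    rw [norm_mul, norm_mul]
    calc ‖z.2 ^ (d - 2)‖ * _ * ‖ψ (ray c z)‖
        ≤ (3 / 2) ^ (d - 2) * (2 * R * ‖g z.1‖) * M :=
          mul_le_mul (mul_le_mul (hpow _ _ h7) hb1 (norm_nonneg _) (by positivity)) (hM _)
            (norm_nonneg _) (by positivity)
      _ = _ := by ring
  have hI₃ : Integrable T₃ P := by
    refine (hθi.comp_fst _).mul_bdd
      (c := 1 * ((3 / 2) ^ (d - 2) * (‖(d - 1 : ℝ)‖ * M + (3 / 2) * (M' * R))))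
      (Measurable.aestronglyMeasurable (by fun_prop)) ?_
    filter_upwards [hae] with z ⟨⟨h2, h3, h4, h5, h6⟩, h7⟩
    have hR : 0 ≤ R := (norm_nonneg _).trans h6
    have hM0 : 0 ≤ M := (norm_nonneg _).trans (hM 0)
    have hM0' : 0 ≤ M' := (norm_nonneg _).trans (hM' 0)
    have hb3 : ‖n z.1 j‖ ≤ 1 := by rw [← h4]; exact PiLp.norm_apply_le _ _
    have hz : ‖z.2‖ ≤ 3 / 2 := by simpa using hpow 1 _ h7
    rw [norm_mul, norm_mul]
    refine mul_le_mul hb3 (mul_le_mul (hpow _ _ h7) ?_ (norm_nonneg _) (by positivity))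
      (by positivity) zero_le_one
    refine (norm_add_le _ _).trans (add_le_add ?_ ?_)
    · rw [norm_mul]
      exact mul_le_mul_of_nonneg_left (hM _) (norm_nonneg _)
    · rw [norm_mul]
      exact mul_le_mul hz ((norm_inner_le_norm _ _).trans
        (mul_le_mul (hM' _) h6 (norm_nonneg _) hM0')) (norm_nonneg _) (by norm_num)
  have hpow2 : ∀ s : ℝ, s ^ (d - 1) = s * s ^ (d - 2) := fun s => by
    rw [← pow_succ']; congr 1; omega
  have e1 : ∫ z, inner ℝ (n z.1) (z.1 - c) * z.2 ^ (d - 1)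
      * (θ (radialProj Ω c (ray c z)) * (∇ ψ (ray c z)) j) ∂P = ∫ z, T₁ z ∂P := by
    refine integral_congr_ae ?_
    filter_upwards [hae] with z ⟨⟨h2, h3, h4, h5, h6⟩, h7⟩
    have hz : 0 < z.2 := lt_trans (by norm_num) h7.1
    rw [radialProj_ray H.convex hr H.ball_subset h5 hz, hT₁]
    ring
  have e2 : ∫ z, inner ℝ (n z.1) (z.1 - c) * z.2 ^ (d - 1)
      * (radialGrad Ω c n g (ray c z) j * ψ (ray c z)) ∂P = ∫ z, T₂ z ∂P := by
    refine integral_congr_ae ?_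
    filter_upwards [hae] with z ⟨⟨h2, h3, h4, h5, h6⟩, h7⟩
    have hz : 0 < z.2 := lt_trans (by norm_num) h7.1
    have hw0 : inner ℝ (n z.1) (z.1 - c) ≠ 0 := (hr.trans_le h2).ne'
    rw [H.radialGrad_ray h5 hz, hT₂, hpow2]
    simp only [PiLp.smul_apply, PiLp.sub_apply, smul_eq_mul]
    field_simp
  -- Along each ray, `T₃` is a constant times the derivative of `s ^ (d - 1) * ψ (ray c (x, s))`,
  -- which vanishes at both ends because ψ is supported in the ball.
  have e3 : ∫ z, T₃ z ∂P = 0 := by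
    rw [hP, integral_prod _ hI₃]
    refine integral_eq_zero_of_ae ?_
    filter_upwards [ae_mem_frontier (Ω := Ω)] with x hx
    rw [hT₃]
    simp only [integral_const_mul, Pi.zero_apply]
    refine mul_eq_zero_of_right _ (mul_eq_zero_of_right _ ?_)
    rw [← intervalIntegral.integral_of_le (by norm_num)]
    have hder : ∀ s ∈ uIcc (1 / 2 : ℝ) (3 / 2), HasDerivAt (fun s : ℝ => s ^ (d - 1) * ψ (ray c (x, s)))
        (s ^ (d - 2) * ((d - 1) * ψ (ray c (x, s)) + s * inner ℝ (∇ ψ (ray c (x, s))) (x - c))) s := by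
      intro s _
      have h2 : HasDerivAt (fun s : ℝ => ray c (x, s)) (x - c) s := by
        simpa [ray] using ((hasDerivAt_id s).smul_const (x - c)).const_add c
      have h3 := (hψ.differentiable (by simp) (ray c (x, s))).hasFDerivAt.comp_hasDerivAt s h2
      have h4 := (hasDerivAt_pow (d - 1) s).mul h3
      refine h4.congr_deriv ?_
      rw [inner_gradient_eq, hpow2, Nat.sub_sub, Nat.cast_sub (by omega)]
      simp only [Function.comp]
      push_cast
      ring
    rw [intervalIntegral.integral_eq_sub_of_hasDerivAt hder]
    · have hz : ∀ s : ℝ, 0 ≤ s → s ∉ Ioo (1 / 2 : ℝ) (3 / 2) → ψ (ray c (x, s)) = 0 := fun s hs hsI =>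
        h0 _ fun hmem => hsI (H.mem_Ioo_of_ray_mem_ball hp hx hs hδ hmem)
      rw [hz (3 / 2) (by norm_num) (by simp), hz (1 / 2) (by norm_num) (by simp)]
      simp
    · refine Continuous.intervalIntegrable ?_ _ _
      have h5 : Continuous fun s : ℝ => ray c (x, s) := hrayc.comp (by fun_prop)
      have h6 : Continuous fun s : ℝ => ψ (ray c (x, s)) := hψcont.comp h5
      have h7 : Continuous fun s : ℝ => ∇ ψ (ray c (x, s)) := hgrad.comp h5
      fun_prop
  have e4 : ∫ z, (T₁ z + T₂ z - T₃ z) ∂P = 0 := by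
    rw [hP, integral_prod_symm (fun z => T₁ z + T₂ z - T₃ z) ((hI₁.add hI₂).sub hI₃)]
    refine integral_eq_zero_of_ae ?_
    filter_upwards [ae_restrict_mem measurableSet_Ioc] with s hs
    have hs0 : 0 < s := lt_trans (by norm_num) hs.1
    have h2 := H.integral_slice_eq_zero hθi hgi hw hψ hψc hs0 j
    have h3 := congrArg (fun y => s ^ (d - 2) * y) h2
    simp only [mul_zero, ← integral_const_mul] at h3
    rw [Pi.zero_apply, ← h3]
    refine integral_congr_ae (Eventually.of_forall fun x => ?_)
    simp only [hT₁, hT₂, hT₃, hpow2]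
    ring
  rw [integral_sub (f := fun z => T₁ z + T₂ z) (hI₁.add hI₂) hI₃, integral_add hI₁ hI₂, e3] at e4
  rw [e1, e2]
  linarith

end RadialSurface

/-! ### Ball growth and Poincaré inequality for measures -/

/-- The volume of the unit ball of `ℝᵏ`. -/
noncomputable def unitVol (k : ℕ) : ℝ := (volume : Measure (E k)).real (Metric.closedBall 0 1)

theorem unitVol_pos (k : ℕ) : 0 < unitVol k :=
  ENNReal.toReal_pos (Metric.measure_closedBall_pos _ _ one_pos).ne' measure_closedBall_lt_top.ne

theorem volume_closedBall_eq {k : ℕ} (x : E k) {t : ℝ} (ht : 0 ≤ t) :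
    volume (Metric.closedBall x t) = ENNReal.ofReal (t ^ k * unitVol k) := by
  rw [Measure.addHaar_closedBall' _ x ht, ENNReal.ofReal_mul (by positivity), unitVol,
    ofReal_measureReal measure_closedBall_lt_top.ne, finrank_euclideanSpace_fin]

theorem volume_ball_le {k : ℕ} (x : E k) {t : ℝ} (ht : 0 ≤ t) :
    volume (Metric.ball x t) ≤ ENNReal.ofReal (t ^ k * unitVol k) := by
  rw [← volume_closedBall_eq x ht]
  exact measure_mono Metric.ball_subset_closedBall

theorem le_of_ofReal_mul_le {a b : ℝ} (ha : 0 < a) {x y : ℝ≥0∞}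
    (h : ENNReal.ofReal a * x ≤ ENNReal.ofReal (a * b) * y) : x ≤ ENNReal.ofReal b * y := by
  rw [ENNReal.ofReal_mul ha.le, mul_assoc] at h
  exact (ENNReal.mul_le_mul_iff_right (ENNReal.ofReal_pos.2 ha).ne' ENNReal.ofReal_ne_top).1 h

/-- A measure `σ` with `k`-dimensional growth on balls, and a notion of weak gradient for which
Poincaré's inequality holds on small balls about the points of `S`. -/
structure PoincareMeasure (k : ℕ) (S : Set (E d)) (σ : Measure (E d))
    (IsGrad : (E d → ℝ) → (E d → E d) → Prop) (A K t₀ : ℝ) : Prop where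
  growth : ∀ p t, 0 ≤ t → σ (Metric.ball p t) ≤ ENNReal.ofReal (A * t ^ k)
  memLp : ∀ θ g, IsGrad θ g → MemLp θ 2 σ
  memLp_grad : ∀ θ g, IsGrad θ g → MemLp g 2 σ
  poincare : ∀ θ g, IsGrad θ g → ∀ p ∈ S, ∀ t, 0 < t → t ≤ t₀ →
    ∫⁻ x in Metric.ball p t, (∫⁻ y in Metric.ball p t, ‖θ x - θ y‖ₑ ^ 2 ∂σ) ∂σ
      ≤ ENNReal.ofReal (A * t ^ (k + 2)) * ∫⁻ x in Metric.ball p (K * t), ‖g x‖ₑ ^ 2 ∂σ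

theorem lintegral_lintegral_congr_ae {α : Type*} [MeasurableSpace α] {μ : Measure α}
    {θ θ' : α → ℝ} (h : θ =ᵐ[μ] θ') :
    ∫⁻ x, (∫⁻ y, ‖θ x - θ y‖ₑ ^ 2 ∂μ) ∂μ = ∫⁻ x, (∫⁻ y, ‖θ' x - θ' y‖ₑ ^ 2 ∂μ) ∂μ := by
  refine lintegral_congr_ae ?_
  filter_upwards [h] with x hx
  refine lintegral_congr_ae ?_
  filter_upwards [h] with y hy
  rw [hx, hy]

/-- The intersection of a ball with Ω is convex with diameter at most `2 * t`, whence the power of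
two. No enlargement of the ball and no bound on its radius is needed. -/
theorem bulk_poincareMeasure {Ω : Set (E d)} (ho : IsOpen Ω) (hc : Convex ℝ Ω) (t₀ : ℝ) :
    PoincareMeasure d (closure Ω) (bulk Ω) (IsWeakGrad Ω) (2 ^ (d + 2) * unitVol d) 1 t₀ where
  growth p t ht := by
    refine (Measure.restrict_apply_le _ _).trans ((volume_ball_le p ht).trans
      (ENNReal.ofReal_le_ofReal ?_))
    have h1 := unitVol_pos d
    have h2 : (1 : ℝ) ≤ 2 ^ (d + 2) := one_le_pow₀ (by norm_num)
    have h3 : 0 ≤ t ^ d * unitVol d := by positivity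
    nlinarith
  memLp θ g h := h.memLp
  memLp_grad θ g h := h.memLp_grad
  poincare θ g hθ p _ t ht _ := by
    have hres : (bulk Ω).restrict (Metric.ball p t) = volume.restrict (Metric.ball p t ∩ Ω) := by
      rw [bulk, Measure.restrict_restrict Metric.isOpen_ball.measurableSet]
    rw [one_mul, hres]
    have h1 := (hθ.mono (V := Metric.ball p t ∩ Ω) inter_subset_right).lintegral_sub_sq_le
      (Metric.isOpen_ball.inter ho) ((convex_ball p t).inter hc)
      (Metric.isBounded_ball.subset inter_subset_left) (δ := 2 * t) fun x hx y hy => by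
        have h2 := dist_triangle_right x y p
        have h3 : dist x p < t := hx.1
        have h4 : dist y p < t := hy.1
        linarith
    refine h1.trans (le_of_eq ?_)
    rw [volume_closedBall_eq _ (by positivity), ← ENNReal.ofReal_pow (by positivity),
      ← ENNReal.ofReal_mul (by positivity)]
    congr 2
    ring

/-! ### Ball growth and Poincaré's inequality on the boundary -/

namespace RadialSurface

variable {Ω : Set (E d)} {c : E d} {r R : ℝ} {n : E d → E d} {θ : E d → ℝ} {g : E d → E d}

/-- The shell of relative thickness `t` over the surface ball has volume at least `r * t` times its
area and fits into a ball of radius `(1 + R) * t`. -/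
theorem measure_ball_le (H : RadialSurface Ω c r R n) (hd : 1 ≤ d) (hR : 0 ≤ R) (p : E d) {t : ℝ}
    (ht : 0 ≤ t) :
    surf Ω (Metric.ball p t) ≤ ENNReal.ofReal ((1 + R) ^ d * unitVol d / r * t ^ (d - 1)) := by
  have hr := H.pos
  rcases ht.eq_or_lt with rfl | ht
  · simp
  have h1 := H.le_lintegral_ball (p := p) (t := t) (F := fun _ => 1) (f := fun _ => 1)
    measurable_const fun _ _ _ _ => rfl
  rw [setLIntegral_one, setLIntegral_one] at h1
  have h2 := h1.trans (volume_ball_le p (by positivity))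
  have h3 := le_of_ofReal_mul_le (x := surf Ω (Metric.ball p t)) (y := 1)
    (b := (1 + R) ^ d * unitVol d / r * t ^ (d - 1)) (mul_pos hr ht) ?_
  · simpa using h3
  · rw [mul_one]
    refine h2.trans (le_of_eq ?_)
    congr 1
    have : t ^ d = t ^ (d - 1) * t := by rw [← pow_succ]; congr 1; omega
    rw [mul_pow, this]
    field_simp

/-- Poincaré's inequality for the radial extension on the full ball of radius `(1 + R) * t` is
compared with Γ on both sides. The double integral loses `(r * t) ^ 2` and the gradient integral
gains one factor `t`, which turns `t ^ (d + 2)` into `t ^ (d + 1)`. -/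
theorem poincare (hd : 2 ≤ d) (H : RadialSurface Ω c r R n) (hR : 0 < R) (hθm : Measurable θ)
    (hgm : Measurable g) (hθ2 : MemLp θ 2 (surf Ω)) (hg2 : MemLp g 2 (surf Ω))
    (hw : ∀ ψ : E d → ℝ, ContDiff ℝ ∞ ψ → HasCompactSupport ψ → ∀ i j : Fin d,
      ∫ x, θ x * (n x i * (∇ ψ x) j - n x j * (∇ ψ x) i) ∂(surf Ω)
        = -∫ x, (n x i * g x j - n x j * g x i) * ψ x ∂(surf Ω))
    {p : E d} (hp : p ∈ frontier Ω) {t : ℝ} (ht : 0 < t) (htr : (1 + R) * t ≤ r / 2) :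
    ∫⁻ x in Metric.ball p t, (∫⁻ y in Metric.ball p t, ‖θ x - θ y‖ₑ ^ 2 ∂(surf Ω)) ∂(surf Ω)
      ≤ ENNReal.ofReal ((2 * (1 + R)) ^ (d + 3) * unitVol d * (R * (3 / 2) ^ (d - 1))
            * (2 * (1 + R / r)) ^ 2 / r ^ 3 * t ^ (d + 1))
        * ∫⁻ x in Metric.ball p ((R / r + 1) * (1 + R) * t), ‖g x‖ₑ ^ 2 ∂(surf Ω) := by
  have hr := H.pos
  have hfin := H.finite
  have hπ := measurable_radialProj H.convex hr H.ball_subset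
  set δ := (1 + R) * t with hδ
  have hδ0 : 0 < δ := by positivity
  have hv := unitVol_pos d
  set Θ : E d → ℝ := fun x => θ (radialProj Ω c x) with hΘ
  have hΘm : Measurable Θ := hθm.comp hπ
  have hΘray : ∀ x ∈ frontier Ω, ∀ s, 0 < s → Θ (ray c (x, s)) = θ x := fun x hx s hs => by
    rw [hΘ]; simp only; rw [radialProj_ray H.convex hr H.ball_subset hx hs]
  have hW := H.isWeakGrad_radialExtension hd hθm hgm hθ2 hg2 hw hp htr
  have h1 := hW.lintegral_sub_sq_le Metric.isOpen_ball (convex_ball p δ) Metric.isBounded_ball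
    (δ := 2 * δ) fun x hx y hy => by
      have h2 := dist_triangle_right x y p
      have h3 : dist x p < δ := hx
      have h4 : dist y p < δ := hy
      linarith
  have h2 := H.lintegral_ball_le hp htr (f := fun x => ‖g x‖ₑ ^ 2)
    (F := fun x => ‖radialGrad Ω c n g x‖ₑ ^ 2)
    ((H.measurable_radialGrad hgm).enorm.pow_const 2) ENNReal.ofReal_ne_top (H.enorm_radialGrad_le g)
  -- The shell estimate is applied to each of the two variables in turn.
  have h3 : ENNReal.ofReal (r * t) * (ENNReal.ofReal (r * t) *
      ∫⁻ x in Metric.ball p t, (∫⁻ y in Metric.ball p t, ‖θ x - θ y‖ₑ ^ 2 ∂(surf Ω)) ∂(surf Ω))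
      ≤ ∫⁻ x in Metric.ball p δ, ∫⁻ y in Metric.ball p δ, ‖Θ x - Θ y‖ₑ ^ 2 := by
    have h4 := H.le_lintegral_ball (p := p) (t := t)
      (F := fun x => ∫⁻ y in Metric.ball p t, ‖Θ x - θ y‖ₑ ^ 2 ∂(surf Ω))
      (f := fun x => ∫⁻ y in Metric.ball p t, ‖θ x - θ y‖ₑ ^ 2 ∂(surf Ω))
      (Measurable.lintegral_prod_right' (f := fun z : E d × E d => ‖Θ z.1 - θ z.2‖ₑ ^ 2)
        (by fun_prop)) fun x hx s hs => by simp only [hΘray x hx s hs]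
    refine (mul_le_mul_right h4 _).trans ?_
    rw [← lintegral_const_mul' _ _ ENNReal.ofReal_ne_top]
    refine lintegral_mono fun x => ?_
    exact H.le_lintegral_ball (F := fun y => ‖Θ x - Θ y‖ₑ ^ 2) (f := fun y => ‖Θ x - θ y‖ₑ ^ 2)
      (by fun_prop) fun y hy s hs => by rw [hΘray y hy s hs]
  rw [← mul_assoc, ← ENNReal.ofReal_mul (by positivity)] at h3
  refine le_of_ofReal_mul_le (a := r * t * (r * t)) (by positivity) (h3.trans (h1.trans ?_))
  refine (mul_le_mul_right h2 _).trans (le_of_eq ?_)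
  rw [volume_closedBall_eq _ (by positivity), ← ENNReal.ofReal_pow (by positivity)]
  simp only [← mul_assoc]
  rw [← ENNReal.ofReal_mul (by positivity), ← ENNReal.ofReal_mul (by positivity),
    ← ENNReal.ofReal_mul (by positivity), ← ENNReal.ofReal_mul (by positivity)]
  have e1 : R * (δ / r) + δ = (R / r + 1) * (1 + R) * t := by rw [hδ]; ring
  rw [e1]
  congr 2
  rw [hδ, ← mul_assoc 2, mul_pow _ t d, pow_add _ d 3, pow_succ t d]
  generalize (3 / 2 : ℝ) ^ (d - 1) = a
  generalize (2 * (1 + R)) ^ d = b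
  field_simp

theorem poincareMeasure (hd : 2 ≤ d) (H : RadialSurface Ω c r R n) (hR : 0 < R) :
    PoincareMeasure (d - 1) (frontier Ω) (surf Ω) (IsWeakSurfGrad Ω)
      (max ((1 + R) ^ d * unitVol d / r)
        ((2 * (1 + R)) ^ (d + 3) * unitVol d * (R * (3 / 2) ^ (d - 1))
          * (2 * (1 + R / r)) ^ 2 / r ^ 3))
      ((R / r + 1) * (1 + R)) (r / 2 / (1 + R)) where
  growth p t ht := (H.measure_ball_le (by omega) hR.le p ht).trans (ENNReal.ofReal_le_ofReal
    (mul_le_mul_of_nonneg_right (le_max_left _ _) (by positivity)))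
  memLp θ g h := h.memLp
  memLp_grad θ g h := h.memLp_grad
  poincare θ g hθ p hp t ht htr := by
    -- The radial extension needs representatives that are measurable everywhere; the outer normal
    -- is likewise replaced by its measurable version.
    have hθs := hθ.memLp.aestronglyMeasurable
    have hgs := hθ.memLp_grad.aestronglyMeasurable
    have hθe := hθs.ae_eq_mk
    have hge := hgs.ae_eq_mk
    have hne := H.normal_eq
    have h1 := H.poincare hd hR hθs.stronglyMeasurable_mk.measurable
      hgs.stronglyMeasurable_mk.measurable (hθ.memLp.ae_eq hθe) (hθ.memLp_grad.ae_eq hge) (by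
        intro ψ hψ hψc i j
        have h2 := hθ.weak ψ hψ hψc i j
        refine Eq.trans (integral_congr_ae ?_) (h2.trans (congrArg _ (integral_congr_ae ?_)))
        · filter_upwards [hθe, hne] with x h3 h4
          rw [h3, h4]
        · filter_upwards [hge, hne] with x h3 h4
          rw [h3, h4]) hp ht (by rwa [le_div_iff₀' (by positivity)] at htr)
    rw [lintegral_lintegral_congr_ae (ae_restrict_of_ae hθe)]
    refine h1.trans ?_
    have e1 : d - 1 + 2 = d + 1 := by omega
    rw [e1]
    refine mul_le_mul' (ENNReal.ofReal_le_ofReal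
      (mul_le_mul_of_nonneg_right (le_max_right _ _) (by positivity))) (le_of_eq ?_)
    refine lintegral_congr_ae ?_
    filter_upwards [ae_restrict_of_ae hge] with x hx
    rw [hx]

end RadialSurface

/-! ### Shape regularity -/

/-- Along its gradient the affine function varies by `2 * r * ‖locGrad s v‖` across the inscribed
ball, and its extreme values on the simplex are taken at vertices. -/
theorem exists_norm_locGrad_le {s : Finset (E d)} (hs : AffineIndependent ℝ ((↑) : s → E d))
    (hne : s.Nonempty) {x : E d} {r : ℝ} (hr : 0 < r) (hx : x ∈ affineSpan ℝ (s : Set (E d)))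
    (hball : Metric.closedBall x r ∩ (affineSpan ℝ (s : Set (E d)) : Set (E d)) ⊆ hull s)
    (v : E d → ℝ) : ∃ p ∈ s, ∃ q ∈ s, 2 * r * ‖locGrad s v‖ ≤ v p - v q := by
  obtain ⟨hb, hbv⟩ := locGrad_spec hs v
  set b := locGrad s v
  obtain ⟨p, hp, hpm⟩ := s.exists_max_image (fun y => inner ℝ b y) hne
  obtain ⟨q, hq, hqm⟩ := s.exists_min_image (fun y => inner ℝ b y) hne
  refine ⟨p, hp, q, hq, ?_⟩
  rw [← hbv p hp q hq, inner_sub_right]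
  by_cases hb0 : b = 0
  · simp [hb0]
  have hbn : 0 < ‖b‖ := norm_pos_iff.2 hb0
  have hz : ∀ e : ℝ, |e| ≤ r / ‖b‖ → e • b + x ∈ hull s := by
    intro e he
    refine hball ⟨?_, ?_⟩
    · rw [Metric.mem_closedBall, dist_eq_norm, add_sub_cancel_right, norm_smul, Real.norm_eq_abs]
      rwa [le_div_iff₀ hbn] at he
    · refine AffineSubspace.vadd_mem_of_mem_direction ?_ hx
      rw [direction_affineSpan]
      exact Submodule.smul_mem _ _ hb
  have hpos : 0 ≤ r / ‖b‖ := by positivity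
  have h1 := inner_add_le_of_mem_hull (c := 0) (M := inner ℝ b p)
    (fun y hy => by simpa using hpm y hy) (hz (r / ‖b‖) (abs_of_nonneg hpos).le)
  have h2 := le_inner_add_of_mem_hull (c := 0) (M := inner ℝ b q)
    (fun y hy => by simpa using hqm y hy) (hz (-(r / ‖b‖)) (by rw [abs_neg, abs_of_nonneg hpos]))
  rw [inner_add_right, real_inner_smul_right, real_inner_self_eq_norm_sq] at h1 h2
  have h3 : r / ‖b‖ * ‖b‖ ^ 2 = r * ‖b‖ := by field_simp
  rw [neg_mul, h3] at h2
  rw [h3] at h1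
  linarith

section Shape

variable {k : ℕ} {T : Finset (Finset (E d))} {S : Set (E d)} {ρ h : ℝ}

/-- From `y` one can move a distance `ρ * h / 2` in the direction from `p` to another vertex without
leaving the inscribed ball. Along the way the basis function falls at rate at least `1 / h` and
stays nonnegative. -/
theorem IsTriangulation.le_nodalBasis (hT : IsTriangulation k T S ρ h) (hk : 1 ≤ k) (hρ : 0 < ρ)
    (hh : 0 < h) {s : Finset (E d)} (hs : s ∈ T) {p : E d} (hp : p ∈ s) {x : E d}
    (hball : Metric.closedBall x (ρ * h) ∩ (affineSpan ℝ (s : Set (E d)) : Set (E d)) ⊆ hull s)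
    {y : E d} (hy : y ∈ Metric.closedBall x (ρ * h / 2))
    (hys : y ∈ affineSpan ℝ (s : Set (E d))) : ρ / 2 ≤ nodalBasis T p y := by
  obtain ⟨q, hq, hqp⟩ := s.exists_mem_ne (by rw [hT.card_eq s hs]; omega) p
  have hpv : p ∈ verts T := mem_verts.2 ⟨s, hs, hp⟩
  have hqv : q ∈ verts T := mem_verts.2 ⟨s, hs, hq⟩
  obtain ⟨hχ, hχv⟩ := hT.isFE_nodalBasis p
  obtain ⟨a, c, hac⟩ := hχ.exists_affine hs
  have hpq : 0 < ‖p - q‖ := norm_pos_iff.2 (sub_ne_zero.2 hqp.symm)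
  have hpqh : ‖p - q‖ ≤ h := by
    rw [← dist_eq_norm]; exact hT.dist_le hs (mem_hull_of_mem hp) (mem_hull_of_mem hq)
  have hapq : inner ℝ a (p - q) = (1 : ℝ) := by
    have h1 := hac p (mem_hull_of_mem hp)
    have h2 := hac q (mem_hull_of_mem hq)
    rw [hχv p hpv, if_pos rfl] at h1
    rw [hχv q hqv, if_neg hqp] at h2
    rw [inner_sub_right]; linarith
  set e := ρ * h / 2 / ‖p - q‖ with he
  have he0 : 0 ≤ e := by positivity
  have hz : (-e) • (p - q) + y ∈ hull s := by
    refine hball ⟨?_, ?_⟩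
    · have h1 : dist ((-e) • (p - q) + y) y = ρ * h / 2 := by
        rw [dist_eq_norm, add_sub_cancel_right, norm_smul, norm_neg, Real.norm_of_nonneg he0, he]
        field_simp
      have h2 := dist_triangle ((-e) • (p - q) + y) y x
      have h3 : dist y x ≤ ρ * h / 2 := hy
      rw [Metric.mem_closedBall]
      linarith
    · refine AffineSubspace.vadd_mem_of_mem_direction ?_ hys
      rw [direction_affineSpan]
      exact Submodule.smul_mem _ _ (vsub_mem_vectorSpan ℝ hp hq)
  have hyh : y ∈ hull s := hball ⟨Metric.closedBall_subset_closedBall (by nlinarith) hy, hys⟩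
  have h1 := hT.nodalBasis_nonneg p (hT.hull_subset hs hz)
  rw [hac _ hz, inner_add_right, real_inner_smul_right, hapq] at h1
  rw [hac y hyh]
  have h2 : ρ / 2 ≤ e := by
    rw [he, le_div_iff₀ hpq]
    nlinarith
  linarith

end Shape

/-- The nodal values of the mass-lumped quasi-interpolant of `θ`. -/
noncomputable def clement (σ : Measure (E d)) (T : Finset (Finset (E d))) (θ : E d → ℝ) (p : E d) :
    ℝ :=
  (∫ x, θ x * nodalBasis T p x ∂σ) / nodalMass σ T p

/-! ### Local estimates for the quasi-interpolant -/

namespace FEMeasure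

variable {k : ℕ} {T : Finset (Finset (E d))} {S : Set (E d)} {ρ h : ℝ} {σ : Measure (E d)}
  {D : (E d → ℝ) → E d → E d}

theorem measure_eq_of_subset_hull {s : Finset (E d)}
    (hσ : σ.restrict (hull s) = (μHE[k] : Measure (E d)).restrict (hull s)) {A : Set (E d)}
    (hA : A ⊆ hull s) : σ A = (μHE[k] : Measure (E d)) A := by
  rw [← Measure.restrict_eq_self σ hA, hσ, Measure.restrict_eq_self _ hA]

theorem measure_closedBall_inter (H : FEMeasure k T S ρ h σ D)
    (hσ : ∀ s ∈ T, σ.restrict (hull s) = (μHE[k] : Measure (E d)).restrict (hull s))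
    {s : Finset (E d)} (hs : s ∈ T) {x : E d} (hx : x ∈ affineSpan ℝ (s : Set (E d))) {t : ℝ}
    (ht : 0 ≤ t)
    (hball : Metric.closedBall x t ∩ (affineSpan ℝ (s : Set (E d)) : Set (E d)) ⊆ hull s) :
    σ (Metric.closedBall x t ∩ (affineSpan ℝ (s : Set (E d)) : Set (E d)))
      = ENNReal.ofReal (t ^ k * unitVol k) := by
  rw [measure_eq_of_subset_hull (hσ s hs) hball,
    euclideanHausdorffMeasure_closedBall_inter (H.tri.card_eq s hs) (H.tri.affineIndependent s hs) hx,
    volume_closedBall_eq _ ht]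

theorem le_nodalMass (H : FEMeasure k T S ρ h σ D) (hk : 1 ≤ k) (hρ : 0 < ρ) (hh : 0 < h)
    (hσ : ∀ s ∈ T, σ.restrict (hull s) = (μHE[k] : Measure (E d)).restrict (hull s))
    {p : E d} (hp : p ∈ verts T) :
    ρ / 2 * ((ρ / 2) ^ k * unitVol k) * h ^ k ≤ nodalMass σ T p := by
  have hfin := H.finite
  obtain ⟨s, hs, hps⟩ := mem_verts.1 hp
  obtain ⟨x, hx, hball⟩ := H.tri.containsBall s hs
  set A := Metric.closedBall x (ρ * h / 2) ∩ (affineSpan ℝ (s : Set (E d)) : Set (E d)) with hA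
  have hAh : A ⊆ hull s := (inter_subset_inter_left _
    (Metric.closedBall_subset_closedBall (by nlinarith))).trans hball
  have hAm : MeasurableSet A := Metric.isClosed_closedBall.measurableSet.inter
    (AffineSubspace.closed_of_finiteDimensional _).measurableSet
  have hi := H.integrable (H.tri.isFE_nodalBasis p).1
  have h1 : ρ / 2 * σ.real A ≤ ∫ y in A, nodalBasis T p y ∂σ :=
    setIntegral_ge_of_const_le_real hAm (measure_ne_top _ _)
      (fun y hy => H.tri.le_nodalBasis hk hρ hh hs hps hball hy.1 hy.2) hi.integrableOn
  have h2 : ∫ y in A, nodalBasis T p y ∂σ ≤ nodalMass σ T p :=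
    setIntegral_le_integral hi (by
      filter_upwards [H.ae_mem] with y hy using H.tri.nodalBasis_nonneg p hy)
  have hv := unitVol_pos k
  have h3 : σ.real A = (ρ * h / 2) ^ k * unitVol k := by
    rw [measureReal_def, H.measure_closedBall_inter hσ hs hx (by positivity) hAh,
      ENNReal.toReal_ofReal (by positivity)]
  rw [h3] at h1
  refine le_trans (le_of_eq ?_) (h1.trans h2)
  rw [mul_div_right_comm, mul_pow]
  ring

theorem integrable_mul_nodalBasis (H : FEMeasure k T S ρ h σ D) {θ : E d → ℝ} (hθ : Integrable θ σ)
    (p : E d) : Integrable (fun x => θ x * nodalBasis T p x) σ := by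
  refine hθ.mul_bdd (c := 1) (H.integrable (H.tri.isFE_nodalBasis p).1).aestronglyMeasurable ?_
  filter_upwards [H.ae_mem] with x hx
  rw [Real.norm_of_nonneg (H.tri.nodalBasis_nonneg p hx)]
  exact H.tri.nodalBasis_le_one p hx

/-- Expanding `f` in the nodal basis gives this at once: the nodal values of the quasi-interpolant
are chosen such that no lumping error appears. -/
theorem integral_mul_eq_sum_clement (H : FEMeasure k T S ρ h σ D)
    (hm : ∀ p ∈ verts T, nodalMass σ T p ≠ 0) {f θ : E d → ℝ} (hf : IsFE T f)
    (hθ : Integrable θ σ) :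
    ∫ x, f x * θ x ∂σ = ∑ p ∈ verts T, f p * clement σ T θ p * nodalMass σ T p := by
  have h1 : ∫ x, f x * θ x ∂σ
      = ∫ x, ∑ p ∈ verts T, f p * (θ x * nodalBasis T p x) ∂σ := by
    refine integral_congr_ae ?_
    filter_upwards [H.ae_mem] with x hx
    rw [← H.tri.interp_eq hf hx, interp, Finset.sum_mul]
    exact Finset.sum_congr rfl fun p _ => by ring
  rw [h1, integral_finsetSum _ fun p _ => (H.integrable_mul_nodalBasis hθ p).const_mul _]
  refine Finset.sum_congr rfl fun p hp => ?_
  rw [integral_const_mul, clement, mul_assoc, div_mul_cancel₀ _ (hm p hp)]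

/-- Multiplied by both masses, the difference of the two weighted means is the double integral of `θ
x - θ y` against the product of the two basis functions. These are at most one and supported in `B`;
Cauchy-Schwarz in both variables does the rest. -/
theorem mul_enorm_clement_sub_sq_le (H : FEMeasure k T S ρ h σ D) {θ : E d → ℝ}
    (hθ : Integrable θ σ) {p q : E d} (hp : 0 < nodalMass σ T p) (hq : 0 < nodalMass σ T q)
    {B : Set (E d)} (hB : MeasurableSet B) (hpB : ∀ x ∈ S, x ∉ B → nodalBasis T p x = 0)
    (hqB : ∀ x ∈ S, x ∉ B → nodalBasis T q x = 0) :
    ENNReal.ofReal ((nodalMass σ T p * nodalMass σ T q) ^ 2)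
        * ENNReal.ofReal ((clement σ T θ p - clement σ T θ q) ^ 2)
      ≤ σ B ^ 2 * ∫⁻ x in B, (∫⁻ y in B, ‖θ x - θ y‖ₑ ^ 2 ∂σ) ∂σ := by
  have hfin := H.finite
  set χ := nodalBasis T p with hχ
  set χ' := nodalBasis T q with hχ'
  have hip := H.integrable_mul_nodalBasis hθ p
  have hiq := H.integrable_mul_nodalBasis hθ q
  have hcp := H.integrable (H.tri.isFE_nodalBasis p).1
  have hcq := H.integrable (H.tri.isFE_nodalBasis q).1
  have e1 : ∀ x, ∫ y, (θ x - θ y) * χ' y ∂σ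
      = nodalMass σ T q * (θ x - clement σ T θ q) := by
    intro x
    have h2 : ∫ y, θ y * χ' y ∂σ = nodalMass σ T q * clement σ T θ q := by
      rw [clement, mul_div_cancel₀ _ hq.ne']
    simp only [sub_mul]
    rw [integral_sub (hcq.const_mul _) hiq, integral_const_mul, h2]
    simp only [nodalMass]
    ring
  have e2 : ∫ x, χ x * ∫ y, (θ x - θ y) * χ' y ∂σ ∂σ
      = nodalMass σ T p * nodalMass σ T q * (clement σ T θ p - clement σ T θ q) := by
    simp only [e1]
    have h2 : ∫ x, θ x * χ x ∂σ = nodalMass σ T p * clement σ T θ p := by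
      rw [clement, mul_div_cancel₀ _ hp.ne']
    have h3 : ∀ x, χ x * (nodalMass σ T q * (θ x - clement σ T θ q))
        = nodalMass σ T q * (θ x * χ x) - nodalMass σ T q * clement σ T θ q * χ x := fun x => by ring
    simp only [h3]
    rw [integral_sub (hip.const_mul _) (hcp.const_mul _), integral_const_mul, integral_const_mul, h2]
    simp only [nodalMass]
    ring
  have hle : ∀ (p : E d) (B : Set (E d)), (∀ x ∈ S, x ∉ B → nodalBasis T p x = 0) →
      ∀ x ∈ S, ‖nodalBasis T p x‖ₑ ≤ B.indicator 1 x := by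
    intro p B hpB x hx
    by_cases hxB : x ∈ B
    · rw [indicator_of_mem hxB, ← ofReal_norm, Real.norm_of_nonneg (H.tri.nodalBasis_nonneg p hx)]
      exact ENNReal.ofReal_le_one.2 (H.tri.nodalBasis_le_one p hx)
    · rw [hpB x hx hxB]; simp
  have h1 : ‖nodalMass σ T p * nodalMass σ T q * (clement σ T θ p - clement σ T θ q)‖ₑ
      ≤ ∫⁻ x in B, (∫⁻ y in B, ‖θ x - θ y‖ₑ ∂σ) ∂σ := by
    rw [← e2, ← lintegral_indicator hB]
    refine (enorm_integral_le_lintegral_enorm _).trans (lintegral_mono_ae ?_)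
    filter_upwards [H.ae_mem] with x hx
    have h2 : ‖∫ y, (θ x - θ y) * χ' y ∂σ‖ₑ ≤ ∫⁻ y in B, ‖θ x - θ y‖ₑ ∂σ := by
      rw [← lintegral_indicator hB]
      refine (enorm_integral_le_lintegral_enorm _).trans (lintegral_mono_ae ?_)
      filter_upwards [H.ae_mem] with y hy
      rw [enorm_mul]
      refine (mul_le_mul_right (hle q B hqB y hy) _).trans (le_of_eq ?_)
      by_cases hyB : y ∈ B <;> simp [hyB]
    rw [enorm_mul]
    refine (mul_le_mul' (hle p B hpB x hx) h2).trans (le_of_eq ?_)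
    by_cases hxB : x ∈ B <;> simp [hxB]
  have hm2 : AEMeasurable (fun z : E d × E d => ‖θ z.1 - θ z.2‖ₑ)
      ((σ.restrict B).prod (σ.restrict B)) :=
    ((hθ.restrict.aestronglyMeasurable.comp_fst).sub
      (hθ.restrict.aestronglyMeasurable.comp_snd)).enorm
  have h2 : (∫⁻ x in B, (∫⁻ y in B, ‖θ x - θ y‖ₑ ∂σ) ∂σ) ^ 2
      ≤ σ B ^ 2 * ∫⁻ x in B, (∫⁻ y in B, ‖θ x - θ y‖ₑ ^ 2 ∂σ) ∂σ := by
    refine (lintegral_sq_le hm2.lintegral_prod_right').trans ?_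
    rw [Measure.restrict_apply_univ, sq (σ B), mul_assoc]
    refine mul_le_mul_right ?_ _
    rw [← lintegral_const_mul' (σ B) _ (measure_ne_top _ _)]
    refine lintegral_mono fun x => ?_
    refine (lintegral_sq_le (μ := σ.restrict B) (f := fun y => ‖θ x - θ y‖ₑ)
      (aestronglyMeasurable_const.sub hθ.restrict.aestronglyMeasurable).enorm).trans (le_of_eq ?_)
    rw [Measure.restrict_apply_univ]
  refine le_trans (le_of_eq ?_) ((pow_le_pow_left' h1 2).trans h2)
  rw [← ENNReal.ofReal_mul (by positivity), ← mul_pow, ← sq_abs, ENNReal.ofReal_pow (abs_nonneg _),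
    ← Real.norm_eq_abs, ofReal_norm]

end FEMeasure

/-! ### Stability of the quasi-interpolant -/

namespace FEMeasure

variable {k : ℕ} {T : Finset (Finset (E d))} {S : Set (E d)} {ρ h : ℝ} {σ : Measure (E d)}
  {D : (E d → ℝ) → E d → E d} {IsGrad : (E d → ℝ) → (E d → E d) → Prop} {A K t₀ : ℝ}

/-- The number of simplices close to a point is bounded by shape regularity. -/
theorem card_filter_mul_le (H : FEMeasure k T S ρ h σ D) (hρ : 0 < ρ) (hh : 0 < h)
    (hσ : ∀ s ∈ T, σ.restrict (hull s) = (μHE[k] : Measure (E d)).restrict (hull s))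
    (P : PoincareMeasure k S σ IsGrad A K t₀) (hA : 0 ≤ A) {L : ℝ} (hL : 0 ≤ L) (x : E d)
    {I : Finset (Finset (E d))} (hIT : I ⊆ T) (hI : ∀ s ∈ I, hull s ⊆ Metric.ball x (L * h)) :
    (I.card : ℝ) * ((ρ * h) ^ k * unitVol k) ≤ A * (L * h) ^ k := by
  have hv := unitVol_pos k
  have h1 : ∑ s ∈ I, σ (hull s) ≤ σ (Metric.ball x (L * h)) := by
    conv_rhs => rw [H.eq_sum_restrict]
    rw [Measure.finsetSum_apply]
    refine (Finset.sum_le_sum fun s hs => ?_).trans (Finset.sum_le_sum_of_subset hIT)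
    rw [Measure.restrict_apply Metric.isOpen_ball.measurableSet, inter_eq_right.2 (hI s hs)]
  have h2 : ∑ s ∈ I, ENNReal.ofReal ((ρ * h) ^ k * unitVol k) ≤ ∑ s ∈ I, σ (hull s) := by
    refine Finset.sum_le_sum fun s hs => ?_
    obtain ⟨y, hy, hball⟩ := H.tri.containsBall s (hIT hs)
    rw [← H.measure_closedBall_inter hσ (hIT hs) hy (by positivity) hball]
    exact measure_mono hball
  have h3 := (h2.trans h1).trans (P.growth x (L * h) (by positivity))
  rw [Finset.sum_const, nsmul_eq_mul, ← ENNReal.ofReal_natCast, ← ENNReal.ofReal_mul (by positivity)]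
    at h3
  exact (ENNReal.ofReal_le_ofReal_iff (by positivity)).1 h3

theorem hull_subset_ball (H : FEMeasure k T S ρ h σ D) {s : Finset (E d)} (hs : s ∈ T) {p x : E d}
    (hp : p ∈ s) {t L : ℝ} (hpx : dist p x < t) (hL : h + t ≤ L) : hull s ⊆ Metric.ball x L := by
  intro y hy
  have h1 := H.tri.dist_le hs hy (mem_hull_of_mem hp)
  have h2 := dist_triangle y p x
  rw [Metric.mem_ball]
  linarith

/-- A simplex whose ball contains `x` lies within `(L + 1) * h` of `x`, so every point belongs to
boundedly many balls. -/
theorem sum_lintegral_ball_le (H : FEMeasure k T S ρ h σ D) (hρ : 0 < ρ) (hh : 0 < h)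
    (hσ : ∀ s ∈ T, σ.restrict (hull s) = (μHE[k] : Measure (E d)).restrict (hull s))
    (P : PoincareMeasure k S σ IsGrad A K t₀) (hA : 0 ≤ A) {L : ℝ} (hL : 0 ≤ L) {f : E d → ℝ≥0∞}
    (hf : AEMeasurable f σ) {c : Finset (E d) → E d} (hc : ∀ s ∈ T, c s ∈ s) :
    ∑ s ∈ T, ∫⁻ x in Metric.ball (c s) (L * h), f x ∂σ
      ≤ ENNReal.ofReal (A * (L + 1) ^ k / (ρ ^ k * unitVol k)) * ∫⁻ x, f x ∂σ := by
  classical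
  have hv := unitVol_pos k
  have hbm : ∀ s, MeasurableSet (Metric.ball (c s) (L * h)) := fun s =>
    Metric.isOpen_ball.measurableSet
  simp only [← lintegral_indicator (hbm _)]
  rw [← lintegral_finsetSum' _ fun s _ => hf.indicator (hbm s),
    ← lintegral_const_mul' _ _ ENNReal.ofReal_ne_top]
  refine lintegral_mono fun x => ?_
  simp only [indicator_apply]
  rw [← Finset.sum_filter, Finset.sum_const, nsmul_eq_mul, ← ENNReal.ofReal_natCast]
  refine mul_le_mul_left (ENNReal.ofReal_le_ofReal ?_) _
  have h1 := H.card_filter_mul_le hρ hh hσ P hA (L := L + 1) (by positivity) x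
    (I := T.filter fun s => x ∈ Metric.ball (c s) (L * h)) (Finset.filter_subset _ _) fun s hs => by
      obtain ⟨hs, hx⟩ := Finset.mem_filter.1 hs
      exact H.hull_subset_ball hs (hc s hs) (Metric.mem_ball'.1 hx) (le_of_eq (by ring))
  rw [le_div_iff₀ (by positivity)]
  rw [mul_pow, mul_pow] at h1
  have hhk : 0 < h ^ k := by positivity
  refine le_of_mul_le_mul_right ?_ hhk
  linarith

/-- On each simplex the gradient is bounded by a nodal difference over `2 * (ρ * h)`, and the latter
by Poincaré's inequality on a ball about a vertex. The powers of `h` balance: `4 * k + 2` from the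
measures and Poincaré against the fourth power of the masses and the squared mesh size. -/
theorem ofReal_dirichletForm_clement_le (H : FEMeasure k T S ρ h σ D) (hk : 1 ≤ k) (hρ : 0 < ρ)
    (hh : 0 < h)
    (hσ : ∀ s ∈ T, σ.restrict (hull s) = (μHE[k] : Measure (E d)).restrict (hull s))
    (P : PoincareMeasure k S σ IsGrad A K t₀) (hA : 0 < A) (hK : 0 ≤ K) (ht₀ : 3 * h ≤ t₀)
    {θ : E d → ℝ} {g : E d → E d} (hθ : IsGrad θ g) :
    ENNReal.ofReal (dirichletForm σ T (clement σ T θ) (clement σ T θ))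
      ≤ ENNReal.ofReal (A ^ 4 * 3 ^ (4 * k + 2)
          / ((ρ / 2 * ((ρ / 2) ^ k * unitVol k)) ^ 4 * (2 * ρ) ^ 2)
          * (A * (K * 3 + 1) ^ k / (ρ ^ k * unitVol k))) * ∫⁻ x, ‖g x‖ₑ ^ 2 ∂σ := by
  have hfin := H.finite
  have hv := unitVol_pos k
  set c₀ := ρ / 2 * ((ρ / 2) ^ k * unitVol k) with hc₀
  have hc₀p : 0 < c₀ := by positivity
  set Q := clement σ T θ with hQ
  have hθi : Integrable θ σ := (P.memLp θ g hθ).integrable (by norm_num)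
  have hmass : ∀ p ∈ verts T, c₀ * h ^ k ≤ nodalMass σ T p := fun p hp =>
    H.le_nodalMass hk hρ hh hσ hp
  have hne : ∀ s ∈ T, s.Nonempty := fun s hs => Finset.card_pos.1 (by rw [H.tri.card_eq s hs]; omega)
  have hex : ∀ s : Finset (E d), ∃ c : E d, s ∈ T → c ∈ s := fun s => by
    by_cases hs : s ∈ T
    · obtain ⟨c, hc⟩ := hne s hs
      exact ⟨c, fun _ => hc⟩
    · exact ⟨0, fun h => absurd h hs⟩
  choose c hc using hex
  have hterm : ∀ s ∈ T, ENNReal.ofReal (σ.real (hull s) * inner ℝ (locGrad s Q) (locGrad s Q))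
      ≤ ENNReal.ofReal (A ^ 4 * 3 ^ (4 * k + 2) / (c₀ ^ 4 * (2 * ρ) ^ 2))
        * ∫⁻ x in Metric.ball (c s) (K * 3 * h), ‖g x‖ₑ ^ 2 ∂σ := by
    intro s hs
    obtain ⟨x, hx, hball⟩ := H.tri.containsBall s hs
    obtain ⟨p, hp, q, hq, hpq⟩ := exists_norm_locGrad_le (H.tri.affineIndependent s hs) (hne s hs)
      (mul_pos hρ hh) hx hball Q
    have hpv : p ∈ verts T := mem_verts.2 ⟨s, hs, hp⟩
    have hqv : q ∈ verts T := mem_verts.2 ⟨s, hs, hq⟩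
    -- The supports reach at most `h` from `p`, hence `2 * h` from `c s`; the radius `3 * h` leaves
    -- room for an open ball.
    have hsupp : ∀ p ∈ s, ∀ y ∈ S, y ∉ Metric.ball (c s) (3 * h) → nodalBasis T p y = 0 := by
      intro p hp y hy hyB
      refine H.tri.nodalBasis_eq_zero hy ?_
      by_contra hcon
      refine hyB ?_
      have h1 := H.tri.dist_le hs (mem_hull_of_mem hp) (mem_hull_of_mem (hc s hs))
      have h2 := dist_triangle y p (c s)
      rw [Metric.mem_ball]
      linarith
    have hB := P.growth (c s) (3 * h) (by positivity)
    have hhull : σ (hull s) ≤ ENNReal.ofReal (A * (3 * h) ^ k) :=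
      (measure_mono (H.hull_subset_ball hs (hc s hs) (t := h) (by simpa using hh)
        (by linarith))).trans hB
    have h1 := H.mul_enorm_clement_sub_sq_le hθi
      ((by positivity : 0 < c₀ * h ^ k).trans_le (hmass p hpv))
      ((by positivity : 0 < c₀ * h ^ k).trans_le (hmass q hqv))
      Metric.isOpen_ball.measurableSet (hsupp p hp) (hsupp q hq)
    have h2 := P.poincare θ g hθ (c s)
      (H.tri.mem_of_mem_verts (mem_verts.2 ⟨s, hs, hc s hs⟩)) (3 * h) (by positivity) ht₀
    rw [← mul_assoc K] at h2
    set G := ∫⁻ x in Metric.ball (c s) (K * 3 * h), ‖g x‖ₑ ^ 2 ∂σ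
    have h3 : ENNReal.ofReal (((c₀ * h ^ k) * (c₀ * h ^ k)) ^ 2)
        * ENNReal.ofReal ((2 * (ρ * h) * ‖locGrad s Q‖) ^ 2)
        ≤ ENNReal.ofReal (A * (3 * h) ^ k) ^ 2 * (ENNReal.ofReal (A * (3 * h) ^ (k + 2)) * G) := by
      refine le_trans ?_ (h1.trans (mul_le_mul' (pow_le_pow_left' hB 2) h2))
      refine mul_le_mul' (ENNReal.ofReal_le_ofReal ?_) (ENNReal.ofReal_le_ofReal ?_)
      · exact pow_le_pow_left₀ (by positivity) (mul_le_mul (hmass p hpv) (hmass q hqv)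
          (by positivity) (H.nodalMass_nonneg p)) 2
      · exact pow_le_pow_left₀ (by positivity) hpq 2
    rw [real_inner_self_eq_norm_sq, ENNReal.ofReal_mul measureReal_nonneg,
      ofReal_measureReal (measure_ne_top _ _)]
    refine le_of_ofReal_mul_le
      (a := ((c₀ * h ^ k) * (c₀ * h ^ k)) ^ 2 * (2 * (ρ * h)) ^ 2) (by positivity) ?_
    rw [mul_pow (2 * (ρ * h)), ENNReal.ofReal_mul (by positivity), ← mul_assoc] at h3
    rw [← ENNReal.ofReal_mul (by positivity)] at h3
    calc _ = σ (hull s) * (ENNReal.ofReal ((c₀ * h ^ k * (c₀ * h ^ k)) ^ 2 * (2 * (ρ * h)) ^ 2)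
          * ENNReal.ofReal (‖locGrad s Q‖ ^ 2)) := by ring
      _ ≤ _ := mul_le_mul' hhull h3
      _ = _ := by
        rw [← ENNReal.ofReal_pow (by positivity), ← mul_assoc, ← mul_assoc,
          ← ENNReal.ofReal_mul (by positivity), ← ENNReal.ofReal_mul (by positivity)]
        congr 2
        rw [mul_pow 3 h k, mul_pow 3 h (k + 2), pow_add 3 (4 * k) 2, pow_mul' 3 4 k, pow_add 3 k 2,
          pow_add h k 2]
        field_simp
  have hgm : AEMeasurable (fun x => ‖g x‖ₑ ^ 2) σ :=
    (P.memLp_grad θ g hθ).aestronglyMeasurable.enorm.pow_const 2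
  have hsum := H.sum_lintegral_ball_le hρ hh hσ P hA.le (L := K * 3) (by positivity) hgm hc
  rw [dirichletForm, ENNReal.ofReal_sum_of_nonneg fun s _ =>
    mul_nonneg measureReal_nonneg real_inner_self_nonneg]
  refine (Finset.sum_le_sum hterm).trans ?_
  rw [← Finset.mul_sum, ENNReal.ofReal_mul (by positivity), mul_assoc (ENNReal.ofReal _)]
  exact mul_le_mul_right hsum _

/-- The functional `θ ↦ ∫ f θ` for a finite element function `f` that is the discrete Laplacian of a
finite element function `w`. -/
theorem abs_integral_mul_le (H : FEMeasure k T S ρ h σ D)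
    (hm : ∀ p ∈ verts T, nodalMass σ T p ≠ 0) {f w θ : E d → ℝ} {g : E d → E d} (hf : IsFE T f)
    (hθ : Integrable θ σ) (hg : MemLp g 2 σ) {C m : ℝ} (hC : 0 ≤ C)
    (hst : ENNReal.ofReal (dirichletForm σ T (clement σ T θ) (clement σ T θ))
      ≤ ENNReal.ofReal C * ∫⁻ x, ‖g x‖ₑ ^ 2 ∂σ)
    (h1 : ∫ x, θ x ^ 2 ∂σ + ∫ x, ‖g x‖ ^ 2 ∂σ ≤ 1)
    (hfw : ∑ p ∈ verts T, f p * clement σ T θ p * nodalMass σ T p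
      = -(m * dirichletForm σ T w (clement σ T θ))) :
    |∫ x, f x * θ x ∂σ| ≤ √(m ^ 2 * C * dirichletForm σ T w w) := by
  have h2 : ∫⁻ x, ‖g x‖ₑ ^ 2 ∂σ ≤ 1 := by
    have h3 : ∫⁻ x, ‖g x‖ₑ ^ 2 ∂σ = ENNReal.ofReal (∫ x, ‖g x‖ ^ 2 ∂σ) := by
      rw [ofReal_integral_eq_lintegral_ofReal hg.norm.integrable_sq
        (Eventually.of_forall fun x => by positivity)]
      refine lintegral_congr fun x => ?_
      rw [ENNReal.ofReal_pow (norm_nonneg _), ofReal_norm]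
    rw [h3]
    refine ENNReal.ofReal_le_one.2 ?_
    have : 0 ≤ ∫ x, θ x ^ 2 ∂σ := integral_nonneg fun x => sq_nonneg _
    linarith
  have h4 : dirichletForm σ T (clement σ T θ) (clement σ T θ) ≤ C := by
    have h5 := hst.trans (mul_le_mul_right h2 _)
    rw [mul_one] at h5
    exact (ENNReal.ofReal_le_ofReal_iff hC).1 h5
  rw [H.integral_mul_eq_sum_clement hm hf hθ, hfw, abs_neg]
  refine Real.abs_le_sqrt ?_
  rw [mul_pow, mul_assoc]
  refine mul_le_mul_of_nonneg_left ?_ (sq_nonneg m)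
  refine (dirichletForm_sq_le σ T w _).trans ?_
  rw [mul_comm C]
  exact mul_le_mul_of_nonneg_left h4 (dirichletForm_self_nonneg σ T w)

end FEMeasure

theorem sq_le_ofReal_of_le_ofReal_sqrt {x : ℝ≥0∞} {a : ℝ} (ha : 0 ≤ a)
    (hx : x ≤ ENNReal.ofReal (√a)) : x ^ 2 ≤ ENNReal.ofReal a := by
  refine (pow_le_pow_left' hx 2).trans (le_of_eq ?_)
  rw [← ENNReal.ofReal_pow (Real.sqrt_nonneg _), Real.sq_sqrt ha]

/-! ### The time derivative in the dual norms -/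

namespace FEMeasure

variable {k : ℕ} {T : Finset (Finset (E d))} {S : Set (E d)} {ρ h : ℝ} {σ : Measure (E d)}
  {D : (E d → ℝ) → E d → E d} {IsGrad : (E d → ℝ) → (E d → E d) → Prop} {A K t₀ : ℝ}

theorem sum_diffQuot_mul_eq (H : FEMeasure k T S ρ h σ D) {m τ : ℝ} (hτ : τ ≠ 0)
    {φ : ℕ → E d → ℝ} {n : ℕ} {w θ Q : E d → ℝ} (hw : IsFE T w) (hθ : IsFE T θ)
    (hQ : ∀ p ∈ verts T, θ p = Q p)
    (heq : ∫ x, interp T (fun y => φ n y * θ y) x ∂σ + τ * m * ∫ x, inner ℝ (D w x) (D θ x) ∂σ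
      = ∫ x, interp T (fun y => φ (n - 1) y * θ y) x ∂σ) :
    ∑ p ∈ verts T, diffQuot τ φ n p * Q p * nodalMass σ T p = -(m * dirichletForm σ T w Q) := by
  rw [H.integral_interp, H.integral_interp, H.integral_inner_grad hw hθ,
    dirichletForm_congr σ H.tri.affineIndependent (v' := w) (fun _ _ => rfl) hQ] at heq
  have h1 : ∑ p ∈ verts T, diffQuot τ φ n p * Q p * nodalMass σ T p
      = τ⁻¹ * (∑ p ∈ verts T, φ n p * θ p * nodalMass σ T p
        - ∑ p ∈ verts T, φ (n - 1) p * θ p * nodalMass σ T p) := by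
    rw [← Finset.sum_sub_distrib, Finset.mul_sum]
    refine Finset.sum_congr rfl fun p hp => ?_
    rw [hQ p hp, diffQuot]
    ring
  rw [h1, ← heq]
  field_simp
  ring

/-- The stability constant of the quasi-interpolant. -/
noncomputable def clementConst (k : ℕ) (ρ A K : ℝ) : ℝ :=
  A ^ 4 * 3 ^ (4 * k + 2) / ((ρ / 2 * ((ρ / 2) ^ k * unitVol k)) ^ 4 * (2 * ρ) ^ 2)
    * (A * (K * 3 + 1) ^ k / (ρ ^ k * unitVol k))

theorem clementConst_nonneg (k : ℕ) {ρ A K : ℝ} (hρ : 0 < ρ) (hA : 0 < A) (hK : 0 ≤ K) :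
    0 ≤ clementConst k ρ A K := by
  have := unitVol_pos k
  unfold clementConst
  positivity

/-- The scheme is assumed only for some finite element function with each choice of nodal values.
This covers the boundary too, where test functions are traces of bulk functions. -/
theorem abs_integral_diffQuot_mul_le (H : FEMeasure k T S ρ h σ D) (hk : 1 ≤ k) (hρ : 0 < ρ)
    (hh : 0 < h)
    (hσ : ∀ s ∈ T, σ.restrict (hull s) = (μHE[k] : Measure (E d)).restrict (hull s))
    (P : PoincareMeasure k S σ IsGrad A K t₀) (hA : 0 < A) (hK : 0 ≤ K) (ht₀ : 3 * h ≤ t₀)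
    {m τ : ℝ} (hτ : τ ≠ 0) {φ : ℕ → E d → ℝ} {n : ℕ} {w : E d → ℝ} (hφ : IsFE T (φ n))
    (hφ' : IsFE T (φ (n - 1))) (hw : IsFE T w)
    (heq : ∀ Q : E d → ℝ, ∃ θ, IsFE T θ ∧ (∀ p ∈ verts T, θ p = Q p) ∧
      ∫ x, interp T (fun y => φ n y * θ y) x ∂σ + τ * m * ∫ x, inner ℝ (D w x) (D θ x) ∂σ
        = ∫ x, interp T (fun y => φ (n - 1) y * θ y) x ∂σ)
    {θ : E d → ℝ} {g : E d → E d} (hθ : IsGrad θ g)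
    (h1 : ∫ x, θ x ^ 2 ∂σ + ∫ x, ‖g x‖ ^ 2 ∂σ ≤ 1) :
    |∫ x, diffQuot τ φ n x * θ x ∂σ|
      ≤ √(m ^ 2 * clementConst k ρ A K * dirichletForm σ T w w) := by
  have hfin := H.finite
  have hv := unitVol_pos k
  obtain ⟨θh, hθh, hQ, he⟩ := heq (clement σ T θ)
  refine H.abs_integral_mul_le (fun p hp => ?_) ((hφ.sub hφ').const_mul τ⁻¹)
    ((P.memLp θ g hθ).integrable (by norm_num)) (P.memLp_grad θ g hθ)
    (clementConst_nonneg k hρ hA hK) (H.ofReal_dirichletForm_clement_le hk hρ hh hσ P hA hK ht₀ hθ)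
    h1 (H.sum_diffQuot_mul_eq hτ hw hθh hQ he)
  exact ((by positivity : 0 < ρ / 2 * ((ρ / 2) ^ k * unitVol k) * h ^ k).trans_le
    (H.le_nodalMass hk hρ hh hσ hp)).ne'

end FEMeasure

theorem bulk_restrict_hull {Ω : Set (E d)} (hc : Convex ℝ Ω) {s : Finset (E d)}
    (hs : hull s ⊆ closure Ω) :
    (bulk Ω).restrict (hull s) = (μHE[d] : Measure (E d)).restrict (hull s) := by
  have h1 : bulk Ω = volume.restrict (closure Ω) :=
    Measure.restrict_congr_set (closure_ae_eq_of_null_frontier (hc.addHaar_frontier volume)).symm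
  rw [h1, euclideanHausdorffMeasure_eq_volume,
    Measure.restrict_restrict (isCompact_hull s).isClosed.measurableSet, inter_eq_left.2 hs]

/-- Of the two factors `m`, one belongs to the dissipation bounded by the energy estimate and the
other stays in the constant. -/
theorem ofReal_mul_sum_sq_le {α : Type*} {I : Finset α} {x : α → ℝ≥0∞} {a : α → ℝ} {τ m C b : ℝ}
    (hτ : 0 ≤ τ) (hm : 0 ≤ m) (hC : 0 ≤ C) (ha : ∀ n ∈ I, 0 ≤ a n)
    (hx : ∀ n ∈ I, x n ≤ ENNReal.ofReal √(m ^ 2 * C * a n)) (hb : τ * ∑ n ∈ I, m * a n ≤ b) :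
    ENNReal.ofReal τ * ∑ n ∈ I, x n ^ 2 ≤ ENNReal.ofReal (m * C * b) := by
  have h0 : ∀ n ∈ I, 0 ≤ m ^ 2 * C * a n := fun n hn => mul_nonneg (by positivity) (ha n hn)
  calc ENNReal.ofReal τ * ∑ n ∈ I, x n ^ 2
      ≤ ENNReal.ofReal τ * ∑ n ∈ I, ENNReal.ofReal (m ^ 2 * C * a n) :=
        mul_le_mul_right (Finset.sum_le_sum fun n hn =>
          sq_le_ofReal_of_le_ofReal_sqrt (h0 n hn) (hx n hn)) _
    _ = ENNReal.ofReal (m * C * (τ * ∑ n ∈ I, m * a n)) := by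
        rw [← ENNReal.ofReal_sum_of_nonneg h0, ← ENNReal.ofReal_mul hτ]
        congr 1
        rw [Finset.mul_sum, Finset.mul_sum, Finset.mul_sum]
        exact Finset.sum_congr rfl fun n _ => by ring
    _ ≤ _ := ENNReal.ofReal_le_ofReal (mul_le_mul_of_nonneg_left hb (by positivity))

theorem IsMesh.verts_subset {Ω : Set (E d)} {T TΓ : Finset (Finset (E d))} {ρ h : ℝ}
    (hM : IsMesh Ω T TΓ ρ h) {p : E d} (hp : p ∈ verts TΓ) : p ∈ verts T := by
  obtain ⟨s, hs, hps⟩ := mem_verts.1 hp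
  obtain ⟨K, hK, hsK⟩ := hM.compatible s hs
  exact mem_verts.2 ⟨K, hK, hsK hps⟩

end CHDyn

theorem lemma4p2 {d : ℕ} (hd : d = 2 ∨ d = 3)
    (Ω : Set (CHDyn.E d)) (hΩ : CHDyn.IsConvexPolytopalDomain Ω)
    (tEnd m mΓ κ β : ℝ) (htEnd : 0 < tEnd) (hm : 0 < m) (hmΓ : 0 < mΓ) (hκ : 0 ≤ κ)
    (Fp Fm Gp Gm : ℝ → ℝ) (hF : CHDyn.IsPotential Fp Fm) (hG : CHDyn.IsPotential Gp Gm)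
    (hβ : 0 ≤ β) (hκβ : κ = 0 → 0 < β)
    (hGm : ∀ s₁ s₂ : ℝ, Gm s₁ - Gm s₂ + β * |s₁ - s₂| ^ 2 ≤ deriv Gm s₂ * (s₁ - s₂))
    -- a family of discretisations: mesh sizes, numbers of time steps, time increments, meshes
    {ι : Type*} (h : ι → ℝ) (N : ι → ℕ) (τ : ι → ℝ)
    (T TΓ : ι → Finset (Finset (CHDyn.E d)))
    (hh : ∀ i, 0 < h i) (hN : ∀ i, 1 ≤ N i) (hτ : ∀ i, τ i = tEnd / (N i : ℝ))
    (ρ : ℝ) (hρ : 0 < ρ) (hmesh : ∀ i, CHDyn.IsMesh Ω (T i) (TΓ i) ρ (h i))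
    -- the initial data
    (φ₀ : ι → CHDyn.E d → ℝ) (hφ₀ : ∀ i, CHDyn.IsFE (T i) (φ₀ i))
    (C₀ : ℝ) (hC₀ : ∀ i, CHDyn.initialEnergy Ω (T i) (TΓ i) κ Fp Fm Gp Gm (φ₀ i) ≤ C₀)
    -- the coupling of `h` and `τ` as both tend to zero
    (hcoup_pos : 0 < κ →
      Tendsto (fun i => h i ^ 4 / τ i) (comap (fun i => (h i, τ i)) (𝓝 (0, 0))) (𝓝 0))
    (hcoup_zero : κ = 0 →
      Tendsto (fun i => h i ^ 2 / τ i) (comap (fun i => (h i, τ i)) (𝓝 (0, 0))) (𝓝 0)) :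
    ∃ h₀ > (0 : ℝ), ∃ C > (0 : ℝ), ∀ i, h i ≤ h₀ →
      ∀ φ μ μΓ : ℕ → CHDyn.E d → ℝ, φ 0 = φ₀ i →
        CHDyn.IsDiscreteSolution Ω (T i) (TΓ i) m mΓ κ (τ i) Fp Fm Gp Gm (N i) φ μ μΓ →
        ENNReal.ofReal (τ i) * ∑ n ∈ Finset.Icc 1 (N i),
            CHDyn.dualNormBulk Ω (CHDyn.diffQuot (τ i) φ n) ^ 2 ≤ ENNReal.ofReal C ∧
        ENNReal.ofReal (τ i) * ∑ n ∈ Finset.Icc 1 (N i),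
            CHDyn.dualNormSurf Ω (CHDyn.diffQuot (τ i) φ n) ^ 2 ≤ ENNReal.ofReal C := by
  open CHDyn in
  have hd2 : 2 ≤ d := by omega
  have ho := hΩ.isOpen
  have hc := hΩ.convex
  have hb := hΩ.isBounded
  obtain ⟨c, hcΩ⟩ := hΩ.1
  obtain ⟨r, hr, hball⟩ := Metric.isOpen_iff.1 ho c hcΩ
  obtain ⟨R, hR, hΩR⟩ := hb.closure.subset_closedBall_lt 0 c
  have hfr : ∀ x ∈ frontier Ω, dist x c ≤ R := fun x hx => hΩR (frontier_subset_closure hx)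
  obtain ⟨cF, hcF0, hcF⟩ := hF.bddBelow
  obtain ⟨cG, hcG0, hcG⟩ := hG.bddBelow
  have hv := unitVol_pos d
  set As := max ((1 + R) ^ d * unitVol d / r) ((2 * (1 + R)) ^ (d + 3) * unitVol d
    * (R * (3 / 2) ^ (d - 1)) * (2 * (1 + R / r)) ^ 2 / r ^ 3) with hAs
  have hAs0 : 0 < As := lt_max_of_lt_left (by positivity)
  set Ks := (R / r + 1) * (1 + R)
  have hKs0 : 0 ≤ Ks := by positivity
  set B := |C₀ + cF * (bulk Ω).real univ + cG * (surf Ω).real univ|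
  set Cb := FEMeasure.clementConst d ρ (2 ^ (d + 2) * unitVol d) 1
  set Cs := FEMeasure.clementConst (d - 1) ρ As Ks
  have hCb : 0 ≤ Cb := FEMeasure.clementConst_nonneg d hρ (by positivity) zero_le_one
  have hCs : 0 ≤ Cs := FEMeasure.clementConst_nonneg (d - 1) hρ hAs0 hKs0
  have hB : 0 ≤ B := abs_nonneg _
  -- The threshold makes `3 * h` an admissible radius for Poincaré's inequality on Γ. One constant
  -- serves both estimates; the summand one makes it positive.
  refine ⟨r / 2 / (1 + R) / 3, by positivity, m * Cb * B + mΓ * Cs * B + 1, by positivity, ?_⟩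
  intro i hi φ μ μΓ hφ0 hsol
  have hM := hmesh i
  have hτ0 : 0 < τ i := by
    rw [hτ i]
    exact div_pos htEnd (by exact_mod_cast hN i)
  have H := bulk_feMeasure (by omega) hb hM.bulk
  have HΓ := surf_feMeasure hd2 ho hc hΩ.1 hM.surf
  obtain ⟨ν, hν⟩ := exists_radialSurface hd2 ho hc hb hr hball hfr hM.surf (mul_pos hρ (hh i))
  -- In the bulk the radius bound is free, so it is set to what the quasi-interpolant needs.
  have P := bulk_poincareMeasure ho hc (3 * h i)
  have PΓ := hν.poincareMeasure hd2 hR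
  have hE := energy_estimate H HΓ hM hκ hF hG hsol (hφ0 ▸ hC₀ i) hcF hcG
  replace hE := hE.trans (le_abs_self _)
  -- The bulk and surface dissipation are both nonnegative, so each alone is bounded by `B`.
  rw [Finset.sum_add_distrib, mul_add] at hE
  have ha : ∀ n, 0 ≤ dirichletForm (bulk Ω) (T i) (μ n) (μ n) := fun n =>
    dirichletForm_self_nonneg _ _ _
  have haΓ : ∀ n, 0 ≤ dirichletForm (surf Ω) (TΓ i) (μΓ n) (μΓ n) := fun n =>
    dirichletForm_self_nonneg _ _ _
  have hE1 : 0 ≤ τ i * ∑ n ∈ Finset.Icc 1 (N i), m * dirichletForm (bulk Ω) (T i) (μ n) (μ n) :=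
    mul_nonneg hτ0.le (Finset.sum_nonneg fun n _ => mul_nonneg hm.le (ha n))
  have hE2 : 0 ≤ τ i * ∑ n ∈ Finset.Icc 1 (N i),
      mΓ * dirichletForm (surf Ω) (TΓ i) (μΓ n) (μΓ n) :=
    mul_nonneg hτ0.le (Finset.sum_nonneg fun n _ => mul_nonneg hmΓ.le (haΓ n))
  have hφn : ∀ n ∈ Finset.Icc 1 (N i), IsFE (T i) (φ n) ∧ IsFE (T i) (φ (n - 1)) := fun n hn =>
    ⟨hsol.phi_mem n (Finset.mem_Icc.1 hn).2,
      hsol.phi_mem (n - 1) ((Nat.sub_le _ _).trans (Finset.mem_Icc.1 hn).2)⟩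
  constructor
  · refine (ofReal_mul_sum_sq_le hτ0.le hm.le hCb (fun n _ => ha n) (fun n hn => ?_)
      (by linarith : _ ≤ B)).trans (ENNReal.ofReal_le_ofReal ?_)
    · refine iSup_le fun θ => iSup_le fun g => iSup_le fun hθ => iSup_le fun h1 =>
        ENNReal.ofReal_le_ofReal ?_
      refine H.abs_integral_diffQuot_mul_le (by omega) hρ (hh i)
        (fun s hs => bulk_restrict_hull hc (hM.bulk.hull_subset hs)) P (by positivity) zero_le_one
        le_rfl hτ0.ne' (hφn n hn).1 (hφn n hn).2 (hsol.mu_mem n hn) (fun Q => ?_) hθ h1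
      obtain ⟨θh, hθh, hQ⟩ := hM.bulk.exists_isFE Q
      exact ⟨θh, hθh, hQ, hsol.eq_bulk n hn θh hθh⟩
    · have : 0 ≤ mΓ * Cs * B := by positivity
      linarith
  · refine (ofReal_mul_sum_sq_le hτ0.le hmΓ.le hCs (fun n _ => haΓ n) (fun n hn => ?_)
      (by linarith : _ ≤ B)).trans (ENNReal.ofReal_le_ofReal ?_)
    · refine iSup_le fun θ => iSup_le fun g => iSup_le fun hθ => iSup_le fun h1 =>
        ENNReal.ofReal_le_ofReal ?_
      refine HΓ.abs_integral_diffQuot_mul_le (by omega) hρ (hh i)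
        (fun s hs => surf_restrict_hull (hM.surf.hull_subset hs)) PΓ hAs0 hKs0
        (by linarith) hτ0.ne' (hM.isFE_surf (hφn n hn).1) (hM.isFE_surf (hφn n hn).2)
        (hsol.muG_mem n hn) (fun Q => ?_) hθ h1
      -- Boundary vertices are vertices of the bulk mesh, so prescribed boundary values are attained
      -- by a bulk function, with which the surface equation may be tested.
      obtain ⟨θh, hθh, hQ⟩ := hM.bulk.exists_isFE Q
      exact ⟨θh, hM.isFE_surf hθh, fun p hp => hQ p (hM.verts_subset hp),
        hsol.eq_surf n hn θh hθh⟩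
    · have : 0 ≤ m * Cb * B := by positivity
      linarith
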